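/- **Setting.** Let $U$ be a compact metric space, let $f:\mathbb R^m\times U\to\mathbb R^m$ be continuous and Lipschitz in $y$ uniformly in $u\in U$, and let $k:\mathbb R^m\times U\to\mathbb R$ be continuous. For a measurable control $u:[0,\infty)\to U$ and $y_0\in\mathbb R^m$, let $y(\cdot,y_0,u)$ be the solution of $y'(t)=f(y(t),u(t))$, $y(0)=y_0$. Let $Y\subset\mathbb R^m$ be non-empty, compact and equal to the closure of its interior, and let $\mathcal U_T(y_0)$ (respectively $\mathcal U(y_0)$) be the set of controls with $y(t,y_0,u)\in Y$ for all $t\in[0,T]$ (respectively all $t\ge 0$). Assume that $\mathcal U(y_0)\ne\emptyset$ for all $y_0\in Y$. For $T,\lambda>0$ and $y_0\in Y$ put $$V_T(y_0)=\frac1T\inf_{u\in\mathcal U_T(y_0)}\int_0^T k(y(t,y_0,u),u(t))\,dt,\qquad h_\lambda(y_0)=\lambda\inf_{u\in\mathcal U(y_0)}\int_0^\infty e^{-\lambda t}k(y(t,y_0,u),u(t))\,dt .$$ Let $d^*(y_0)$ be the supremum of all $\mu\in\mathbb R$ for which there are $\psi,\eta\in C^1(\mathbb R^m)$ such that, for all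 $(y,u)\in Y\times U$, $$k(y,u)+\psi(y_0)-\psi(y)+\nabla\eta(y)f(y,u)-\mu\ge 0,\qquad \nabla\psi(y)f(y,u)\ge 0 .$$ Let $\Gamma_T$ be the set of the occupational measures $\gamma(Q)=\frac1T\int_0^T 1_Q(y(t),u(t))\,dt$ on $Y\times U$ with $y_0\in Y$, $u\in\mathcal U_T(y_0)$, $y(\cdot)=y(\cdot,y_0,u)$. Let $\Theta^\lambda$ be the set of the discounted occupational measures $\gamma(Q)=\lambda\int_0^\infty e^{-\lambda t}1_Q(y(t),u(t))\,dt$ with $y_0\in Y$, $u\in\mathcal U(y_0)$. Let $W$ be the set of Borel probability measures $\gamma$ on $Y\times U$ with $\int\nabla\varphi(y)f(y,u)\,\gamma(dy,du)=0$ for all $\varphi\in C^1(\mathbb R^m)$. Fix a sequence $q_1,q_2,\dots$ of Lipschitz functions dense in the unit ball of $C(Y\times U)$, let $\rho(\gamma,\gamma')=\sum_{j\ge1}2^{-j}\left|\int q_j\,d\gamma-\int q_j\,d\gamma'\right|$, and let $\rho_H$ be the Hausdorff distance given by $\rho$; $\mathrm{co}$ denotes the convex hull. A function $F:Y\to\mathbb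 R$ is called $C^1$ up to the boundary of $Y$ if it is continuously differentiable in the interior of $Y$, $\nabla F$ extends to a continuous function $G$ on $Y$, and $F(z)=F(y)+G(y)(z-y)+o(|z-y|)$ as $|z-y|\to 0$, uniformly over $y,z\in Y$. **Theorem.** (a) Suppose that $V_T$ is continuous on $Y$ for every $T>0$ and $\lim_{T\to\infty}\rho_H(\mathrm{co}\,\Gamma_T,W)=0$. If the pointwise limit $V(y_0)=\lim_{T\to\infty}V_T(y_0)$ exists for all $y_0\in Y$ and $V$ is $C^1$ up to the boundary of $Y$, then $V(y_0)=d^*(y_0)$ for all $y_0\in Y$. (b) Suppose that $h_\lambda$ is continuous on $Y$ for every $\lambda>0$ and $\lim_{\lambda\downarrow0}\rho_H(\mathrm{co}\,\Theta^\lambda,W)=0$. If the pointwise limit $h(y_0)=\lim_{\lambda\downarrow0}h_\lambda(y_0)$ exists for all $y_0\in Y$ and $h$ is $C^1$ up to the boundary of $Y$, then $h(y_0)=d^*(y_0)$ for all $y_0\in Y$. (c) Consequently, if the assumptions of both (a) and (b) hold, then $V(y_0)=h(y_0)$ for all $y_0\in Y$. Neither uniform convergence of $V_T$, $h_\lambda$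 nor equality of $d^*$ with the optimal value of the primal linear program is assumed. -/

import Mathlib

open MeasureTheory Set Filter Topology
open scoped NNReal ENNReal

noncomputable section

namespace OptControl

/-- `y` is the solution on `[0, ∞)` of `y' = f (y, u)`, `y 0 = y₀` for the control `u`
(a continuous function satisfying the integral equation, i.e. an absolutely continuous solution).
Only the values of `u` and `y` at times `t ≥ 0` matter. -/
def IsTrajectory {m : ℕ} {U : Type*}
    (f : EuclideanSpace ℝ (Fin m) → U → EuclideanSpace ℝ (Fin m))
    (y₀ : EuclideanSpace ℝ (Fin m)) (u : ℝ → U) (y : ℝ → EuclideanSpace ℝ (Fin m)) : Prop :=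
  ContinuousOn y (Ici 0) ∧ ∀ t : ℝ, 0 ≤ t → y t = y₀ + ∫ s in (0 : ℝ)..t, f (y s) (u s)

/-- The pairs (trajectory, control) starting at `y₀` that satisfy the state constraint `y t ∈ Y`
for all `t` in the set of times `I`.  The controls occurring here form the set `𝒰_T(y₀)` for
`I = [0, T]`, and the set `𝒰(y₀)` for `I = [0, ∞)`. -/
def admissible {m : ℕ} {U : Type*} [MeasurableSpace U]
    (f : EuclideanSpace ℝ (Fin m) → U → EuclideanSpace ℝ (Fin m))
    (Y : Set (EuclideanSpace ℝ (Fin m))) (I : Set ℝ) (y₀ : EuclideanSpace ℝ (Fin m)) :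
    Set ((ℝ → EuclideanSpace ℝ (Fin m)) × (ℝ → U)) :=
  {p | Measurable p.2 ∧ IsTrajectory f y₀ p.2 p.1 ∧ ∀ t ∈ I, p.1 t ∈ Y}

/-- `V_T(y₀)`. -/
def cesaroValue {m : ℕ} {U : Type*} [MeasurableSpace U]
    (f : EuclideanSpace ℝ (Fin m) → U → EuclideanSpace ℝ (Fin m))
    (k : EuclideanSpace ℝ (Fin m) → U → ℝ) (Y : Set (EuclideanSpace ℝ (Fin m)))
    (T : ℝ) (y₀ : EuclideanSpace ℝ (Fin m)) : ℝ :=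
  1 / T * sInf ((fun p => ∫ t in (0 : ℝ)..T, k (p.1 t) (p.2 t)) '' admissible f Y (Icc 0 T) y₀)

/-- `h_lam(y₀)`. -/
def abelValue {m : ℕ} {U : Type*} [MeasurableSpace U]
    (f : EuclideanSpace ℝ (Fin m) → U → EuclideanSpace ℝ (Fin m))
    (k : EuclideanSpace ℝ (Fin m) → U → ℝ) (Y : Set (EuclideanSpace ℝ (Fin m)))
    (lam : ℝ) (y₀ : EuclideanSpace ℝ (Fin m)) : ℝ :=
  lam * sInf ((fun p => ∫ t in Ioi (0 : ℝ), Real.exp (-lam * t) * k (p.1 t) (p.2 t)) ''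
    admissible f Y (Ici 0) y₀)

/-- The set of the numbers `μ` for which some triplet `(μ, ψ, η)` is feasible in the dual problem
with initial condition `y₀`. -/
def dualFeasibleValues {m : ℕ} {U : Type*}
    (f : EuclideanSpace ℝ (Fin m) → U → EuclideanSpace ℝ (Fin m))
    (k : EuclideanSpace ℝ (Fin m) → U → ℝ) (Y : Set (EuclideanSpace ℝ (Fin m)))
    (y₀ : EuclideanSpace ℝ (Fin m)) : Set ℝ :=
  {μ | ∃ ψ η : EuclideanSpace ℝ (Fin m) → ℝ, ContDiff ℝ 1 ψ ∧ ContDiff ℝ 1 η ∧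
    ∀ y ∈ Y, ∀ u : U,
      0 ≤ k y u + (ψ y₀ - ψ y) + fderiv ℝ η y (f y u) - μ ∧ 0 ≤ fderiv ℝ ψ y (f y u)}

/-- `d*(y₀)`, the optimal value of the dual problem (a supremum in the extended reals). -/
def dStar {m : ℕ} {U : Type*}
    (f : EuclideanSpace ℝ (Fin m) → U → EuclideanSpace ℝ (Fin m))
    (k : EuclideanSpace ℝ (Fin m) → U → ℝ) (Y : Set (EuclideanSpace ℝ (Fin m)))
    (y₀ : EuclideanSpace ℝ (Fin m)) : EReal :=
  sSup ((fun μ : ℝ => (μ : EReal)) '' dualFeasibleValues f k Y y₀)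

/-- `Γ_T`: all the occupational measures on `[0, T]` generated by admissible processes with
an initial condition in `Y`. -/
def occupMeasures {m : ℕ} {U : Type*} [MeasurableSpace U]
    (f : EuclideanSpace ℝ (Fin m) → U → EuclideanSpace ℝ (Fin m))
    (Y : Set (EuclideanSpace ℝ (Fin m))) (T : ℝ) : Set (ProbabilityMeasure (Y × U)) :=
  {γ | ∃ y₀ ∈ Y, ∃ p ∈ admissible f Y (Icc 0 T) y₀, ∀ Q : Set (Y × U), MeasurableSet Q →
    (γ : Measure (Y × U)) Q =
      ENNReal.ofReal (1 / T) *
        volume {t : ℝ | t ∈ Icc 0 T ∧ ∃ h : p.1 t ∈ Y, ((⟨p.1 t, h⟩ : Y), p.2 t) ∈ Q}}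

/-- `Θ^lam`: all the discounted occupational measures generated by admissible processes with
an initial condition in `Y`. -/
def discOccupMeasures {m : ℕ} {U : Type*} [MeasurableSpace U]
    (f : EuclideanSpace ℝ (Fin m) → U → EuclideanSpace ℝ (Fin m))
    (Y : Set (EuclideanSpace ℝ (Fin m))) (lam : ℝ) : Set (ProbabilityMeasure (Y × U)) :=
  {γ | ∃ y₀ ∈ Y, ∃ p ∈ admissible f Y (Ici 0) y₀, ∀ Q : Set (Y × U), MeasurableSet Q →
    (γ : Measure (Y × U)) Q =
      ENNReal.ofReal lam *
        ∫⁻ t in {t : ℝ | t ∈ Ici 0 ∧ ∃ h : p.1 t ∈ Y, ((⟨p.1 t, h⟩ : Y), p.2 t) ∈ Q},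
          ENNReal.ofReal (Real.exp (-lam * t))}

/-- The set `W` of probability measures on `Y × U` with `∫ ∇φ(y) f(y,u) γ(dy,du) = 0` for all
continuously differentiable `φ`. -/
def stationaryMeasures {m : ℕ} {U : Type*} [MeasurableSpace U]
    (f : EuclideanSpace ℝ (Fin m) → U → EuclideanSpace ℝ (Fin m))
    (Y : Set (EuclideanSpace ℝ (Fin m))) : Set (ProbabilityMeasure (Y × U)) :=
  {γ | ∀ φ : EuclideanSpace ℝ (Fin m) → ℝ, ContDiff ℝ 1 φ →
    ∫ p : Y × U, fderiv ℝ φ (p.1 : EuclideanSpace ℝ (Fin m))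
      (f (p.1 : EuclideanSpace ℝ (Fin m)) p.2) ∂(γ : Measure (Y × U)) = 0}

/-- The convex hull of a set of probability measures: all finite convex combinations. -/
def coMeasures {X : Type*} [MeasurableSpace X] (Γ : Set (ProbabilityMeasure X)) :
    Set (ProbabilityMeasure X) :=
  {γ | ∃ (n : ℕ) (w : Fin n → ℝ≥0) (g : Fin n → ProbabilityMeasure X),
    (∀ i, g i ∈ Γ) ∧ ∑ i, w i = 1 ∧ (γ : Measure X) = ∑ i, w i • (g i : Measure X)}

/-- `q` is a sequence of Lipschitz functions which is dense in the unit ball of `C(X)`. -/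
structure IsTestSequence {X : Type*} [PseudoMetricSpace X] (q : ℕ → X → ℝ) : Prop where
  lipschitz : ∀ j, ∃ K : ℝ≥0, LipschitzWith K (q j)
  mem_ball : ∀ j x, |q j x| ≤ 1
  dense : ∀ g : X → ℝ, Continuous g → (∀ x, |g x| ≤ 1) →
    ∀ ε : ℝ, 0 < ε → ∃ j, ∀ x, |q j x - g x| ≤ ε

/-- The metric `ρ` on probability measures given by the sequence `q`
(the sequence is indexed from `0` here, hence the exponent `j + 1`). -/
def rho {X : Type*} [MeasurableSpace X] (q : ℕ → X → ℝ) (γ γ' : ProbabilityMeasure X) : ℝ :=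
  ∑' j : ℕ, (1 / 2 : ℝ) ^ (j + 1) *
    |(∫ x, q j x ∂(γ : Measure X)) - ∫ x, q j x ∂(γ' : Measure X)|

/-- `ρ(γ, Γ) = inf_{γ' ∈ Γ} ρ(γ, γ')`. -/
def rhoToSet {X : Type*} [MeasurableSpace X] (q : ℕ → X → ℝ) (γ : ProbabilityMeasure X)
    (Γ : Set (ProbabilityMeasure X)) : ℝ :=
  sInf ((fun γ' => rho q γ γ') '' Γ)

/-- The Hausdorff distance `ρ_H` given by `ρ`. -/
def rhoHausdorff {X : Type*} [MeasurableSpace X] (q : ℕ → X → ℝ)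
    (Γ₁ Γ₂ : Set (ProbabilityMeasure X)) : ℝ :=
  max (sSup ((fun γ => rhoToSet q γ Γ₂) '' Γ₁)) (sSup ((fun γ => rhoToSet q γ Γ₁) '' Γ₂))

/-- `F` is continuously differentiable on `Y` up to the boundary: `F` is differentiable in the
interior of `Y`, its gradient there extends to a continuous `G` on `Y`, and the first-order Taylor
expansion of `F` with gradient `G` holds uniformly on `Y`.  (In particular `F` is continuous
on `Y`. For a convex compact `Y` with nonempty interior, the last clause follows from the first
two and the continuity of `F` on `Y`.) -/
def IsC1UpToBoundary {m : ℕ} (F : EuclideanSpace ℝ (Fin m) → ℝ)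
    (Y : Set (EuclideanSpace ℝ (Fin m))) : Prop :=
  ∃ G : EuclideanSpace ℝ (Fin m) → (EuclideanSpace ℝ (Fin m) →L[ℝ] ℝ),
    ContinuousOn G Y ∧
    (∀ y ∈ interior Y, HasFDerivAt F (G y) y) ∧
    ∀ ε : ℝ, 0 < ε → ∃ δ : ℝ, 0 < δ ∧ ∀ y ∈ Y, ∀ z ∈ Y, ‖z - y‖ < δ →
      |F z - F y - G y (z - y)| ≤ ε * ‖z - y‖

/-- The hypotheses on the Cesàro limit: `V_T` is continuous on `Y` for every `T > 0`,
`ρ_H(co Γ_T, W) → 0` as `T → ∞`, `V` is the pointwise limit of `V_T` on `Y`,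
and `V` is continuously differentiable up to the boundary of `Y`. -/
structure CesaroHypotheses {m : ℕ} {U : Type*} [MeasurableSpace U]
    (f : EuclideanSpace ℝ (Fin m) → U → EuclideanSpace ℝ (Fin m))
    (k : EuclideanSpace ℝ (Fin m) → U → ℝ) (Y : Set (EuclideanSpace ℝ (Fin m)))
    (q : ℕ → Y × U → ℝ) (V : EuclideanSpace ℝ (Fin m) → ℝ) : Prop where
  continuous_value : ∀ T : ℝ, 0 < T → ContinuousOn (cesaroValue f k Y T) Y
  occup_limit : Tendsto
    (fun T : ℝ => rhoHausdorff q (coMeasures (occupMeasures f Y T)) (stationaryMeasures f Y))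
    atTop (𝓝 0)
  limit : ∀ y₀ ∈ Y, Tendsto (fun T : ℝ => cesaroValue f k Y T y₀) atTop (𝓝 (V y₀))
  smooth : IsC1UpToBoundary V Y

/-- The hypotheses on the Abel limit: `h_lam` is continuous on `Y` for every `lam > 0`,
`ρ_H(co Θ^lam, W) → 0` as `lam ↓ 0`, `h` is the pointwise limit of `h_lam` on `Y`,
and `h` is continuously differentiable up to the boundary of `Y`. -/
structure AbelHypotheses {m : ℕ} {U : Type*} [MeasurableSpace U]
    (f : EuclideanSpace ℝ (Fin m) → U → EuclideanSpace ℝ (Fin m))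
    (k : EuclideanSpace ℝ (Fin m) → U → ℝ) (Y : Set (EuclideanSpace ℝ (Fin m)))
    (q : ℕ → Y × U → ℝ) (h : EuclideanSpace ℝ (Fin m) → ℝ) : Prop where
  continuous_value : ∀ lam : ℝ, 0 < lam → ContinuousOn (abelValue f k Y lam) Y
  occup_limit : Tendsto
    (fun lam : ℝ =>
      rhoHausdorff q (coMeasures (discOccupMeasures f Y lam)) (stationaryMeasures f Y))
    (𝓝[>] 0) (𝓝 0)
  limit : ∀ y₀ ∈ Y, Tendsto (fun lam : ℝ => abelValue f k Y lam y₀) (𝓝[>] 0) (𝓝 (h y₀))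
  smooth : IsC1UpToBoundary h Y

end OptControl

end

/-! Write `V` for either limit value; the two cases follow the same scheme. The claim `V = d*` is
proved by comparing `V` with the dual problem in both directions.

Every dual feasible `μ` is at most `V y₀`. Along a viable process from `y₀` the function `ψ` does
not decrease, so the term `ψ y₀ - ψ y` can be dropped and `μ ≤ k + ∇η f`. In the mean over `[0, T]`,
or over an exponential time of rate `λ`, the term `∇η f` contributes only `O(1/T)` or `O(λ)`, so `μ`
is at most the cost up to an error that vanishes in the limit (`le_cesaroLimit_of_feasible`,
`le_abelLimit_of_feasible`).

Conversely, `V y₀ - ε` is dual feasible with `ψ` a `C¹` extension of `V`. This needs two facts.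

The first is `∇V f ≥ 0` on `Y`. By dynamic programming, following a viable process for a fixed time
costs an amount that is negligible in the long-run mean, so `V` does not decrease along viable
processes. At an interior point any constant control can be used for a short time; differentiating
`V` along it at time zero gives the inequality there, and it passes to `Y = closure (interior Y)` by
continuity (`gradient_nonneg_of_mono`).

The second is some `η` with `k - V + ε + ∇η f ≥ 0`. By a Farkas lemma (Hahn-Banach and Riesz-Markov)
it exists as soon as `∫ (k - V) dγ ≥ 0` for every stationary measure `γ`. To see the latter, fix a
horizon `S` first. The bound `S V_S(y(t)) ≤ ∫ k` over `[t, t + S]`, averaged over `t ∈ [0, T]`,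
gives `∫ (k - V_S) dγ ≥ -O(S/T)` on `Γ_T`, hence on its convex hull. Since `V_S` is continuous,
letting `T → ∞` gives `∫ (k - V_S) dγ ≥ 0` on `W`; only then `S → ∞`, by dominated convergence.
Pointwise convergence of the values is therefore enough. In the Abel case an independent exponential
time plays the role of the window.

Feasibility requires test functions that are `C¹` on the whole space, and this is supplied by
Whitney's extension theorem. It is proved with a continuous average of Taylor polynomials instead of
a partition of unity on cubes: the radius of the bump at `z` depends on `z` alone, so derivatives in
`x` never meet the nonsmooth distance function. -/

noncomputable section

set_option linter.unusedSectionVars false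

/-! ### Whitney extension: the kernel and differentiation of its averages -/

namespace Whitney

variable {E : Type*} [NormedAddCommGroup E] [InnerProductSpace ℝ E] [FiniteDimensional ℝ E]

/-- A smooth bump function which is `1` on the unit ball and vanishes outside the ball of
radius `3 / 2`. -/
def bump (E : Type*) [NormedAddCommGroup E] [InnerProductSpace ℝ E] : ContDiffBump (0 : E) where
  rIn := 1
  rOut := 3 / 2
  rIn_pos := one_pos
  rIn_lt_rOut := by norm_num

theorem bump_eq_one {v : E} (hv : ‖v‖ ≤ 1) : bump E v = 1 :=
  (bump E).one_of_mem_closedBall (by simpa [bump] using hv)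

theorem bump_eq_zero {v : E} (hv : 2 ≤ ‖v‖) : bump E v = 0 :=
  (bump E).zero_of_le_dist (by simp only [bump, dist_zero_right]; linarith)

theorem fderiv_bump_eq_zero {v : E} (hv : 2 ≤ ‖v‖) : fderiv ℝ (bump E) v = 0 := by
  apply fderiv_of_notMem_tsupport
  rw [(bump E).tsupport_eq]
  simp only [bump, Metric.mem_closedBall, dist_zero_right, not_le]
  linarith

theorem continuous_fderiv_bump : Continuous (fderiv ℝ (bump E)) :=
  (bump E).contDiff.continuous_fderiv (n := 1) one_ne_zero

theorem exists_fderiv_bump_bound (E : Type*) [NormedAddCommGroup E] [InnerProductSpace ℝ E]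
    [FiniteDimensional ℝ E] : ∃ C : ℝ, 0 ≤ C ∧ ∀ v : E, ‖fderiv ℝ (bump E) v‖ ≤ C := by
  obtain ⟨C, hC⟩ := ((bump E).hasCompactSupport.fderiv ℝ).exists_bound_of_continuous
    continuous_fderiv_bump
  exact ⟨C, (norm_nonneg _).trans (hC 0), hC⟩

/-- The kernel of the Whitney extension: a bump centred at `z` whose radius is proportional to
the distance from `z` to `S`. -/
def kernel (S : Set E) (x z : E) : ℝ := bump E ((Metric.infDist z S / 10)⁻¹ • (x - z))

/-- The derivative of `kernel S x z` in `x`. -/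
def dkernel (S : Set E) (x z : E) : E →L[ℝ] ℝ :=
  (Metric.infDist z S / 10)⁻¹ • fderiv ℝ (bump E) ((Metric.infDist z S / 10)⁻¹ • (x - z))

variable {S : Set E}

/-- No condition on `z` is needed: for `z ∈ S` the scaling factor is `0⁻¹ = 0`, so the kernel is
constant in `x` and `dkernel` vanishes. -/
theorem hasFDerivAt_kernel (x z : E) :
    HasFDerivAt (fun x => kernel S x z) (dkernel S x z) x := by
  set c := (Metric.infDist z S / 10)⁻¹ with hc
  have h1 : HasFDerivAt (fun x : E => c • (x - z)) (c • ContinuousLinearMap.id ℝ E) x :=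
    ((hasFDerivAt_id x).sub_const z).const_smul c
  have h2 : HasFDerivAt (bump E) (fderiv ℝ (bump E) (c • (x - z))) (c • (x - z)) :=
    (((bump E).contDiff (n := 1)).differentiable one_ne_zero _).hasFDerivAt
  have h3 := h2.comp x h1
  have h4 : dkernel S x z =
      (fderiv ℝ (bump E) (c • (x - z))).comp (c • ContinuousLinearMap.id ℝ E) := by
    ext v
    simp [dkernel, ← hc]
  rw [h4]
  exact h3

theorem continuous_dkernel (z : E) : Continuous fun x => dkernel S x z := by
  have h : Continuous fun x : E => (Metric.infDist z S / 10)⁻¹ • (x - z) := by fun_prop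
  exact Continuous.const_smul (continuous_fderiv_bump.comp h) (Metric.infDist z S / 10)⁻¹

theorem continuous_kernel (z : E) : Continuous fun x => kernel S x z := by
  unfold kernel
  exact (bump E).continuous.comp (by fun_prop)

theorem kernel_nonneg (x z : E) : 0 ≤ kernel S x z := (bump E).nonneg

theorem kernel_le_one (x z : E) : kernel S x z ≤ 1 := (bump E).le_one

theorem norm_smul_ge {x z : E} (hz : 0 < Metric.infDist z S)
    (h : Metric.infDist z S / 5 ≤ dist x z) :
    2 ≤ ‖(Metric.infDist z S / 10)⁻¹ • (x - z)‖ := by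
  rw [norm_smul, norm_inv, Real.norm_of_nonneg (by positivity), ← dist_eq_norm,
    inv_mul_eq_div, le_div_iff₀ (by positivity)]
  linarith

theorem kernel_eq_zero {x z : E} (hz : 0 < Metric.infDist z S)
    (h : Metric.infDist z S / 5 ≤ dist x z) : kernel S x z = 0 :=
  bump_eq_zero (norm_smul_ge hz h)

theorem dkernel_eq_zero {x z : E} (hz : 0 < Metric.infDist z S)
    (h : Metric.infDist z S / 5 ≤ dist x z) : dkernel S x z = 0 := by
  rw [dkernel, fderiv_bump_eq_zero (norm_smul_ge hz h), smul_zero]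

theorem kernel_eq_one {x z : E} (hz : 0 < Metric.infDist z S)
    (h : dist x z ≤ Metric.infDist z S / 10) : kernel S x z = 1 := by
  apply bump_eq_one
  rw [norm_smul, norm_inv, Real.norm_of_nonneg (by positivity), ← dist_eq_norm,
    inv_mul_eq_div, div_le_one (by positivity)]
  exact h

theorem norm_dkernel_le {C : ℝ} (hC : ∀ v : E, ‖fderiv ℝ (bump E) v‖ ≤ C) {x z : E}
    (hz : 0 < Metric.infDist z S) :
    ‖dkernel S x z‖ ≤ 10 / Metric.infDist z S * C := by
  rw [dkernel, norm_smul, norm_inv, Real.norm_of_nonneg (by positivity), inv_div]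
  gcongr
  exact hC _

/-- The distance to `S` is 1-Lipschitz, so wherever the kernel can be nonzero the distances of `x`
and `z` to `S` are comparable. -/
theorem infDist_bounds {x z : E} (h : dist x z < Metric.infDist z S / 5) :
    Metric.infDist z S ≤ 5 / 4 * Metric.infDist x S ∧
      5 / 6 * Metric.infDist x S ≤ Metric.infDist z S := by
  have h1 : Metric.infDist z S ≤ Metric.infDist x S + dist z x := Metric.infDist_le_infDist_add_dist
  have h2 : Metric.infDist x S ≤ Metric.infDist z S + dist x z := Metric.infDist_le_infDist_add_dist
  rw [dist_comm] at h1
  constructor <;> linarith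

variable [MeasurableSpace E] [BorelSpace E]

theorem measurable_kernel (x : E) : Measurable fun z => kernel S x z := by
  unfold kernel
  exact (bump E).continuous.measurable.comp (by fun_prop)

theorem measurable_dkernel (x : E) : Measurable fun z => dkernel S x z := by
  unfold dkernel
  have h : Measurable fun z : E => (Metric.infDist z S / 10)⁻¹ := by fun_prop
  refine h.smul (continuous_fderiv_bump.measurable.comp ?_)
  fun_prop

/-- The Whitney integral of a field of affine functions `x ↦ A z + B z x`. -/
def avg (S : Set E) (A : E → ℝ) (B : E → E →L[ℝ] ℝ) (x : E) : ℝ :=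
  ∫ z in Sᶜ, kernel S x z * (A z + B z x)

/-- The integrand of the derivative of `avg`. -/
def davgIntegrand (S : Set E) (A : E → ℝ) (B : E → E →L[ℝ] ℝ) (x z : E) : E →L[ℝ] ℝ :=
  kernel S x z • B z + (A z + B z x) • dkernel S x z

/-- The derivative of `avg`. -/
def davg (S : Set E) (A : E → ℝ) (B : E → E →L[ℝ] ℝ) (x : E) : E →L[ℝ] ℝ :=
  ∫ z in Sᶜ, davgIntegrand S A B x z

theorem integrable_indicator_closedBall (x : E) (R c : ℝ) (s : Set E) :
    Integrable ((Metric.closedBall x R).indicator fun _ => c) (volume.restrict s) := by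
  have : Integrable ((Metric.closedBall x R).indicator fun _ => c) (volume : Measure E) :=
    (integrable_indicator_iff measurableSet_closedBall).2
      (integrableOn_const (measure_closedBall_lt_top).ne)
  exact this.mono_measure Measure.restrict_le_self

section
variable {A : E → ℝ} {B : E → E →L[ℝ] ℝ} {a b : ℝ}

/-- Localizes the kernel uniformly for `x` near `x₀`. With `d` the distance from `x₀` to `S`, the
distance from `x` lies between `d/2` and `3d/2`, so that of `z` lies between `5d/12` and `15d/8`,
and `z` is within `d/2 + 3d/8` of `x₀`. -/
theorem local_support {x₀ x z : E}
    (hx : x ∈ Metric.ball x₀ (Metric.infDist x₀ S / 2))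
    (hxz : dist x z < Metric.infDist z S / 5) :
    z ∈ Metric.closedBall x₀ (Metric.infDist x₀ S) ∧
      Metric.infDist x₀ S / 3 ≤ Metric.infDist z S := by
  have h1 := infDist_bounds hxz
  have h2 : Metric.infDist x₀ S ≤ Metric.infDist x S + dist x₀ x :=
    Metric.infDist_le_infDist_add_dist
  have h3 : Metric.infDist x S ≤ Metric.infDist x₀ S + dist x x₀ :=
    Metric.infDist_le_infDist_add_dist
  rw [dist_comm] at h2
  rw [Metric.mem_ball] at hx
  have h4 : dist z x₀ ≤ dist x z + dist x x₀ := by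
    rw [dist_comm x z]; exact dist_triangle _ _ _
  rw [Metric.mem_closedBall]
  constructor <;> linarith

theorem infDist_pos (hS : IsClosed S) (hne : S.Nonempty) {z : E} (hz : z ∉ S) :
    0 < Metric.infDist z S := (hS.notMem_iff_infDist_pos hne).1 hz

theorem norm_integrand_le (ha : ∀ z, |A z| ≤ a) (hb : ∀ z, ‖B z‖ ≤ b) (z x : E) {ρ : ℝ}
    (hx : ‖x‖ ≤ ρ) : |A z + B z x| ≤ a + b * ρ := by
  have h0 : 0 ≤ b := (norm_nonneg _).trans (hb z)
  calc |A z + B z x| ≤ |A z| + ‖B z x‖ := abs_add_le _ _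
    _ ≤ a + b * ρ := add_le_add (ha z) (((B z).le_opNorm x).trans (by gcongr; exact hb z))

theorem norm_kernel_mul_le (hS : IsClosed S) (hne : S.Nonempty) (ha : ∀ z, |A z| ≤ a)
    (hb : ∀ z, ‖B z‖ ≤ b) (x₀ : E) {x : E}
    (hx : x ∈ Metric.ball x₀ (Metric.infDist x₀ S / 2)) {z : E} (hz : z ∉ S) :
    ‖kernel S x z * (A z + B z x)‖ ≤
      (Metric.closedBall x₀ (Metric.infDist x₀ S)).indicator
        (fun _ => a + b * (‖x₀‖ + Metric.infDist x₀ S)) z := by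
  by_cases h : dist x z < Metric.infDist z S / 5
  · obtain ⟨h1, -⟩ := local_support hx h
    rw [indicator_of_mem h1, norm_mul, Real.norm_of_nonneg (kernel_nonneg _ _)]
    have h2 : ‖x‖ ≤ ‖x₀‖ + Metric.infDist x₀ S := by
      have := norm_le_norm_add_norm_sub' x x₀
      rw [Metric.mem_ball, dist_eq_norm] at hx
      have := Metric.infDist_nonneg (x := x₀) (s := S)
      linarith
    rw [Real.norm_eq_abs]
    exact (mul_le_of_le_one_left (abs_nonneg _) (kernel_le_one _ _)).trans
      (norm_integrand_le ha hb z x h2)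
  · rw [kernel_eq_zero (infDist_pos hS hne hz) (not_lt.1 h)]
    have h0 : 0 ≤ a := (abs_nonneg _).trans (ha z)
    have h1 : 0 ≤ b := (norm_nonneg _).trans (hb z)
    have := Metric.infDist_nonneg (x := x₀) (s := S)
    rw [zero_mul, norm_zero]
    exact indicator_nonneg (fun _ _ => by positivity) _

/-- The dominating function for differentiating under the integral sign, and for continuity of the
derivative. By `local_support` the scales entering stay above a third of the distance of `x₀`, so
the derivatives of the bumps stay bounded. -/
theorem exists_davgIntegrand_bound (hS : IsClosed S) (hne : S.Nonempty) (ha : ∀ z, |A z| ≤ a)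
    (hb : ∀ z, ‖B z‖ ≤ b) (x₀ : E) (hx₀ : x₀ ∉ S) :
    ∃ c : ℝ, ∀ x ∈ Metric.ball x₀ (Metric.infDist x₀ S / 2), ∀ z ∉ S,
      ‖davgIntegrand S A B x z‖ ≤
        (Metric.closedBall x₀ (Metric.infDist x₀ S)).indicator (fun _ => c) z := by
  obtain ⟨C, hC0, hC⟩ := exists_fderiv_bump_bound E
  have hd0 := infDist_pos hS hne hx₀
  set d := Metric.infDist x₀ S with hd
  have h0 : 0 ≤ a := (abs_nonneg _).trans (ha x₀)
  have h1 : 0 ≤ b := (norm_nonneg _).trans (hb x₀)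
  refine ⟨b + (a + b * (‖x₀‖ + d)) * (10 / (d / 3) * C), fun x hx z hz => ?_⟩
  have hz0 := infDist_pos hS hne hz
  by_cases h : dist x z < Metric.infDist z S / 5
  · obtain ⟨h2, h3⟩ := local_support hx h
    rw [indicator_of_mem h2]
    have h4 : ‖x‖ ≤ ‖x₀‖ + d := by
      have := norm_le_norm_add_norm_sub' x x₀
      rw [Metric.mem_ball, dist_eq_norm] at hx
      linarith
    refine (norm_add_le _ _).trans (add_le_add ?_ ?_)
    · rw [norm_smul, Real.norm_of_nonneg (kernel_nonneg _ _)]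
      calc _ ≤ 1 * b := mul_le_mul (kernel_le_one _ _) (hb z) (norm_nonneg _) zero_le_one
        _ = b := one_mul b
    · rw [norm_smul]
      refine mul_le_mul (norm_integrand_le ha hb z x h4) ((norm_dkernel_le hC hz0).trans ?_)
        (norm_nonneg _) (by positivity)
      gcongr
  · rw [davgIntegrand, kernel_eq_zero hz0 (not_lt.1 h), dkernel_eq_zero hz0 (not_lt.1 h)]
    simp only [zero_smul, smul_zero, add_zero, norm_zero]
    exact indicator_nonneg (fun _ _ => by positivity) _

theorem measurable_integrand (hA : Measurable A) (hB : Measurable B) (x : E) :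
    Measurable fun z => A z + B z x :=
  hA.add ((ContinuousLinearMap.apply ℝ ℝ x).continuous.measurable.comp hB)

theorem integrable_kernel_mul (hS : IsClosed S) (hne : S.Nonempty) (hA : Measurable A)
    (hB : Measurable B) (ha : ∀ z, |A z| ≤ a) (hb : ∀ z, ‖B z‖ ≤ b) {x : E} (hx : x ∉ S) :
    Integrable (fun z => kernel S x z * (A z + B z x)) (volume.restrict Sᶜ) := by
  refine (integrable_indicator_closedBall x (Metric.infDist x S)
    (a + b * (‖x‖ + Metric.infDist x S)) _).mono'
    ((measurable_kernel x).mul (measurable_integrand hA hB x)).aestronglyMeasurable ?_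
  refine (ae_restrict_iff' hS.measurableSet.compl).2 (Eventually.of_forall fun z hz => ?_)
  exact norm_kernel_mul_le hS hne ha hb x
    (Metric.mem_ball_self (half_pos (infDist_pos hS hne hx))) hz

theorem measurable_davgIntegrand (hA : Measurable A) (hB : Measurable B) (x : E) :
    Measurable (davgIntegrand S A B x) :=
  ((measurable_kernel x).smul hB).add ((measurable_integrand hA hB x).smul (measurable_dkernel x))

theorem integrable_davgIntegrand (hS : IsClosed S) (hne : S.Nonempty) (hA : Measurable A)
    (hB : Measurable B) (ha : ∀ z, |A z| ≤ a) (hb : ∀ z, ‖B z‖ ≤ b) {x : E} (hx : x ∉ S) :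
    Integrable (davgIntegrand S A B x) (volume.restrict Sᶜ) := by
  obtain ⟨c, hc⟩ := exists_davgIntegrand_bound hS hne ha hb x hx
  refine (integrable_indicator_closedBall x (Metric.infDist x S) c _).mono'
    (measurable_davgIntegrand hA hB x).aestronglyMeasurable ?_
  exact (ae_restrict_iff' hS.measurableSet.compl).2 (Eventually.of_forall fun z hz =>
    hc x (Metric.mem_ball_self (half_pos (infDist_pos hS hne hx))) z hz)

theorem hasFDerivAt_avg (hS : IsClosed S) (hne : S.Nonempty) (hA : Measurable A)
    (hB : Measurable B) (ha : ∀ z, |A z| ≤ a) (hb : ∀ z, ‖B z‖ ≤ b) {x : E} (hx : x ∉ S) :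
    HasFDerivAt (avg S A B) (davg S A B x) x := by
  obtain ⟨c, hc⟩ := exists_davgIntegrand_bound hS hne ha hb x hx
  refine hasFDerivAt_integral_of_dominated_of_fderiv_le
    (Metric.ball_mem_nhds x (half_pos (infDist_pos hS hne hx)))
    (Eventually.of_forall fun y =>
      ((measurable_kernel y).mul (measurable_integrand hA hB y)).aestronglyMeasurable)
    (integrable_kernel_mul hS hne hA hB ha hb hx)
    (measurable_davgIntegrand hA hB x).aestronglyMeasurable
    ((ae_restrict_iff' hS.measurableSet.compl).2 (Eventually.of_forall fun z hz y hy =>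
      hc y hy z hz))
    (integrable_indicator_closedBall x _ c _)
    (Eventually.of_forall fun z y _ => ?_)
  exact (hasFDerivAt_kernel y z).mul ((B z).hasFDerivAt.const_add (A z))

theorem continuousAt_davg (hS : IsClosed S) (hne : S.Nonempty) (hA : Measurable A)
    (hB : Measurable B) (ha : ∀ z, |A z| ≤ a) (hb : ∀ z, ‖B z‖ ≤ b) {x : E} (hx : x ∉ S) :
    ContinuousAt (davg S A B) x := by
  obtain ⟨c, hc⟩ := exists_davgIntegrand_bound hS hne ha hb x hx
  refine continuousAt_of_dominated
    (Eventually.of_forall fun y => (measurable_davgIntegrand hA hB y).aestronglyMeasurable)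
    ?_ (integrable_indicator_closedBall x (Metric.infDist x S) c _)
    (Eventually.of_forall fun z => ?_)
  · filter_upwards [Metric.ball_mem_nhds x (half_pos (infDist_pos hS hne hx))] with y hy
    exact (ae_restrict_iff' hS.measurableSet.compl).2 (Eventually.of_forall fun z hz =>
      hc y hy z hz)
  · unfold davgIntegrand
    have h1 := continuous_kernel (S := S) z
    have h2 := continuous_dkernel (S := S) z
    fun_prop

end

end Whitney

/-! ### Whitney extension: normalization and derivative bounds -/

namespace Whitney

variable {E : Type*} [NormedAddCommGroup E] [InnerProductSpace ℝ E] [FiniteDimensional ℝ E]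
  [MeasurableSpace E] [BorelSpace E] {S : Set E}

/-- The total mass of the kernel. -/
def mass (S : Set E) (x : E) : ℝ := avg S (fun _ => 1) (fun _ => 0) x

theorem mass_eq (x : E) : mass S x = ∫ z in Sᶜ, kernel S x z := by
  simp [mass, avg]

theorem integrable_kernel (hS : IsClosed S) (hne : S.Nonempty) {x : E} (hx : x ∉ S) :
    Integrable (fun z => kernel S x z) (volume.restrict Sᶜ) := by
  simpa using integrable_kernel_mul hS hne (measurable_const (a := (1 : ℝ)))
    (measurable_const (a := (0 : E →L[ℝ] ℝ))) (fun _ => le_rfl) (fun _ => le_rfl) hx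

theorem integrable_dkernel (hS : IsClosed S) (hne : S.Nonempty) {x : E} (hx : x ∉ S) :
    Integrable (fun z => dkernel S x z) (volume.restrict Sᶜ) := by
  have h : (fun z => dkernel S x z) = davgIntegrand S (fun _ => 1) (fun _ => 0) x := by
    ext1 z
    simp [davgIntegrand]
  rw [h]
  exact integrable_davgIntegrand hS hne measurable_const measurable_const (fun _ => le_rfl)
    (fun _ => le_rfl) hx

/-- The kernel is `1` on this ball: if `z` is within `d/11` of `x`, its distance to `S` is at least
`10d/11`, so its bump equals `1` up to radius `d/11`. -/
theorem volume_closedBall_le_mass (hS : IsClosed S) (hne : S.Nonempty) {x : E} (hx : x ∉ S) :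
    (volume : Measure E).real (Metric.closedBall x (Metric.infDist x S / 11)) ≤ mass S x := by
  have hd := infDist_pos hS hne hx
  have hsub : Metric.closedBall x (Metric.infDist x S / 11) ⊆ Sᶜ := by
    intro z hz hzS
    have := Metric.infDist_le_dist_of_mem hzS (x := x)
    rw [Metric.mem_closedBall, dist_comm] at hz
    linarith
  have h1 : (volume : Measure E).real (Metric.closedBall x (Metric.infDist x S / 11)) =
      ∫ z in Sᶜ, (Metric.closedBall x (Metric.infDist x S / 11)).indicator (fun _ => (1 : ℝ)) z := by
    rw [integral_indicator measurableSet_closedBall, integral_const, smul_eq_mul, mul_one,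
      Measure.restrict_restrict measurableSet_closedBall, inter_eq_left.2 hsub,
      measureReal_restrict_apply_univ]
  rw [h1, mass_eq]
  refine integral_mono (integrable_indicator_closedBall _ _ _ _) (integrable_kernel hS hne hx) ?_
  refine indicator_le' (fun z hz => ?_) (fun z _ => kernel_nonneg _ _)
  have hz' : z ∉ S := hsub hz
  rw [kernel_eq_one (infDist_pos hS hne hz')]
  have h2 : Metric.infDist x S ≤ Metric.infDist z S + dist x z := Metric.infDist_le_infDist_add_dist
  rw [Metric.mem_closedBall, dist_comm] at hz
  linarith

theorem mass_pos (hS : IsClosed S) (hne : S.Nonempty) {x : E} (hx : x ∉ S) : 0 < mass S x := by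
  refine lt_of_lt_of_le ?_ (volume_closedBall_le_mass hS hne hx)
  have hd := infDist_pos hS hne hx
  exact ENNReal.toReal_pos (Metric.measure_closedBall_pos volume x (by positivity)).ne'
    measure_closedBall_lt_top.ne

/-- The scale-invariant estimate behind the `C¹` bound. The derivative of the kernel is at most
`12C/d` and lives in the ball of radius `d`, whose volume is `11 ^ dim` times that of the ball on
which the kernel is `1`. The constant does not depend on `S` or `x`. -/
theorem exists_integral_norm_dkernel_le (E : Type*) [NormedAddCommGroup E] [InnerProductSpace ℝ E]
    [FiniteDimensional ℝ E] [MeasurableSpace E] [BorelSpace E] :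
    ∃ C : ℝ, 0 ≤ C ∧ ∀ S : Set E, IsClosed S → S.Nonempty → ∀ x ∉ S,
      ∫ z in Sᶜ, ‖dkernel S x z‖ ≤ C / Metric.infDist x S * mass S x := by
  obtain ⟨C, hC0, hC⟩ := exists_fderiv_bump_bound E
  refine ⟨12 * C * 11 ^ Module.finrank ℝ E, by positivity, fun S hS hne x hx => ?_⟩
  have hd := infDist_pos hS hne hx
  set d := Metric.infDist x S with hd_def
  have hvol : (volume : Measure E).real (Metric.closedBall x d) =
      11 ^ Module.finrank ℝ E * (volume : Measure E).real (Metric.closedBall x (d / 11)) := by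
    have h := Measure.addHaar_closedBall_mul (volume : Measure E) x (r := 11) (by norm_num)
      (s := d / 11) (by positivity)
    rw [mul_div_cancel₀ d (by norm_num : (11 : ℝ) ≠ 0)] at h
    rw [measureReal_def, h, ENNReal.toReal_mul, ENNReal.toReal_ofReal (by positivity),
      measureReal_def, Measure.addHaar_closedBall_center volume x]
  have h1 : ∫ z in Sᶜ, ‖dkernel S x z‖ ≤
      ∫ z in Sᶜ, (Metric.closedBall x d).indicator (fun _ => 12 / d * C) z := by
    refine integral_mono_ae (integrable_dkernel hS hne hx).norm
      (integrable_indicator_closedBall _ _ _ _) ?_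
    refine (ae_restrict_iff' hS.measurableSet.compl).2 (Eventually.of_forall fun z hz => ?_)
    have hz0 := infDist_pos hS hne hz
    by_cases h : dist x z < Metric.infDist z S / 5
    · obtain ⟨h2, h3⟩ := infDist_bounds h
      have hmem : z ∈ Metric.closedBall x d := by
        rw [Metric.mem_closedBall, dist_comm]; linarith
      simp only [indicator_of_mem hmem]
      refine (norm_dkernel_le hC hz0).trans ?_
      gcongr ?_ * C
      rw [div_le_div_iff₀ hz0 hd]
      linarith
    · simp only [dkernel_eq_zero hz0 (not_lt.1 h), norm_zero]
      exact indicator_nonneg (fun _ _ => by positivity) _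
  have h2 : ∫ z in Sᶜ, (Metric.closedBall x d).indicator (fun _ => 12 / d * C) z ≤
      12 / d * C * (volume : Measure E).real (Metric.closedBall x d) := by
    rw [integral_indicator measurableSet_closedBall, integral_const, smul_eq_mul,
      Measure.restrict_restrict measurableSet_closedBall, measureReal_restrict_apply_univ,
      mul_comm]
    gcongr
    · exact measure_closedBall_lt_top.ne
    · exact inter_subset_left
  calc _ ≤ 12 / d * C * (volume : Measure E).real (Metric.closedBall x d) := h1.trans h2
    _ = 12 * C * 11 ^ Module.finrank ℝ E / d *
        (volume : Measure E).real (Metric.closedBall x (d / 11)) := by rw [hvol]; ring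
    _ ≤ _ := by gcongr; exact volume_closedBall_le_mass hS hne hx

section
variable {A : E → ℝ} {B : E → E →L[ℝ] ℝ} {κ ε : ℝ}

theorem abs_avg_le (hS : IsClosed S) (hne : S.Nonempty) {x : E} (hx : x ∉ S)
    (h : ∀ z ∉ S, dist x z < Metric.infDist z S / 5 → |A z + B z x| ≤ κ) :
    |avg S A B x| ≤ κ * mass S x := by
  rw [mass_eq, ← integral_const_mul, avg, ← Real.norm_eq_abs]
  refine norm_integral_le_of_norm_le ((integrable_kernel hS hne hx).const_mul κ) ?_
  refine (ae_restrict_iff' hS.measurableSet.compl).2 (Eventually.of_forall fun z hz => ?_)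
  rw [norm_mul, Real.norm_of_nonneg (kernel_nonneg _ _), mul_comm, Real.norm_eq_abs]
  by_cases h1 : dist x z < Metric.infDist z S / 5
  · exact mul_le_mul_of_nonneg_right (h z hz h1) (kernel_nonneg _ _)
  · rw [kernel_eq_zero (infDist_pos hS hne hz) (not_lt.1 h1)]; simp

theorem norm_davg_le (hS : IsClosed S) (hne : S.Nonempty) {x : E} (hx : x ∉ S)
    (h : ∀ z ∉ S, dist x z < Metric.infDist z S / 5 → |A z + B z x| ≤ κ)
    (h' : ∀ z ∉ S, dist x z < Metric.infDist z S / 5 → ‖B z‖ ≤ ε) :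
    ‖davg S A B x‖ ≤ ε * mass S x + κ * ∫ z in Sᶜ, ‖dkernel S x z‖ := by
  have hi := (integrable_kernel hS hne hx).const_mul ε
  have hi' := (integrable_dkernel hS hne hx).norm.const_mul κ
  rw [mass_eq, ← integral_const_mul, ← integral_const_mul, ← integral_add hi hi', davg]
  refine norm_integral_le_of_norm_le (hi.add hi') ?_
  refine (ae_restrict_iff' hS.measurableSet.compl).2 (Eventually.of_forall fun z hz => ?_)
  by_cases h1 : dist x z < Metric.infDist z S / 5
  · refine (norm_add_le _ _).trans (add_le_add ?_ ?_)
    · rw [norm_smul, Real.norm_of_nonneg (kernel_nonneg _ _), mul_comm]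
      exact mul_le_mul_of_nonneg_right (h' z hz h1) (kernel_nonneg _ _)
    · rw [norm_smul]
      exact mul_le_mul_of_nonneg_right (h z hz h1) (norm_nonneg _)
  · have h2 := infDist_pos hS hne hz
    simp [davgIntegrand, kernel_eq_zero h2 (not_lt.1 h1), dkernel_eq_zero h2 (not_lt.1 h1)]

/-- The extension outside `S`: the average of the affine functions `x ↦ A z + B z x`. -/
def quotient (S : Set E) (A : E → ℝ) (B : E → E →L[ℝ] ℝ) (x : E) : ℝ := avg S A B x / mass S x

variable {a b : ℝ}

theorem avg_sub (hS : IsClosed S) (hne : S.Nonempty) (hA : Measurable A)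
    (hB : Measurable B) (ha : ∀ z, |A z| ≤ a) (hb : ∀ z, ‖B z‖ ≤ b) {x : E} (hx : x ∉ S)
    (c : ℝ) (l : E →L[ℝ] ℝ) :
    avg S (fun z => A z - c) (fun z => B z - l) x = avg S A B x - (c + l x) * mass S x := by
  rw [mass_eq, avg, avg, ← integral_const_mul,
    ← integral_sub (integrable_kernel_mul hS hne hA hB ha hb hx)
      ((integrable_kernel hS hne hx).const_mul _)]
  refine integral_congr_ae (Eventually.of_forall fun z => ?_)
  simp only [sub_apply]
  ring

/-- A normalized average reproduces affine functions exactly. Only the deviations from a chosen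
Taylor polynomial `c + l` have to be estimated. -/
theorem quotient_eq (hS : IsClosed S) (hne : S.Nonempty) (hA : Measurable A)
    (hB : Measurable B) (ha : ∀ z, |A z| ≤ a) (hb : ∀ z, ‖B z‖ ≤ b) {x : E} (hx : x ∉ S)
    (c : ℝ) (l : E →L[ℝ] ℝ) :
    quotient S A B x =
      (c + l x) + avg S (fun z => A z - c) (fun z => B z - l) x / mass S x := by
  rw [avg_sub hS hne hA hB ha hb hx, quotient]
  have := (mass_pos hS hne hx).ne'
  field_simp
  ring

/-- The derivative of a quotient `avg / mass`. -/
def dquotient (S : Set E) (A : E → ℝ) (B : E → E →L[ℝ] ℝ) (x : E) : E →L[ℝ] ℝ :=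
  (mass S x ^ 2)⁻¹ • (mass S x • davg S A B x - avg S A B x • davg S (fun _ => 1) (fun _ => 0) x)

theorem hasFDerivAt_mass (hS : IsClosed S) (hne : S.Nonempty) {x : E} (hx : x ∉ S) :
    HasFDerivAt (mass S) (davg S (fun _ => 1) (fun _ => 0) x) x :=
  hasFDerivAt_avg hS hne measurable_const measurable_const (fun _ => le_rfl) (fun _ => le_rfl) hx

theorem hasFDerivAt_quotient (hS : IsClosed S) (hne : S.Nonempty) (hA : Measurable A)
    (hB : Measurable B) (ha : ∀ z, |A z| ≤ a) (hb : ∀ z, ‖B z‖ ≤ b) {x : E} (hx : x ∉ S) :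
    HasFDerivAt (quotient S A B) (dquotient S A B x) x := by
  have hm := (mass_pos hS hne hx).ne'
  have h := (hasFDerivAt_avg hS hne hA hB ha hb hx).mul
    ((hasDerivAt_inv hm).comp_hasFDerivAt x (hasFDerivAt_mass hS hne hx))
  have h1 : quotient S A B = avg S A B * (fun y => y⁻¹) ∘ mass S := by
    ext y
    simp [quotient, div_eq_mul_inv]
  rw [h1]
  refine h.congr_fderiv ?_
  ext v
  simp [dquotient]
  field_simp
  ring

theorem continuousAt_dquotient (hS : IsClosed S) (hne : S.Nonempty) (hA : Measurable A)
    (hB : Measurable B) (ha : ∀ z, |A z| ≤ a) (hb : ∀ z, ‖B z‖ ≤ b) {x : E} (hx : x ∉ S) :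
    ContinuousAt (dquotient S A B) x := by
  have h1 := (hasFDerivAt_avg hS hne hA hB ha hb hx).continuousAt
  have h2 := (hasFDerivAt_mass hS hne hx).continuousAt
  have h3 := continuousAt_davg hS hne hA hB ha hb hx
  have h4 : ContinuousAt (davg S (fun _ => 1) (fun _ => 0)) x :=
    continuousAt_davg hS hne measurable_const measurable_const
      (fun _ => le_rfl) (fun _ => le_rfl) hx
  exact ((h2.pow 2).inv₀ (pow_ne_zero 2 (mass_pos hS hne hx).ne')).smul
    ((h2.smul h3).sub (h1.smul h4))

/-- Differentiating `quotient_eq` on the open complement of `S`; uniqueness of the derivative avoids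
any computation. -/
theorem dquotient_eq (hS : IsClosed S) (hne : S.Nonempty) (hA : Measurable A)
    (hB : Measurable B) (ha : ∀ z, |A z| ≤ a) (hb : ∀ z, ‖B z‖ ≤ b) {x : E} (hx : x ∉ S)
    (c : ℝ) (l : E →L[ℝ] ℝ) :
    dquotient S A B x = l + dquotient S (fun z => A z - c) (fun z => B z - l) x := by
  have h1 := hasFDerivAt_quotient hS hne hA hB ha hb hx
  have h2 := hasFDerivAt_quotient hS hne (hA.sub_const c) (hB.sub_const l)
    (fun z => (abs_sub (A z) c).trans (add_le_add_left (ha z) _))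
    (fun z => (norm_sub_le (B z) l).trans (add_le_add_left (hb z) _)) hx
  have h3 := (l.hasFDerivAt.const_add c).add h2
  refine h1.unique (h3.congr_of_eventuallyEq ?_)
  filter_upwards [hS.isOpen_compl.mem_nhds hx] with y hy
  exact quotient_eq hS hne hA hB ha hb hy c l

/-- The derivative of the kernel costs a factor of order `1/d`. It is harmless when the affine
functions are of size `κ` of order `εd` at `x`, as happens near `S`. -/
theorem norm_dquotient_le (hS : IsClosed S) (hne : S.Nonempty) {x : E} (hx : x ∉ S)
    {C : ℝ} (hC : ∫ z in Sᶜ, ‖dkernel S x z‖ ≤ C / Metric.infDist x S * mass S x) (hκ : 0 ≤ κ)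
    (h : ∀ z ∉ S, dist x z < Metric.infDist z S / 5 → |A z + B z x| ≤ κ)
    (h' : ∀ z ∉ S, dist x z < Metric.infDist z S / 5 → ‖B z‖ ≤ ε) :
    ‖dquotient S A B x‖ ≤ ε + 2 * κ * (C / Metric.infDist x S) := by
  have hm := mass_pos hS hne hx
  have h1 := abs_avg_le hS hne hx h
  have h2 := norm_davg_le hS hne hx h h'
  have h3 : ‖davg S (fun _ => 1) (fun _ => (0 : E →L[ℝ] ℝ)) x‖ ≤
      C / Metric.infDist x S * mass S x := by
    refine (norm_davg_le (ε := 0) (κ := 1) hS hne hx (by simp) (by simp)).trans ?_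
    linarith
  rw [dquotient, norm_smul, Real.norm_of_nonneg (by positivity), inv_mul_le_iff₀ (by positivity)]
  calc _ ≤ mass S x * ‖davg S A B x‖ +
        |avg S A B x| * ‖davg S (fun _ => 1) (fun _ => (0 : E →L[ℝ] ℝ)) x‖ := by
        refine (norm_sub_le _ _).trans ?_
        rw [norm_smul, norm_smul, Real.norm_of_nonneg hm.le, Real.norm_eq_abs]
    _ ≤ mass S x * (ε * mass S x + κ * (C / Metric.infDist x S * mass S x)) +
        (κ * mass S x) * (C / Metric.infDist x S * mass S x) := by
        refine add_le_add (mul_le_mul_of_nonneg_left (h2.trans ?_) hm.le)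
          (mul_le_mul h1 h3 (norm_nonneg _) (by positivity))
        gcongr
    _ = _ := by ring

end

/-- Almost nearest points are taken from a countable dense subset of `S`. Any data attached to them
then depends on `z` through an integer and is automatically measurable. -/
theorem exists_measurable_selection (hne : S.Nonempty) (hS : IsClosed S) :
    ∃ (s : ℕ → E) (n : E → ℕ), Measurable n ∧ (∀ i, s i ∈ S) ∧
      ∀ z ∉ S, dist z (s (n z)) < 2 * Metric.infDist z S := by
  classical
  have : Nonempty S := hne.to_subtype
  let s : ℕ → E := fun i => (TopologicalSpace.denseSeq S i : E)
  -- The alternative `z ∈ S` makes the first admissible index defined everywhere.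
  have hex : ∀ z : E, ∃ i, z ∈ S ∨ dist z (s i) < 2 * Metric.infDist z S := by
    intro z
    by_cases hz : z ∈ S
    · exact ⟨0, Or.inl hz⟩
    · have hd := infDist_pos hS hne hz
      obtain ⟨y, hy, hzy⟩ := (Metric.infDist_lt_iff (x := z) (r := 2 * Metric.infDist z S) hne).1
        (by linarith)
      have hopen : IsOpen {y : S | dist z (y : E) < 2 * Metric.infDist z S} :=
        isOpen_lt (by fun_prop) continuous_const
      obtain ⟨i, hi⟩ := (TopologicalSpace.denseRange_denseSeq S).exists_mem_open hopen ⟨⟨y, hy⟩, hzy⟩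
      exact ⟨i, Or.inr hi⟩
  refine ⟨s, fun z => Nat.find (hex z), measurable_find hex fun k => ?_,
    fun i => (TopologicalSpace.denseSeq S i).2, fun z hz => ?_⟩
  · exact hS.measurableSet.union (measurableSet_lt (f := fun z : E => dist z (s k))
      (g := fun z : E => 2 * Metric.infDist z S) (by fun_prop) (by fun_prop))
  · exact (Nat.find_spec (hex z)).resolve_left hz

end Whitney

/-! ### Whitney extension: the theorem -/

namespace Whitney

variable {E : Type*} [NormedAddCommGroup E] [InnerProductSpace ℝ E] [FiniteDimensional ℝ E]
  [MeasurableSpace E] [BorelSpace E] {S : Set E}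

/-- A uniform first-order Taylor expansion with continuous gradient forces continuity. -/
theorem continuousOn_of_taylor {F : E → ℝ} {G : E → E →L[ℝ] ℝ}
    (hT : ∀ ε : ℝ, 0 < ε → ∃ δ : ℝ, 0 < δ ∧ ∀ y ∈ S, ∀ z ∈ S, ‖z - y‖ < δ →
      |F z - F y - G y (z - y)| ≤ ε * ‖z - y‖) : ContinuousOn F S := by
  intro y hy
  obtain ⟨δ, hδ, h⟩ := hT 1 one_pos
  have h1 : Tendsto (fun z => 1 * ‖z - y‖ + |G y (z - y)|) (𝓝[S] y) (𝓝 0) := by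
    have : Continuous fun z => 1 * ‖z - y‖ + |G y (z - y)| := by fun_prop
    have h2 := this.tendsto y
    simp only [sub_self, norm_zero, mul_zero, map_zero, abs_zero, add_zero] at h2
    exact h2.mono_left nhdsWithin_le_nhds
  rw [ContinuousWithinAt, tendsto_iff_dist_tendsto_zero]
  refine squeeze_zero' (Eventually.of_forall fun _ => dist_nonneg) ?_ h1
  filter_upwards [self_mem_nhdsWithin,
    nhdsWithin_le_nhds (Metric.ball_mem_nhds y hδ)] with z hz hzy
  rw [Metric.mem_ball, dist_eq_norm] at hzy
  rw [Real.dist_eq]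
  have h3 := h y hy z hz hzy
  calc |F z - F y| = |(F z - F y - G y (z - y)) + G y (z - y)| := by ring_nf
    _ ≤ _ := (abs_add_le _ _).trans (add_le_add_left h3 _)

/-- Near a point `b` of `S`, all affine functions entering the average at `x` are close to the
affine function attached to `b`. -/
theorem affine_close {F : E → ℝ} {G : E → E →L[ℝ] ℝ} {ε δ : ℝ}
    (hT : ∀ y ∈ S, ∀ z ∈ S, ‖z - y‖ < δ → |F z - F y - G y (z - y)| ≤ ε * ‖z - y‖)
    (hG : ∀ y ∈ S, ∀ z ∈ S, ‖z - y‖ < δ → ‖G z - G y‖ ≤ ε) (hε : 0 ≤ ε)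
    {x z p b : E} (hb : b ∈ S) (hp : p ∈ S) (hx : 4 * ‖x - b‖ < δ)
    (hpz : dist z p < 2 * Metric.infDist z S)
    (hxz : dist x z < Metric.infDist z S / 5) :
    |(F p - G p p - (F b - G b b)) + (G p - G b) x| ≤ 7 * ε * ‖x - b‖ ∧ ‖G p - G b‖ ≤ ε := by
  have h1 := (infDist_bounds hxz).1
  have h2 : Metric.infDist x S ≤ ‖x - b‖ := by
    rw [← dist_eq_norm]; exact Metric.infDist_le_dist_of_mem hb
  -- The path through `z` has length below `(1/5 + 2) · 5/4 = 11/4` times the distance from `x` to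
  -- `S`.
  have h3 : ‖x - p‖ ≤ 3 * ‖x - b‖ := by
    rw [← dist_eq_norm]
    have := dist_triangle x z p
    have := norm_nonneg (x - b)
    linarith
  have h4 : ‖p - b‖ ≤ 4 * ‖x - b‖ := by
    have : p - b = (x - b) - (x - p) := by abel
    rw [this]
    refine (norm_sub_le _ _).trans ?_
    linarith
  have h5 := hG b hb p hp (h4.trans_lt hx)
  refine ⟨?_, h5⟩
  -- The difference at `x` of the Taylor polynomials at `p` and `b`, regrouped as the Taylor
  -- remainder from `b` to `p` plus the change of gradient applied to `x - p`.
  have h6 : (F p - G p p - (F b - G b b)) + (G p - G b) x =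
      (F p - F b - G b (p - b)) + (G p - G b) (x - p) := by
    simp only [map_sub, sub_apply]
    ring
  rw [h6]
  calc _ ≤ ε * ‖p - b‖ + ‖G p - G b‖ * ‖x - p‖ :=
        (abs_add_le _ _).trans (add_le_add (hT b hb p hp (h4.trans_lt hx))
          ((G p - G b).le_opNorm _))
    _ ≤ ε * (4 * ‖x - b‖) + ε * (3 * ‖x - b‖) := by gcongr
    _ = _ := by ring

/-- **Whitney's extension theorem** for `C¹` functions on a compact set. -/
theorem exists_contDiff_extension (hS : IsCompact S) (hne : S.Nonempty) {F : E → ℝ}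
    {G : E → E →L[ℝ] ℝ} (hG : ContinuousOn G S)
    (hT : ∀ ε : ℝ, 0 < ε → ∃ δ : ℝ, 0 < δ ∧ ∀ y ∈ S, ∀ z ∈ S, ‖z - y‖ < δ →
      |F z - F y - G y (z - y)| ≤ ε * ‖z - y‖) :
    ∃ ψ : E → ℝ, ContDiff ℝ 1 ψ ∧ ∀ y ∈ S, ψ y = F y ∧ fderiv ℝ ψ y = G y := by
  classical
  have hcl := hS.isClosed
  obtain ⟨s, n, hn, hs, hsn⟩ := exists_measurable_selection hne hcl
  obtain ⟨C, hC0, hC⟩ := exists_integral_norm_dkernel_le E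
  have hF := continuousOn_of_taylor hT
  obtain ⟨cF, hcF⟩ := hS.exists_bound_of_continuousOn
    (hF.sub (hG.clm_apply continuousOn_id))
  obtain ⟨cG, hcG⟩ := hS.exists_bound_of_continuousOn hG
  -- `A z + B z x` is the Taylor polynomial at the almost nearest point `s (n z)`, evaluated at `x`.
  set A : E → ℝ := fun z => F (s (n z)) - G (s (n z)) (s (n z)) with hA_def
  set B : E → E →L[ℝ] ℝ := fun z => G (s (n z)) with hB_def
  have hA : Measurable A :=
    (measurable_from_nat (f := fun i => F (s i) - G (s i) (s i))).comp hn
  have hB : Measurable B := (measurable_from_nat (f := fun i => G (s i))).comp hn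
  have ha : ∀ z, |A z| ≤ cF := fun z => hcF _ (hs _)
  have hb : ∀ z, ‖B z‖ ≤ cG := fun z => hcG _ (hs _)
  have hmod : ∀ ε : ℝ, 0 < ε → ∃ δ : ℝ, 0 < δ ∧
      (∀ y ∈ S, ∀ z ∈ S, ‖z - y‖ < δ → |F z - F y - G y (z - y)| ≤ ε * ‖z - y‖) ∧
      (∀ y ∈ S, ∀ z ∈ S, ‖z - y‖ < δ → ‖G z - G y‖ ≤ ε) := by
    intro ε hε
    obtain ⟨δ₁, hδ₁, h1⟩ := hT ε hε
    obtain ⟨δ₂, hδ₂, h2⟩ := Metric.uniformContinuousOn_iff.1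
      (hS.uniformContinuousOn_of_continuous hG) ε hε
    refine ⟨min δ₁ δ₂, lt_min hδ₁ hδ₂, fun y hy z hz h => h1 y hy z hz (h.trans_le (min_le_left _ _)),
      fun y hy z hz h => ?_⟩
    have := h2 z hz y hy (by rw [dist_eq_norm]; exact h.trans_le (min_le_right _ _))
    rw [dist_eq_norm] at this
    exact this.le
  set ψ : E → ℝ := fun x => if x ∈ S then F x else quotient S A B x with hψ
  set D : E → E →L[ℝ] ℝ := fun x => if x ∈ S then G x else dquotient S A B x with hD
  -- One estimate, uniform in `b ∈ S`, yields both differentiability of `ψ` at points of `S` and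
  -- continuity of `D` there.
  have key : ∀ ε : ℝ, 0 < ε → ∃ δ : ℝ, 0 < δ ∧ ∀ b ∈ S, ∀ x, ‖x - b‖ < δ →
      |ψ x - F b - G b (x - b)| ≤ ε * ‖x - b‖ ∧ ‖D x - G b‖ ≤ ε := by
    intro ε hε
    -- The values need `7e`. The gradients need `e` for the slopes, `28Ce` for the derivative of the
    -- kernel and `e` for passing from `b'` to `b`.
    have hK : (0 : ℝ) < 7 + (2 + 28 * C) := by positivity
    obtain ⟨δ, hδ, h1, h2⟩ := hmod (ε / (7 + (2 + 28 * C))) (by positivity)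
    set e := ε / (7 + (2 + 28 * C)) with he
    have he0 : 0 < e := by positivity
    have heε : e * (7 + (2 + 28 * C)) = ε := div_mul_cancel₀ _ hK.ne'
    refine ⟨δ / 12, by positivity, fun b hbS x hxb => ?_⟩
    by_cases hx : x ∈ S
    · simp only [hψ, hD, if_pos hx]
      have heε' : e ≤ ε := by nlinarith
      refine ⟨(h1 b hbS x hx (by linarith)).trans (by gcongr), (h2 b hbS x hx (by linarith)).trans heε'⟩
    · simp only [hψ, hD, if_neg hx]
      have hd := infDist_pos hcl hne hx
      have hm := mass_pos hcl hne hx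
      have hclose : ∀ b' ∈ S, 4 * ‖x - b'‖ < δ → ∀ z ∉ S, dist x z < Metric.infDist z S / 5 →
          |(A z - (F b' - G b' b')) + (B z - G b') x| ≤ 7 * e * ‖x - b'‖ ∧ ‖B z - G b'‖ ≤ e :=
        fun b' hb' hxb' z hz hxz =>
          affine_close h1 h2 he0.le hb' (hs _) hxb' (hsn z hz) hxz
      constructor
      · have h3 := quotient_eq hcl hne hA hB ha hb hx (F b - G b b) (G b)
        have h4 := abs_avg_le hcl hne hx
          (fun z hz hxz => (hclose b hbS (by linarith) z hz hxz).1)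
        have h5 : quotient S A B x - F b - G b (x - b) =
            avg S (fun z => A z - (F b - G b b)) (fun z => B z - G b) x / mass S x := by
          rw [h3, map_sub]; ring
        rw [h5, abs_div, abs_of_pos hm, div_le_iff₀ hm]
        refine h4.trans ?_
        gcongr
        nlinarith
      -- The point `b` may be far from `x` compared with the distance to `S`, and the factor `1/d`
      -- would then be uncontrolled. The derivative is compared first with the gradient at an almost
      -- nearest point `b'`. Since `‖x - b'‖ < 2‖x - b‖`, the radius `δ/12` keeps all points
      -- involved within `δ`.
      · obtain ⟨b', hb', hxb'⟩ := (Metric.infDist_lt_iff (x := x)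
          (r := 2 * Metric.infDist x S) hne).1 (by linarith)
        rw [dist_eq_norm] at hxb'
        have hle : Metric.infDist x S ≤ ‖x - b‖ := by
          rw [← dist_eq_norm]; exact Metric.infDist_le_dist_of_mem hbS
        have h3 := dquotient_eq hcl hne hA hB ha hb hx (F b' - G b' b') (G b')
        have hclose' := hclose b' hb' (by linarith)
        have h4 := norm_dquotient_le hcl hne hx (hC S hcl hne x hx) (κ := 7 * e * ‖x - b'‖)
          (by positivity) (fun z hz hxz => (hclose' z hz hxz).1)
          (fun z hz hxz => (hclose' z hz hxz).2)
        have h5 : 2 * (7 * e * ‖x - b'‖) * (C / Metric.infDist x S) ≤ 28 * C * e := by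
          rw [mul_div_assoc', div_le_iff₀ hd]
          have : C * e * ‖x - b'‖ ≤ C * e * (2 * Metric.infDist x S) := by gcongr
          linarith
        have h6 : ‖G b' - G b‖ ≤ e := by
          refine h2 b hbS b' hb' ?_
          have : b' - b = (x - b) - (x - b') := by abel
          rw [this]
          refine (norm_sub_le _ _).trans_lt ?_
          linarith
        have h7 : dquotient S A B x - G b =
            dquotient S (fun z => A z - (F b' - G b' b')) (fun z => B z - G b') x + (G b' - G b) := by
          rw [h3]; abel
        rw [h7]
        refine (norm_add_le _ _).trans ?_
        nlinarith
  have hderiv : ∀ x, HasFDerivAt ψ (D x) x := by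
    intro x
    by_cases hx : x ∈ S
    · have hψx : ψ x = F x := if_pos hx
      have hDx : D x = G x := if_pos hx
      rw [hasFDerivAt_iff_isLittleO, Asymptotics.isLittleO_iff, hψx, hDx]
      intro ε hε
      obtain ⟨δ, hδ, h⟩ := key ε hε
      filter_upwards [Metric.ball_mem_nhds x hδ] with y hy
      rw [Metric.mem_ball, dist_eq_norm] at hy
      exact (h x hx y hy).1
    · have hDx : D x = dquotient S A B x := if_neg hx
      rw [hDx]
      refine (hasFDerivAt_quotient hcl hne hA hB ha hb hx).congr_of_eventuallyEq ?_
      filter_upwards [hcl.isOpen_compl.mem_nhds hx] with y hy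
      exact if_neg hy
  have hcont : Continuous D := by
    refine continuous_iff_continuousAt.2 fun x => ?_
    by_cases hx : x ∈ S
    · have hDx : D x = G x := if_pos hx
      rw [Metric.continuousAt_iff, hDx]
      intro ε hε
      obtain ⟨δ, hδ, h⟩ := key (ε / 2) (half_pos hε)
      refine ⟨δ, hδ, fun y hy => ?_⟩
      rw [dist_eq_norm] at hy ⊢
      exact (h x hx y hy).2.trans_lt (half_lt_self hε)
    · refine (continuousAt_dquotient hcl hne hA hB ha hb hx).congr ?_
      filter_upwards [hcl.isOpen_compl.mem_nhds hx] with y hy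
      exact (if_neg hy).symm
  refine ⟨ψ, contDiff_one_iff_hasFDerivAt.2 ⟨D, hcont, hderiv⟩, fun y hy => ⟨if_pos hy, ?_⟩⟩
  rw [(hderiv y).fderiv]
  exact if_pos hy

end Whitney

/-! ### Trajectories: calculus, concatenation, local existence -/

namespace OptControl

/-- The state space. -/
abbrev Eu (m : ℕ) := EuclideanSpace ℝ (Fin m)

variable {m : ℕ} {U : Type*} [MetricSpace U] [CompactSpace U] [MeasurableSpace U] [BorelSpace U]

section measurability
variable {H : Type*} [NormedAddCommGroup H] [SecondCountableTopology H]
  {g : Eu m → U → H} {y : ℝ → Eu m} {u : ℝ → U} {s : Set ℝ}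

theorem aestronglyMeasurable_comp (hg : Continuous (fun p : Eu m × U => g p.1 p.2))
    (hs : MeasurableSet s) (hy : ContinuousOn y s) (hu : Measurable u) :
    AEStronglyMeasurable (fun t => g (y t) (u t)) (volume.restrict s) := by
  borelize H
  have h1 : AEMeasurable (fun t => (y t, u t)) (volume.restrict s) :=
    (hy.aemeasurable hs).prodMk hu.aemeasurable
  exact (hg.measurable.comp_aemeasurable h1).aestronglyMeasurable

theorem exists_bound_comp (hg : Continuous (fun p : Eu m × U => g p.1 p.2))
    {K : Set (Eu m)} (hK : IsCompact K) :
    ∃ M : ℝ, 0 ≤ M ∧ ∀ x ∈ K, ∀ v : U, ‖g x v‖ ≤ M := by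
  obtain ⟨M, hM⟩ := (hK.prod (isCompact_univ (X := U))).exists_bound_of_continuousOn hg.continuousOn
  exact ⟨max M 0, le_max_right _ _, fun x hx v => (hM (x, v) ⟨hx, mem_univ _⟩).trans (le_max_left _ _)⟩

theorem intervalIntegrable_comp (hg : Continuous (fun p : Eu m × U => g p.1 p.2)) {a b : ℝ}
    (hab : a ≤ b) (hy : ContinuousOn y (Icc a b)) (hu : Measurable u) :
    IntervalIntegrable (fun t => g (y t) (u t)) volume a b := by
  obtain ⟨M, -, hM⟩ := exists_bound_comp hg (isCompact_Icc.image_of_continuousOn hy)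
  rw [intervalIntegrable_iff_integrableOn_Icc_of_le hab]
  refine Integrable.of_bound (aestronglyMeasurable_comp hg measurableSet_Icc hy hu) M ?_
  exact (ae_restrict_iff' measurableSet_Icc).2
    (Eventually.of_forall fun t ht => hM _ (mem_image_of_mem y ht) _)

end measurability

section trajectory
variable {f : Eu m → U → Eu m} {y₀ : Eu m} {u : ℝ → U} {y : ℝ → Eu m}

theorem IsTrajectory.apply_zero (h : IsTrajectory f y₀ u y) : y 0 = y₀ := by
  simpa using h.2 0 le_rfl

theorem IsTrajectory.continuousOn_Icc (h : IsTrajectory f y₀ u y) {a b : ℝ} (ha : 0 ≤ a) :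
    ContinuousOn y (Icc a b) :=
  h.1.mono fun _ ht => ha.trans ht.1

theorem IsTrajectory.intervalIntegrable {H : Type*} [NormedAddCommGroup H]
    [SecondCountableTopology H] {g : Eu m → U → H}
    (hg : Continuous (fun p : Eu m × U => g p.1 p.2)) (h : IsTrajectory f y₀ u y)
    (hu : Measurable u) {a b : ℝ} (ha : 0 ≤ a) (hb : 0 ≤ b) :
    IntervalIntegrable (fun t => g (y t) (u t)) volume a b := by
  rcases le_total a b with hab | hab
  · exact intervalIntegrable_comp hg hab (h.continuousOn_Icc ha) hu
  · exact (intervalIntegrable_comp hg hab (h.continuousOn_Icc hb) hu).symm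

theorem IsTrajectory.sub_eq (hf : Continuous (fun p : Eu m × U => f p.1 p.2))
    (h : IsTrajectory f y₀ u y) (hu : Measurable u) {a b : ℝ} (ha : 0 ≤ a) (hb : 0 ≤ b) :
    y b - y a = ∫ s in a..b, f (y s) (u s) := by
  rw [h.2 a ha, h.2 b hb, add_sub_add_left_eq_sub, intervalIntegral.integral_interval_sub_left
    (h.intervalIntegrable hf hu le_rfl hb) (h.intervalIntegrable hf hu le_rfl ha)]

theorem IsTrajectory.shift (hf : Continuous (fun p : Eu m × U => f p.1 p.2))
    (h : IsTrajectory f y₀ u y) (hu : Measurable u) {τ : ℝ} (hτ : 0 ≤ τ) :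
    IsTrajectory f (y τ) (fun t => u (τ + t)) (fun t => y (τ + t)) := by
  refine ⟨h.1.comp (by fun_prop) fun t ht => add_nonneg hτ ht, fun t ht => ?_⟩
  rw [intervalIntegral.integral_comp_add_left (fun s => f (y s) (u s)), add_zero,
    ← h.sub_eq hf hu hτ (by positivity)]
  abel

/-- On `[0, T]` the trajectory stays in a compact set, where the speed is bounded, so it is
Lipschitz. The function `η` is Lipschitz on a ball containing that set, the ball being convex as the
mean value inequality requires. -/
theorem IsTrajectory.absolutelyContinuous (hf : Continuous (fun p : Eu m × U => f p.1 p.2))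
    (h : IsTrajectory f y₀ u y) (hu : Measurable u) {η : Eu m → ℝ} (hη : ContDiff ℝ 1 η)
    {T : ℝ} (hT : 0 ≤ T) : AbsolutelyContinuousOnInterval (fun t => η (y t)) 0 T := by
  have hcont := h.continuousOn_Icc (b := T) le_rfl
  have hcomp : IsCompact (y '' Icc 0 T) := isCompact_Icc.image_of_continuousOn hcont
  obtain ⟨M, hM0, hM⟩ := exists_bound_comp hf hcomp
  have hylip : LipschitzOnWith M.toNNReal y (Icc 0 T) := by
    refine LipschitzOnWith.of_dist_le_mul fun s hs t ht => ?_
    rw [dist_eq_norm, h.sub_eq hf hu ht.1 hs.1, Real.coe_toNNReal _ hM0, Real.dist_eq]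
    refine intervalIntegral.norm_integral_le_of_norm_le_const fun r hr => hM _ ?_ _
    refine mem_image_of_mem y ?_
    exact (convex_Icc (0 : ℝ) T).ordConnected.uIcc_subset ht hs (uIoc_subset_uIcc hr)
  obtain ⟨R, hR⟩ := hcomp.isBounded.subset_closedBall 0
  obtain ⟨C, hC⟩ := (isCompact_closedBall (0 : Eu m) R).exists_bound_of_continuousOn
    (hη.continuous_fderiv one_ne_zero).continuousOn
  have hηlip : LipschitzOnWith C.toNNReal η (Metric.closedBall 0 R) := by
    refine (convex_closedBall (0 : Eu m) R).lipschitzOnWith_of_nnnorm_fderiv_le (𝕜 := ℝ)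
      (fun x _ => hη.differentiable one_ne_zero x) fun x hx => ?_
    rw [← NNReal.coe_le_coe, coe_nnnorm]
    exact (hC x hx).trans (Real.le_coe_toNNReal C)
  have hlip : LipschitzOnWith (C.toNNReal * M.toNNReal) (fun t => η (y t)) (uIcc 0 T) := by
    rw [uIcc_of_le hT]
    exact hηlip.comp hylip fun t ht => hR (mem_image_of_mem y ht)
  exact hlip.absolutelyContinuousOnInterval

/-- The control is only measurable, so the differential equation holds at almost every time, by
Lebesgue differentiation of the integral equation. -/
theorem IsTrajectory.ae_deriv_eq (hf : Continuous (fun p : Eu m × U => f p.1 p.2))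
    (h : IsTrajectory f y₀ u y) (hu : Measurable u) {η : Eu m → ℝ} (hη : ContDiff ℝ 1 η)
    {T : ℝ} (hT : 0 ≤ T) :
    ∀ᵐ t, t ∈ uIoc 0 T → deriv (fun t => η (y t)) t = fderiv ℝ η (y t) (f (y t) (u t)) := by
  have hae := (h.intervalIntegrable hf hu le_rfl hT).ae_hasDerivAt_integral
  filter_upwards [hae] with t ht htT
  have h1 := ht (uIoc_subset_uIcc htT) 0 left_mem_uIcc
  rw [uIoc_of_le hT] at htT
  have h2 : HasDerivAt y (f (y t) (u t)) t := by
    refine (h1.const_add y₀).congr_of_eventuallyEq ?_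
    filter_upwards [Ioi_mem_nhds htT.1] with s hs
    exact h.2 s (le_of_lt hs)
  have h3 := (hη.differentiable one_ne_zero (y t)).hasFDerivAt.comp_hasDerivAt t h2
  exact h3.deriv

/-- The fundamental theorem of calculus for `η ∘ y`. -/
theorem IsTrajectory.integral_fderiv (hf : Continuous (fun p : Eu m × U => f p.1 p.2))
    (h : IsTrajectory f y₀ u y) (hu : Measurable u) {η : Eu m → ℝ} (hη : ContDiff ℝ 1 η)
    {T : ℝ} (hT : 0 ≤ T) :
    ∫ t in (0 : ℝ)..T, fderiv ℝ η (y t) (f (y t) (u t)) = η (y T) - η y₀ := by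
  have hFTC := (h.absolutelyContinuous hf hu hη hT).integral_deriv_eq_sub
  rw [h.apply_zero] at hFTC
  rw [← hFTC]
  refine intervalIntegral.integral_congr_ae ?_
  filter_upwards [h.ae_deriv_eq hf hu hη hT] with t ht htT
  exact (ht htT).symm

/-- Integration by parts against an exponential weight. -/
theorem IsTrajectory.integral_exp_mul_fderiv (hf : Continuous (fun p : Eu m × U => f p.1 p.2))
    (h : IsTrajectory f y₀ u y) (hu : Measurable u) {η : Eu m → ℝ} (hη : ContDiff ℝ 1 η)
    {T : ℝ} (hT : 0 ≤ T) (r : ℝ) :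
    ∫ t in (0 : ℝ)..T, Real.exp (r * t) * fderiv ℝ η (y t) (f (y t) (u t)) =
      Real.exp (r * T) * η (y T) - η y₀ - ∫ t in (0 : ℝ)..T, r * Real.exp (r * t) * η (y t) := by
  have hexp : AbsolutelyContinuousOnInterval (fun t => Real.exp (r * t)) 0 T := by
    have : ContDiff ℝ 1 fun t => Real.exp (r * t) := by fun_prop
    exact this.contDiffOn.absolutelyContinuousOnInterval
  have hparts := hexp.integral_mul_deriv_eq_deriv_mul (h.absolutelyContinuous hf hu hη hT)
  have hderiv : ∀ t, deriv (fun t => Real.exp (r * t)) t = r * Real.exp (r * t) := fun t => by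
    have h1 : HasDerivAt (fun t => r * t) r t := by
      simpa using (hasDerivAt_id t).const_mul r
    rw [h1.exp.deriv, mul_comm]
  simp only [hderiv, mul_zero, Real.exp_zero, one_mul, h.apply_zero] at hparts
  rw [← hparts]
  refine intervalIntegral.integral_congr_ae ?_
  filter_upwards [h.ae_deriv_eq hf hu hη hT] with t ht htT
  rw [ht htT]

/-- Concatenation of a piece of trajectory on `[0, τ]` with a trajectory from its end point. -/
theorem IsTrajectory.concat (hf : Continuous (fun p : Eu m × U => f p.1 p.2)) {τ : ℝ} (hτ : 0 ≤ τ)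
    {u₁ : ℝ → U} {y₁ : ℝ → Eu m} (hu₁ : Measurable u₁) (hy₁ : ContinuousOn y₁ (Icc 0 τ))
    (hint : ∀ t ∈ Icc 0 τ, y₁ t = y₀ + ∫ s in (0 : ℝ)..t, f (y₁ s) (u₁ s))
    (h : IsTrajectory f (y₁ τ) u y) (hu : Measurable u) :
    IsTrajectory f y₀ (fun t => if t ≤ τ then u₁ t else u (t - τ))
      (fun t => if t ≤ τ then y₁ t else y (t - τ)) := by
  have hc1 : ContinuousOn (fun t => if t ≤ τ then y₁ t else y (t - τ)) (Icc 0 τ) :=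
    hy₁.congr fun t ht => if_pos ht.2
  have hc2 : ContinuousOn (fun t => if t ≤ τ then y₁ t else y (t - τ)) (Ici τ) := by
    have hc : ContinuousOn (fun t => y (t - τ)) (Ici τ) :=
      h.1.comp (by fun_prop) fun t ht => sub_nonneg.2 (show τ ≤ t from ht)
    refine hc.congr fun t ht => ?_
    rcases (show τ ≤ t from ht).eq_or_lt with rfl | h1
    · simp [h.apply_zero]
    · exact if_neg (not_le.2 h1)
  have hc : ContinuousOn (fun t => if t ≤ τ then y₁ t else y (t - τ)) (Ici 0) := by
    rw [← Icc_union_Ici_eq_Ici hτ]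
    exact hc1.union_of_isClosed hc2 isClosed_Icc isClosed_Ici
  have hfirst : ∀ t ∈ Icc 0 τ, EqOn (fun s => f (if s ≤ τ then y₁ s else y (s - τ))
      (if s ≤ τ then u₁ s else u (s - τ))) (fun s => f (y₁ s) (u₁ s)) (uIcc 0 t) := by
    intro t ht s hs
    rw [uIcc_of_le ht.1] at hs
    simp only [if_pos (hs.2.trans ht.2)]
  refine ⟨hc, fun t ht => ?_⟩
  rcases le_or_gt t τ with htτ | htτ
  · simp only [if_pos htτ]
    rw [hint t ⟨ht, htτ⟩, intervalIntegral.integral_congr (hfirst t ⟨ht, htτ⟩)]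
  · simp only [if_neg (not_le.2 htτ)]
    have hsecond : ∫ s in τ..t, f (if s ≤ τ then y₁ s else y (s - τ))
        (if s ≤ τ then u₁ s else u (s - τ)) = ∫ s in τ..t, f (y (s - τ)) (u (s - τ)) := by
      refine intervalIntegral.integral_congr_ae (Eventually.of_forall fun s hs => ?_)
      rw [uIoc_of_le htτ.le] at hs
      simp only [if_neg (not_le.2 hs.1)]
    have hmeas : Measurable fun t => if t ≤ τ then u₁ t else u (t - τ) :=
      Measurable.ite measurableSet_Iic hu₁ (hu.comp (by fun_prop))
    rw [← intervalIntegral.integral_add_adjacent_intervals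
      (intervalIntegrable_comp hf hτ hc1 hmeas)
      (intervalIntegrable_comp hf htτ.le (hc2.mono fun s hs => hs.1) hmeas),
      intervalIntegral.integral_congr (hfirst τ ⟨hτ, le_rfl⟩), hsecond, ← add_assoc,
      ← hint τ ⟨hτ, le_rfl⟩, intervalIntegral.integral_comp_sub_right (fun s => f (y s) (u s)),
      sub_self]
    exact h.2 _ (sub_nonneg.2 htτ.le)

end trajectory

/-- Local existence for a constant control, inside an open set. -/
theorem exists_local_solution {f : Eu m → Eu m} {L : ℝ≥0} (hf : LipschitzWith L f)
    {O : Set (Eu m)} (hO : IsOpen O) {y₀ : Eu m} (hy₀ : y₀ ∈ O) :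
    ∃ τ : ℝ, 0 < τ ∧ ∃ y : ℝ → Eu m, y 0 = y₀ ∧ ContinuousOn y (Icc 0 τ) ∧
      (∀ t ∈ Icc 0 τ, y t = y₀ + ∫ s in (0 : ℝ)..t, f (y s)) ∧ (∀ t ∈ Icc 0 τ, y t ∈ O) ∧
      HasDerivWithinAt y (f y₀) (Ici 0) 0 := by
  obtain ⟨M, hM⟩ := (isCompact_closedBall y₀ (1 : ℝ)).exists_bound_of_continuousOn
    hf.continuous.continuousOn
  have hM0 : 0 ≤ M := (norm_nonneg _).trans (hM y₀ (Metric.mem_closedBall_self zero_le_one))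
  -- With speed at most `M` the solution cannot leave the unit ball around `y₀` before this time;
  -- the `+ 1` covers `M = 0`.
  set σ : ℝ := 1 / (M + 1) with hσ
  have hσ0 : 0 < σ := by positivity
  have hPL : IsPicardLindelof (fun _ => f) (tmin := 0) (tmax := σ)
      ⟨0, left_mem_Icc.2 hσ0.le⟩ y₀ 1 0 M.toNNReal L := by
    refine IsPicardLindelof.of_time_independent (fun x hx => ?_) hf.lipschitzOnWith ?_
    · rw [Real.coe_toNNReal _ hM0]
      exact hM x hx
    · simp only [sub_zero, NNReal.coe_one, NNReal.coe_zero, Real.coe_toNNReal _ hM0]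
      rw [max_eq_left hσ0.le, hσ, mul_one_div, div_le_one (by positivity)]
      linarith
  obtain ⟨y, hy0, hy⟩ := hPL.exists_eq_forall_mem_Icc_hasDerivWithinAt₀
  simp only at hy0
  have hyc : ContinuousOn y (Icc 0 σ) := fun t ht => (hy t ht).continuousWithinAt
  have hder : HasDerivWithinAt y (f y₀) (Ici 0) 0 := by
    have h1 := hy 0 (left_mem_Icc.2 hσ0.le)
    rw [hy0] at h1
    exact h1.mono_of_mem_nhdsWithin (Icc_mem_nhdsGE hσ0)
  have hev : ∀ᶠ t in 𝓝[≥] (0 : ℝ), y t ∈ O := by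
    have : Tendsto y (𝓝[≥] 0) (𝓝 y₀) := by
      have := hder.continuousWithinAt.tendsto
      rwa [hy0] at this
    exact this.eventually (hO.mem_nhds hy₀)
  obtain ⟨τ', hτ', hsub⟩ := (mem_nhdsGE_iff_exists_Icc_subset).1 hev
  refine ⟨min τ' σ, lt_min hτ' hσ0, y, hy0, hyc.mono (Icc_subset_Icc_right (min_le_right _ _)),
    fun t ht => ?_, fun t ht => hsub ⟨ht.1, ht.2.trans (min_le_left _ _)⟩, hder⟩
  have htσ : t ≤ σ := ht.2.trans (min_le_right _ _)
  have hct : ContinuousOn y (Icc 0 t) := hyc.mono (Icc_subset_Icc_right htσ)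
  rw [intervalIntegral.integral_eq_sub_of_hasDerivAt_of_le (f := y) ht.1 hct (fun s hs => ?_)]
  · rw [hy0]; abel
  · refine ContinuousOn.intervalIntegrable ?_
    rw [uIcc_of_le ht.1]
    exact hf.continuous.comp_continuousOn hct
  · exact (hy s ⟨hs.1.le, hs.2.le.trans htσ⟩).hasDerivAt (Icc_mem_nhds hs.1 (hs.2.trans_le htσ))

end OptControl

/-! ### Duality: a Farkas lemma from Hahn-Banach and Riesz-Markov -/

namespace OptControl

open CompactlySupported in
/-- A positive functional on `C(X, ℝ)`, for compact `X`, is the integral with respect to a finite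
measure. -/
theorem exists_measure_of_positive {X : Type*} [TopologicalSpace X] [T2Space X] [CompactSpace X]
    [MeasurableSpace X] [BorelSpace X] (Λ : C(X, ℝ) →ₗ[ℝ] ℝ)
    (hΛ : ∀ a : C(X, ℝ), (∀ x, 0 ≤ a x) → 0 ≤ Λ a) :
    ∃ μ : Measure X, IsFiniteMeasure μ ∧ ∀ a : C(X, ℝ), ∫ x, a x ∂μ = Λ a := by
  let Λ' : C_c(X, ℝ) →ₗ[ℝ] ℝ :=
    { toFun := fun a => Λ a.toContinuousMap
      map_add' := fun a b => by rw [← map_add]; rfl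
      map_smul' := fun c a => by rw [RingHom.id_apply, ← map_smul]; rfl }
  let P : C_c(X, ℝ) →ₚ[ℝ] ℝ := PositiveLinearMap.mk₀ Λ' fun a ha => hΛ _ fun x => ha x
  refine ⟨RealRMK.rieszMeasure P, ⟨isCompact_univ.measure_lt_top⟩, fun a => ?_⟩
  exact RealRMK.integral_rieszMeasure P
    (CompactlySupportedContinuousMap.continuousMapEquiv a)

/-- **Farkas lemma** for continuous functions and probability measures on a compact space. -/
theorem exists_mem_submodule_of_integral_nonneg {X : Type*} [TopologicalSpace X] [T2Space X]
    [CompactSpace X] [MeasurableSpace X] [BorelSpace X] (N : Submodule ℝ C(X, ℝ)) (g : C(X, ℝ))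
    (h : ∀ μ : ProbabilityMeasure X, (∀ ξ ∈ N, ∫ x, ξ x ∂(μ : Measure X) = 0) →
      0 ≤ ∫ x, g x ∂(μ : Measure X)) {ε : ℝ} (hε : 0 < ε) :
    ∃ ξ ∈ N, ∀ x, 0 < g x + ε + ξ x := by
  by_contra! hcon
  set s : Set C(X, ℝ) := {a | ∀ x, 0 < a x} with hs
  set t : Set C(X, ℝ) := (fun ξ => (g + ContinuousMap.const X ε) + ξ) '' (N : Set C(X, ℝ)) with ht
  have hs_convex : Convex ℝ s := by
    intro a ha b hb c d hc hd hcd x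
    have h1 := ha x
    have h2 := hb x
    simp only [ContinuousMap.add_apply, ContinuousMap.smul_apply, smul_eq_mul]
    rcases hc.eq_or_lt with rfl | hc'
    · have : d = 1 := by linarith
      subst this
      simpa using h2
    · have := mul_pos hc' h1
      have := mul_nonneg hd h2.le
      linarith
  have hs_open : IsOpen s := by
    have := ContinuousMap.isOpen_setOfPred_mapsTo (X := X) (Y := ℝ) isCompact_univ (isOpen_Ioi (a := 0))
    simpa [hs, MapsTo] using this
  have ht_convex : Convex ℝ t := N.convex.translate _
  have hdisj : Disjoint s t := by
    rw [Set.disjoint_left]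
    rintro _ ha ⟨ξ, hξ, rfl⟩
    obtain ⟨x, hx⟩ := hcon ξ hξ
    exact absurd (ha x) (not_lt.2 hx)
  -- If the claim fails, the open cone of positive functions misses the translate of `N` by `g + ε`.
  -- The separating functional, with its sign reversed, is a measure that annihilates `N` and
  -- contradicts the hypothesis.
  obtain ⟨Λ, c, hΛs, hΛt⟩ := geometric_hahn_banach_open hs_convex hs_open ht_convex hdisj
  set b := g + ContinuousMap.const X ε with hb
  have hconst : ∀ δ : ℝ, Λ (ContinuousMap.const X δ) = δ * Λ 1 := by
    intro δ
    rw [← smul_eq_mul, ← map_smul]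
    congr 1
    ext x
    simp
  have hc0 : 0 ≤ c := by
    by_contra! hc
    have h1 : ∀ δ : ℝ, 0 < δ → δ * Λ 1 < c := fun δ hδ => by
      rw [← hconst]; exact hΛs _ fun x => hδ
    have h2 : Tendsto (fun δ : ℝ => δ * Λ 1) (𝓝[>] 0) (𝓝 0) := by
      have : Continuous fun δ : ℝ => δ * Λ 1 := by fun_prop
      simpa using (this.tendsto 0).mono_left nhdsWithin_le_nhds
    have h3 := le_of_tendsto h2 (eventually_mem_nhdsWithin.mono fun δ hδ => (h1 δ hδ).le)
    linarith
  have hneg : ∀ a ∈ s, Λ a ≤ 0 := by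
    intro a ha
    by_contra! hpos
    -- This multiple is chosen so that `Λ` takes the value `c + Λ a` on it, which exceeds the bound
    -- `c`.
    have h1 : (c / Λ a + 1) • a ∈ s := fun x => by
      have := ha x
      simp only [ContinuousMap.smul_apply, smul_eq_mul]
      positivity
    have h2 := hΛs _ h1
    rw [map_smul, smul_eq_mul, add_mul, div_mul_cancel₀ _ hpos.ne'] at h2
    linarith
  have hpos : ∀ a : C(X, ℝ), (∀ x, 0 ≤ a x) → 0 ≤ (-Λ : C(X, ℝ) →L[ℝ] ℝ) a := by
    intro a ha
    have h1 : ∀ δ : ℝ, 0 < δ → Λ a + δ * Λ 1 ≤ 0 := fun δ hδ => by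
      rw [← hconst, ← map_add]
      refine hneg _ fun x => ?_
      have := ha x
      simp only [ContinuousMap.add_apply, ContinuousMap.const_apply]
      linarith
    have h2 : Tendsto (fun δ : ℝ => Λ a + δ * Λ 1) (𝓝[>] 0) (𝓝 (Λ a)) := by
      have : Continuous fun δ : ℝ => Λ a + δ * Λ 1 := by fun_prop
      simpa using (this.tendsto 0).mono_left nhdsWithin_le_nhds
    have h3 := le_of_tendsto h2 (eventually_mem_nhdsWithin.mono fun δ hδ => h1 δ hδ)
    simpa using h3
  have hN : ∀ ξ ∈ N, Λ ξ = 0 := by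
    intro ξ hξ
    by_contra hne
    -- This multiple of `ξ` would bring `Λ` down to `c - 1` on `t`.
    have h1 := hΛt _ ⟨((c - Λ b - 1) / Λ ξ) • ξ, N.smul_mem _ hξ, rfl⟩
    simp only [map_add, map_smul, smul_eq_mul] at h1
    rw [div_mul_cancel₀ _ hne, ← map_add] at h1
    linarith
  have hΛb : c ≤ Λ b := by
    have h1 : c ≤ Λ (b + 0) := hΛt _ ⟨0, N.zero_mem, rfl⟩
    rwa [add_zero] at h1
  obtain ⟨μ, hμfin, hμ⟩ := exists_measure_of_positive ((-Λ : C(X, ℝ) →L[ℝ] ℝ) : C(X, ℝ) →ₗ[ℝ] ℝ) hpos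
  have hμ' : ∀ a : C(X, ℝ), ∫ x, a x ∂μ = -Λ a := hμ
  -- If `μ = 0` then `Λ` vanishes and the strict separation gives `0 < c ≤ 0`. Otherwise `μ` is
  -- normalized, and the slack `ε` makes `∫ b dμ` strictly positive although it equals `-Λ b ≤ 0`.
  by_cases hμ0 : μ = 0
  · have h1 := hμ' 1
    have h2 := hμ' b
    rw [hμ0, integral_zero_measure] at h1 h2
    have h3 := hΛs 1 fun x => one_pos
    linarith
  · have : NeZero μ := ⟨hμ0⟩
    set ν : ProbabilityMeasure X := ⟨(μ univ)⁻¹ • μ, inferInstance⟩ with hν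
    have hint : ∀ a : C(X, ℝ), ∫ x, a x ∂(ν : Measure X) = (μ univ)⁻¹.toReal * ∫ x, a x ∂μ := by
      intro a
      rw [hν, ProbabilityMeasure.coe_mk, integral_smul_measure, smul_eq_mul]
    have hpos' : 0 < μ.real univ := ENNReal.toReal_pos (by simpa using hμ0) (measure_ne_top _ _)
    have h1 := h ν fun ξ hξ => by rw [hint, hμ', hN ξ hξ]; simp
    have h2 : 0 < (μ univ)⁻¹.toReal := by
      rw [ENNReal.toReal_inv]; exact inv_pos.2 hpos'
    rw [hint] at h1
    have h3 := nonneg_of_mul_nonneg_right h1 h2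
    have h4 := hμ' b
    have h5 : ∫ x, b x ∂μ = ∫ x, g x ∂μ + ε * μ.real univ := by
      have hgi : Integrable (fun x => g x) μ :=
        g.continuous.integrable_of_hasCompactSupport (HasCompactSupport.of_compactSpace _)
      simp only [hb, ContinuousMap.add_apply, ContinuousMap.const_apply]
      rw [integral_add hgi (integrable_const _), integral_const, smul_eq_mul, mul_comm ε]
    have := mul_pos hε hpos'
    linarith

variable {m : ℕ} {U : Type*} [MetricSpace U] [CompactSpace U] [MeasurableSpace U] [BorelSpace U]

/-- The functions `(y, u) ↦ ∇η(y) f(y, u)` with `η ∈ C¹`. -/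
def gradientFunctions (f : Eu m → U → Eu m) (Y : Set (Eu m)) : Submodule ℝ C(Y × U, ℝ) where
  carrier := {ξ | ∃ η : Eu m → ℝ, ContDiff ℝ 1 η ∧ ∀ p : Y × U, ξ p = fderiv ℝ η p.1 (f p.1 p.2)}
  add_mem' := by
    rintro _ _ ⟨η₁, h₁, e₁⟩ ⟨η₂, h₂, e₂⟩
    refine ⟨η₁ + η₂, h₁.add h₂, fun p => ?_⟩
    rw [ContinuousMap.add_apply, e₁, e₂, fderiv_add (h₁.differentiable one_ne_zero _)
      (h₂.differentiable one_ne_zero _), add_apply]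
  zero_mem' := ⟨0, contDiff_const, fun p => by simp⟩
  smul_mem' := by
    rintro c _ ⟨η, h, e⟩
    refine ⟨c • η, h.const_smul c, fun p => ?_⟩
    rw [ContinuousMap.smul_apply, e, fderiv_const_smul (h.differentiable one_ne_zero _), smul_apply]

theorem continuous_fderiv_apply {f : Eu m → U → Eu m}
    (hf : Continuous (fun p : Eu m × U => f p.1 p.2)) {η : Eu m → ℝ} (hη : ContDiff ℝ 1 η) :
    Continuous (fun p : Eu m × U => fderiv ℝ η p.1 (f p.1 p.2)) :=
  ((hη.continuous_fderiv one_ne_zero).comp continuous_fst).clm_apply hf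

/-- The Farkas lemma for `gradientFunctions`: the probability measures annihilating this subspace
are the stationary ones. -/
theorem exists_subsolution {f : Eu m → U → Eu m} (hf : Continuous (fun p : Eu m × U => f p.1 p.2))
    {Y : Set (Eu m)} (hY : IsCompact Y) {g : Eu m → U → ℝ}
    (hg : Continuous (fun p : Eu m × U => g p.1 p.2))
    (hW : ∀ γ ∈ stationaryMeasures f Y, 0 ≤ ∫ p : Y × U, g p.1 p.2 ∂(γ : Measure (Y × U)))
    {ε : ℝ} (hε : 0 < ε) :
    ∃ η : Eu m → ℝ, ContDiff ℝ 1 η ∧ ∀ y ∈ Y, ∀ u : U, 0 ≤ g y u + ε + fderiv ℝ η y (f y u) := by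
  have : CompactSpace Y := isCompact_iff_compactSpace.1 hY
  have hemb : Continuous fun p : Y × U => ((p.1 : Eu m), p.2) := by fun_prop
  obtain ⟨ξ, ⟨η, hη, hξ⟩, h⟩ := exists_mem_submodule_of_integral_nonneg (gradientFunctions f Y)
    ⟨fun p => g p.1 p.2, hg.comp hemb⟩ (fun μ hμ => hW μ fun φ hφ =>
      hμ ⟨fun p => fderiv ℝ φ p.1 (f p.1 p.2), (continuous_fderiv_apply hf hφ).comp hemb⟩
        ⟨φ, hφ, fun p => rfl⟩) hε
  refine ⟨η, hη, fun y hy u => ?_⟩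
  have := h (⟨y, hy⟩, u)
  rw [hξ] at this
  exact this.le

end OptControl

/-! ### Occupational measures as pushforwards of measures on the time axis -/

namespace OptControl

variable {m : ℕ} {U : Type*} [MetricSpace U] [CompactSpace U] [MeasurableSpace U] [BorelSpace U]

section lift
variable {Y : Set (Eu m)} {I : Set ℝ} {y : ℝ → Eu m} {u : ℝ → U}

/-- A process that stays in `Y` during `I` is, on `I`, a measurable map into `Y × U`. -/
theorem exists_measurable_lift (hne : Y.Nonempty) (hI : MeasurableSet I) (hy : ContinuousOn y I)
    (hyY : ∀ t ∈ I, y t ∈ Y) (hu : Measurable u) :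
    ∃ Φ : ℝ → Y × U, Measurable Φ ∧ (∀ t ∈ I, ((Φ t).1 : Eu m) = y t ∧ (Φ t).2 = u t) ∧
      ∀ Q : Set (Y × U), {t : ℝ | t ∈ I ∧ ∃ h : y t ∈ Y, ((⟨y t, h⟩ : Y), u t) ∈ Q} =
        I ∩ Φ ⁻¹' Q := by
  classical
  obtain ⟨x₀, hx₀⟩ := hne
  have hmem : ∀ t, I.piecewise y (fun _ => x₀) t ∈ Y := by
    intro t
    by_cases ht : t ∈ I
    · rw [piecewise_eq_of_mem _ _ _ ht]; exact hyY t ht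
    · rw [piecewise_eq_of_notMem _ _ _ ht]; exact hx₀
  have hmeas : Measurable (I.piecewise y (fun _ => x₀)) :=
    hy.measurable_piecewise continuousOn_const hI
  have hval : ∀ t ∈ I, I.piecewise y (fun _ => x₀) t = y t := fun t ht =>
    piecewise_eq_of_mem _ _ _ ht
  refine ⟨fun t => (⟨I.piecewise y (fun _ => x₀) t, hmem t⟩, u t),
    (hmeas.subtype_mk).prodMk hu, fun t ht => ⟨hval t ht, rfl⟩, fun Q => ?_⟩
  ext t
  constructor
  · rintro ⟨ht, h, hQ⟩
    refine ⟨ht, ?_⟩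
    simp only [mem_preimage, hval t ht]
    exact hQ
  · rintro ⟨ht, hQ⟩
    refine ⟨ht, hyY t ht, ?_⟩
    simp only [mem_preimage, hval t ht] at hQ
    exact hQ

/-- The measure `Q ↦ π {t ∈ I | (y t, u t) ∈ Q}` integrates `g` to `∫ g (y t) (u t) dπ`. -/
theorem integral_eq_of_occupation (hne : Y.Nonempty) (hI : MeasurableSet I) (hy : ContinuousOn y I)
    (hyY : ∀ t ∈ I, y t ∈ Y) (hu : Measurable u) {π : Measure ℝ} (hπ : π Iᶜ = 0)
    {γ : Measure (Y × U)} (hγ : ∀ Q : Set (Y × U), MeasurableSet Q →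
      γ Q = π {t : ℝ | t ∈ I ∧ ∃ h : y t ∈ Y, ((⟨y t, h⟩ : Y), u t) ∈ Q})
    {g : Eu m → U → ℝ} (hg : Continuous (fun p : Y × U => g p.1 p.2)) :
    ∫ p : Y × U, g p.1 p.2 ∂γ = ∫ t, g (y t) (u t) ∂π := by
  obtain ⟨Φ, hΦ, hval, hset⟩ := exists_measurable_lift hne hI hy hyY hu
  have hmap : γ = π.map Φ := by
    ext Q hQ
    rw [hγ Q hQ, hset, Measure.map_apply hΦ hQ, inter_comm, measure_inter_conull hπ]
  rw [hmap, integral_map hΦ.aemeasurable hg.aestronglyMeasurable]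
  refine integral_congr_ae ?_
  filter_upwards [(mem_ae_iff.2 hπ : I ∈ ae π)] with t ht
  rw [(hval t ht).1, (hval t ht).2]

/-- The measure is the pushforward of `π` under the lifted process. It serves to show that the sets
of occupational measures are nonempty. -/
theorem exists_occupation (hne : Y.Nonempty) (hI : MeasurableSet I) (hy : ContinuousOn y I)
    (hyY : ∀ t ∈ I, y t ∈ Y) (hu : Measurable u) {π : Measure ℝ} [IsProbabilityMeasure π]
    (hπ : π Iᶜ = 0) :
    ∃ γ : ProbabilityMeasure (Y × U), ∀ Q : Set (Y × U), MeasurableSet Q →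
      (γ : Measure (Y × U)) Q =
        π {t : ℝ | t ∈ I ∧ ∃ h : y t ∈ Y, ((⟨y t, h⟩ : Y), u t) ∈ Q} := by
  obtain ⟨Φ, hΦ, hval, hset⟩ := exists_measurable_lift hne hI hy hyY hu
  refine ⟨⟨π.map Φ, Measure.isProbabilityMeasure_map hΦ.aemeasurable⟩, fun Q hQ => ?_⟩
  rw [hset, ProbabilityMeasure.coe_mk, Measure.map_apply hΦ hQ, inter_comm,
    measure_inter_conull hπ]

end lift

/-! ### The metric `ρ` and passage to the limit in integrals -/

section limit
variable {X : Type*} [PseudoMetricSpace X] [MeasurableSpace X] [BorelSpace X] {q : ℕ → X → ℝ}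

theorem IsTestSequence.continuous (hq : IsTestSequence q) (j : ℕ) : Continuous (q j) :=
  let ⟨_, hK⟩ := hq.lipschitz j
  hK.continuous

theorem IsTestSequence.integrable (hq : IsTestSequence q) (j : ℕ) (γ : ProbabilityMeasure X) :
    Integrable (q j) (γ : Measure X) :=
  Integrable.of_bound (hq.continuous j).measurable.aestronglyMeasurable 1
    (Eventually.of_forall (hq.mem_ball j))

theorem IsTestSequence.abs_integral_le (hq : IsTestSequence q) (j : ℕ) (γ : ProbabilityMeasure X) :
    |∫ x, q j x ∂(γ : Measure X)| ≤ 1 := by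
  have := norm_integral_le_of_norm_le_const (μ := (γ : Measure X)) (f := q j) (C := 1)
    (Eventually.of_forall (hq.mem_ball j))
  simpa using this

theorem rho_term_le (hq : IsTestSequence q) (γ γ' : ProbabilityMeasure X) (j : ℕ) :
    (1 / 2 : ℝ) ^ (j + 1) *
      |(∫ x, q j x ∂(γ : Measure X)) - ∫ x, q j x ∂(γ' : Measure X)| ≤ (1 / 2 : ℝ) ^ j := by
  have h := (abs_sub _ _).trans (add_le_add (hq.abs_integral_le j γ) (hq.abs_integral_le j γ'))
  calc _ ≤ (1 / 2 : ℝ) ^ (j + 1) * (1 + 1) := by gcongr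
    _ = _ := by rw [pow_succ]; ring

theorem summable_rho (hq : IsTestSequence q) (γ γ' : ProbabilityMeasure X) :
    Summable fun j : ℕ => (1 / 2 : ℝ) ^ (j + 1) *
      |(∫ x, q j x ∂(γ : Measure X)) - ∫ x, q j x ∂(γ' : Measure X)| :=
  Summable.of_nonneg_of_le (fun _ => by positivity) (rho_term_le hq γ γ') summable_geometric_two

theorem rho_nonneg (γ γ' : ProbabilityMeasure X) : 0 ≤ rho q γ γ' :=
  tsum_nonneg fun _ => by positivity

theorem rho_le (hq : IsTestSequence q) (γ γ' : ProbabilityMeasure X) : rho q γ γ' ≤ 2 := by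
  rw [← tsum_geometric_two]
  exact (summable_rho hq γ γ').tsum_le_tsum (rho_term_le hq γ γ') summable_geometric_two

theorem abs_integral_sub_le (hq : IsTestSequence q) (γ γ' : ProbabilityMeasure X) (j : ℕ) :
    |(∫ x, q j x ∂(γ : Measure X)) - ∫ x, q j x ∂(γ' : Measure X)| ≤ 2 ^ (j + 1) * rho q γ γ' := by
  have h := (summable_rho hq γ γ').le_tsum j fun _ _ => by positivity
  have h2 : (2 : ℝ) ^ (j + 1) * (1 / 2 : ℝ) ^ (j + 1) = 1 := by rw [← mul_pow]; norm_num
  calc _ = 2 ^ (j + 1) * ((1 / 2 : ℝ) ^ (j + 1) *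
        |(∫ x, q j x ∂(γ : Measure X)) - ∫ x, q j x ∂(γ' : Measure X)|) := by
        rw [← mul_assoc, h2, one_mul]
    _ ≤ _ := by gcongr; exact h

theorem rhoToSet_le (hq : IsTestSequence q) (γ : ProbabilityMeasure X)
    {Γ : Set (ProbabilityMeasure X)} (hΓ : Γ.Nonempty) : rhoToSet q γ Γ ≤ 2 := by
  obtain ⟨γ', hγ'⟩ := hΓ
  exact (csInf_le ⟨0, by rintro _ ⟨γ'', -, rfl⟩; exact rho_nonneg _ _⟩
    (mem_image_of_mem _ hγ')).trans (rho_le hq γ γ')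

/-- A measure of the second set is approximated by measures of the first set, up to the Hausdorff
distance. -/
theorem exists_rho_lt (hq : IsTestSequence q) {Γ W : Set (ProbabilityMeasure X)} (hΓ : Γ.Nonempty)
    {δ : ℝ} (h : rhoHausdorff q Γ W < δ) {γ : ProbabilityMeasure X} (hγ : γ ∈ W) :
    ∃ γ' ∈ Γ, rho q γ γ' < δ := by
  have h1 : rhoToSet q γ Γ < δ := by
    refine lt_of_le_of_lt ?_ h
    refine le_trans ?_ (le_max_right _ _)
    exact le_csSup ⟨2, by rintro _ ⟨γ'', -, rfl⟩; exact rhoToSet_le hq γ'' hΓ⟩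
      (mem_image_of_mem (fun γ => rhoToSet q γ Γ) hγ)
  -- Nonemptiness of `Γ` is essential: for an empty set the convention `sInf ∅ = 0` would make the
  -- distance small without any approximating measure.
  obtain ⟨_, ⟨γ', hγ', rfl⟩, h2⟩ := exists_lt_of_csInf_lt (hΓ.image _) h1
  exact ⟨γ', hγ', h2⟩

theorem subset_coMeasures (Γ : Set (ProbabilityMeasure X)) : Γ ⊆ coMeasures Γ := fun γ hγ =>
  ⟨1, fun _ => 1, fun _ => γ, fun _ => hγ, by simp, by simp⟩

/-- The integral is affine in the measure, so taking convex hulls loses nothing in a lower bound. -/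
theorem le_integral_of_mem_coMeasures {Γ : Set (ProbabilityMeasure X)} {g : X → ℝ} {c : ℝ}
    (hg : ∀ γ : ProbabilityMeasure X, Integrable g (γ : Measure X))
    (h : ∀ γ ∈ Γ, c ≤ ∫ x, g x ∂(γ : Measure X)) {γ : ProbabilityMeasure X}
    (hγ : γ ∈ coMeasures Γ) : c ≤ ∫ x, g x ∂(γ : Measure X) := by
  obtain ⟨n, w, γs, hγs, hw, hγ⟩ := hγ
  rw [hγ, integral_finsetSum_measure fun i _ => (hg (γs i)).smul_measure_nnreal]
  have hw' : ∑ i, (w i : ℝ) = 1 := by exact_mod_cast hw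
  calc c = ∑ i, (w i : ℝ) * c := by rw [← Finset.sum_mul, hw', one_mul]
    _ ≤ _ := Finset.sum_le_sum fun i _ => by
      rw [integral_smul_nnreal_measure, NNReal.smul_def, smul_eq_mul]
      exact mul_le_mul_of_nonneg_left (h _ (hγs i)) (w i).coe_nonneg

/-- Asymptotic lower bounds on integrals pass to the limit of convex hulls. -/
theorem integral_nonneg_of_tendsto [CompactSpace X] (hq : IsTestSequence q) {ι : Type*}
    {l : Filter ι} [l.NeBot] {Γ : ι → Set (ProbabilityMeasure X)} {W : Set (ProbabilityMeasure X)}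
    (hlim : Tendsto (fun i => rhoHausdorff q (coMeasures (Γ i)) W) l (𝓝 0))
    (hne : ∀ᶠ i in l, (Γ i).Nonempty) {g : X → ℝ} (hg : Continuous g) {c : ι → ℝ}
    (hc : Tendsto c l (𝓝 0))
    (h : ∀ᶠ i in l, ∀ γ ∈ Γ i, c i ≤ ∫ x, g x ∂(γ : Measure X)) :
    ∀ γ ∈ W, 0 ≤ ∫ x, g x ∂(γ : Measure X) := by
  intro γ hγ
  obtain ⟨R, hR0, hR⟩ : ∃ R : ℝ, 0 < R ∧ ∀ x, |g x| ≤ R := by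
    obtain ⟨R, hR⟩ := isCompact_univ.exists_bound_of_continuousOn hg.continuousOn (s := univ)
    exact ⟨max R 1, lt_max_of_lt_right one_pos, fun x => (hR x (mem_univ x)).trans (le_max_left _ _)⟩
  have hgi : ∀ γ : ProbabilityMeasure X, Integrable g (γ : Measure X) := fun γ =>
    Integrable.of_bound hg.measurable.aestronglyMeasurable R (Eventually.of_forall hR)
  -- The error is `Rδ` three times: replacing `g` by `R q_j` under `γ` and under the approximating
  -- `γ'`, and exchanging the two measures in the integral of `R q_j`.
  have key : ∀ δ : ℝ, 0 < δ → -(3 * R * δ) ≤ ∫ x, g x ∂(γ : Measure X) := by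
    intro δ hδ
    obtain ⟨j, hj⟩ := hq.dense (fun x => g x / R) (by fun_prop) (fun x => by
      rw [abs_div, abs_of_pos hR0, div_le_one hR0]; exact hR x) δ hδ
    have hclose : ∀ γ : ProbabilityMeasure X,
        |(∫ x, g x ∂(γ : Measure X)) - R * ∫ x, q j x ∂(γ : Measure X)| ≤ R * δ := by
      intro γ
      rw [← integral_const_mul, ← integral_sub (hgi γ) ((hq.integrable j γ).const_mul R)]
      have := norm_integral_le_of_norm_le_const (μ := (γ : Measure X)) (C := R * δ)
        (f := fun x => g x - R * q j x) (Eventually.of_forall fun x => by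
          have h1 : g x - R * q j x = -(R * (q j x - g x / R)) := by field_simp; ring
          rw [h1, norm_neg, norm_mul, Real.norm_of_nonneg hR0.le, Real.norm_eq_abs]
          exact mul_le_mul_of_nonneg_left (hj x) hR0.le)
      simpa using this
    have hev : ∀ᶠ i in l, c i - 3 * R * δ ≤ ∫ x, g x ∂(γ : Measure X) := by
      -- The weight of `q_j` in `ρ` is `2 ^ -(j + 1)`.
      have hpos : (0 : ℝ) < δ / 2 ^ (j + 1) := by positivity
      filter_upwards [hlim.eventually_lt_const hpos, hne, h] with i h1 h2 h3
      obtain ⟨γ', hγ', h4⟩ := exists_rho_lt hq (h2.mono (subset_coMeasures _)) h1 hγ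
      have h5 := abs_integral_sub_le hq γ γ' j
      rw [lt_div_iff₀ (by positivity), mul_comm] at h4
      have h6 := le_integral_of_mem_coMeasures hgi h3 hγ'
      have h7 := (abs_le.1 (hclose γ)).1
      have h8 := (abs_le.1 (hclose γ')).2
      have h9 := mul_le_mul_of_nonneg_left (neg_le_of_abs_le (h5.trans h4.le)) hR0.le
      linarith
    have h1 : Tendsto (fun i => c i - 3 * R * δ) l (𝓝 (0 - 3 * R * δ)) := hc.sub_const _
    rw [zero_sub] at h1
    exact le_of_tendsto h1 hev
  have h1 : Tendsto (fun δ : ℝ => -(3 * R * δ)) (𝓝[>] 0) (𝓝 0) := by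
    have : Continuous fun δ : ℝ => -(3 * R * δ) := by fun_prop
    simpa using (this.tendsto 0).mono_left nhdsWithin_le_nhds
  exact le_of_tendsto h1 (eventually_mem_nhdsWithin.mono fun δ hδ => key δ hδ)

end limit

end OptControl

/-! ### The abstract theorem: monotone smooth values solve the dual problem -/

namespace OptControl

variable {m : ℕ} {U : Type*} [MetricSpace U] [CompactSpace U] [MeasurableSpace U] [BorelSpace U]

/-- `a` up to time `τ`, followed by `b`. -/
def glue {α : Type*} (τ : ℝ) (a b : ℝ → α) (t : ℝ) : α := if t ≤ τ then a t else b (t - τ)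

theorem glue_of_le {α : Type*} {τ t : ℝ} (a b : ℝ → α) (h : t ≤ τ) : glue τ a b t = a t := if_pos h

theorem glue_of_lt {α : Type*} {τ t : ℝ} (a b : ℝ → α) (h : τ < t) :
    glue τ a b t = b (t - τ) := if_neg (not_le.2 h)

variable {f : Eu m → U → Eu m} {Y : Set (Eu m)} {y₀ : Eu m}

theorem glue_mem_admissible (hf : Continuous (fun p : Eu m × U => f p.1 p.2)) {τ : ℝ} (hτ : 0 ≤ τ)
    {u₁ : ℝ → U} {y₁ : ℝ → Eu m} (hu₁ : Measurable u₁) (hy₁ : ContinuousOn y₁ (Icc 0 τ))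
    (hint : ∀ t ∈ Icc 0 τ, y₁ t = y₀ + ∫ s in (0 : ℝ)..t, f (y₁ s) (u₁ s))
    (hY : ∀ t ∈ Icc 0 τ, y₁ t ∈ Y) {I J : Set ℝ} {p : (ℝ → Eu m) × (ℝ → U)}
    (hp : p ∈ admissible f Y J (y₁ τ)) (hI : I ⊆ Ici 0) (hIJ : ∀ t ∈ I, τ < t → t - τ ∈ J) :
    (glue τ y₁ p.1, glue τ u₁ p.2) ∈ admissible f Y I y₀ := by
  refine ⟨Measurable.ite measurableSet_Iic hu₁ (hp.1.comp (by fun_prop)),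
    hp.2.1.concat hf hτ hu₁ hy₁ hint hp.1, fun t ht => ?_⟩
  rcases le_or_gt t τ with h | h
  · simp only [glue_of_le _ _ h]
    exact hY t ⟨hI ht, h⟩
  · simp only [glue_of_lt _ _ h]
    exact hp.2.2 _ (hIJ t ht h)

theorem shift_mem_admissible (hf : Continuous (fun p : Eu m × U => f p.1 p.2)) {τ : ℝ} (hτ : 0 ≤ τ)
    {I J : Set ℝ} {p : (ℝ → Eu m) × (ℝ → U)} (hp : p ∈ admissible f Y I y₀)
    (hIJ : ∀ t ∈ J, τ + t ∈ I) :
    ((fun t => p.1 (τ + t)), fun t => p.2 (τ + t)) ∈ admissible f Y J (p.1 τ) :=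
  ⟨hp.1.comp (by fun_prop), hp.2.1.shift hf hp.1 hτ, fun t ht => hp.2.2 _ (hIJ t ht)⟩

theorem admissible_mono {I J : Set ℝ} (h : J ⊆ I) :
    admissible f Y I y₀ ⊆ admissible f Y J y₀ := fun _ hp => ⟨hp.1, hp.2.1, fun t ht => hp.2.2 t (h ht)⟩

theorem Icc_subset_Ici_zero (T : ℝ) : Icc 0 T ⊆ Ici 0 := fun _ ht => ht.1

/-- If `V` does not decrease along viable processes, its gradient satisfies `∇V f ≥ 0`. -/
theorem gradient_nonneg_of_mono (hf : Continuous (fun p : Eu m × U => f p.1 p.2)) {L : ℝ≥0}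
    (hf_lip : ∀ u : U, LipschitzWith L (fun y => f y u))
    (hY_closure : closure (interior Y) = Y)
    (hY_viable : ∀ y₀ ∈ Y, (admissible f Y (Ici 0) y₀).Nonempty) {V : Eu m → ℝ}
    {G : Eu m → (Eu m →L[ℝ] ℝ)} (hG : ContinuousOn G Y)
    (hV : ∀ y ∈ interior Y, HasFDerivAt V (G y) y)
    (hmono : ∀ y₀ ∈ Y, ∀ p ∈ admissible f Y (Ici 0) y₀, ∀ τ : ℝ, 0 < τ → V y₀ ≤ V (p.1 τ)) :
    ∀ y ∈ Y, ∀ u : U, 0 ≤ G y (f y u) := by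
  have hint : ∀ y ∈ interior Y, ∀ u : U, 0 ≤ G y (f y u) := by
    intro y hy u
    obtain ⟨τ, hτ, y₁, hy₁0, hy₁c, hy₁i, hy₁O, hy₁d⟩ :=
      exists_local_solution (hf_lip u) isOpen_interior hy
    obtain ⟨p, hp⟩ := hY_viable (y₁ τ) (interior_subset (hy₁O τ ⟨hτ.le, le_rfl⟩))
    -- The constant control is viable only for a short time; continuing with a process that
    -- viability provides makes the whole process admissible on `[0, ∞)`, as `hmono` requires.
    have hadm := glue_mem_admissible hf hτ.le (measurable_const (a := u)) hy₁c hy₁i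
      (fun t ht => interior_subset (hy₁O t ht)) (I := Ici 0) hp subset_rfl
      (fun t _ h => sub_nonneg.2 h.le)
    have hd : HasDerivWithinAt (fun t => V (y₁ t)) (G y (f y u)) (Ici 0) 0 := by
      have h1 := hV y hy
      rw [← hy₁0] at h1
      have h2 := h1.comp_hasDerivWithinAt 0 hy₁d
      rwa [hy₁0] at h2
    rw [hasDerivWithinAt_iff_tendsto_slope, Ici_sdiff_left] at hd
    refine ge_of_tendsto hd ?_
    filter_upwards [Ioc_mem_nhdsGT hτ] with t ht
    have h1 := hmono y (interior_subset hy) _ hadm t ht.1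
    simp only [glue_of_le _ _ ht.2] at h1
    rw [slope_def_field, hy₁0, sub_zero]
    exact div_nonneg (sub_nonneg.2 h1) ht.1.le
  intro y hy u
  have hcont : ContinuousOn (fun y => G y (f y u)) Y :=
    hG.clm_apply ((hf.comp (by fun_prop : Continuous fun y : Eu m => (y, u))).continuousOn)
  have hy' : y ∈ closure (interior Y) := by rw [hY_closure]; exact hy
  have : (𝓝[interior Y] y).NeBot := mem_closure_iff_nhdsWithin_neBot.1 hy'
  exact ge_of_tendsto ((hcont y hy).mono interior_subset)
    (eventually_mem_nhdsWithin.mono fun z hz => hint z hz u)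

/-- The abstract form of the theorem: a smooth function `V` that is monotone along processes,
dominated by `k` in the mean over stationary measures, and above all dual feasible values, is the
optimal value of the dual problem. -/
theorem eq_dStar (hf : Continuous (fun p : Eu m × U => f p.1 p.2)) {L : ℝ≥0}
    (hf_lip : ∀ u : U, LipschitzWith L (fun y => f y u)) {k : Eu m → U → ℝ}
    (hk : Continuous (fun p : Eu m × U => k p.1 p.2)) (hY_nonempty : Y.Nonempty)
    (hY_compact : IsCompact Y) (hY_closure : closure (interior Y) = Y)
    (hY_viable : ∀ y₀ ∈ Y, (admissible f Y (Ici 0) y₀).Nonempty) {V : Eu m → ℝ}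
    (hV : IsC1UpToBoundary V Y)
    (hmono : ∀ y₀ ∈ Y, ∀ p ∈ admissible f Y (Ici 0) y₀, ∀ τ : ℝ, 0 < τ → V y₀ ≤ V (p.1 τ))
    (hW : ∀ γ ∈ stationaryMeasures f Y, 0 ≤ ∫ p : Y × U, k p.1 p.2 - V p.1 ∂(γ : Measure (Y × U)))
    (hup : ∀ y₀ ∈ Y, ∀ μ ∈ dualFeasibleValues f k Y y₀, μ ≤ V y₀) :
    ∀ y₀ ∈ Y, (V y₀ : EReal) = dStar f k Y y₀ := by
  obtain ⟨G, hG, hVd, hT⟩ := hV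
  obtain ⟨ψ, hψ, hψY⟩ := Whitney.exists_contDiff_extension hY_compact hY_nonempty hG hT
  have hgrad := gradient_nonneg_of_mono hf hf_lip hY_closure hY_viable hG hVd hmono
  intro y₀ hy₀
  refine le_antisymm ?_ (sSup_le ?_)
  · have hlow : ∀ ε : ℝ, 0 < ε → ((V y₀ - ε : ℝ) : EReal) ≤ dStar f k Y y₀ := by
      intro ε hε
      obtain ⟨η, hη, h⟩ := exists_subsolution hf hY_compact
        (g := fun y u => k y u - ψ y) (hk.sub (hψ.continuous.comp continuous_fst))
        (fun γ hγ => by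
          refine (hW γ hγ).trans_eq (integral_congr_ae (Eventually.of_forall fun p => ?_))
          simp only [(hψY p.1 p.1.2).1]) hε
      -- With `μ = V y₀ - ε` and `ψ = V` on `Y`, the values at `y₀` cancel and the first constraint
      -- becomes `k - V + ε + ∇η f ≥ 0`, which does not involve `y₀`.
      refine le_sSup (mem_image_of_mem _ ⟨ψ, η, hψ, hη, fun y hy u => ⟨?_, ?_⟩⟩)
      · have := h y hy u
        rw [(hψY y₀ hy₀).1]
        linarith
      · rw [(hψY y hy).2]
        exact hgrad y hy u
    have h1 : Tendsto (fun ε : ℝ => ((V y₀ - ε : ℝ) : EReal)) (𝓝[>] 0) (𝓝 ((V y₀ : ℝ) : EReal)) := by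
      have : Continuous fun ε : ℝ => ((V y₀ - ε : ℝ) : EReal) :=
        continuous_coe_real_ereal.comp (by fun_prop)
      simpa using (this.tendsto 0).mono_left nhdsWithin_le_nhds
    exact le_of_tendsto h1 (eventually_mem_nhdsWithin.mono fun ε hε => hlow ε hε)
  · rintro _ ⟨μ, hμ, rfl⟩
    exact EReal.coe_le_coe_iff.2 (hup y₀ hy₀ μ hμ)

/-- Dual feasibility evaluated along an admissible process. -/
theorem le_of_mem_dualFeasible (hf : Continuous (fun p : Eu m × U => f p.1 p.2))
    {k : Eu m → U → ℝ} {μ : ℝ} {ψ η : Eu m → ℝ} (hψ : ContDiff ℝ 1 ψ)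
    (hfeas : ∀ y ∈ Y, ∀ u : U,
      0 ≤ k y u + (ψ y₀ - ψ y) + fderiv ℝ η y (f y u) - μ ∧ 0 ≤ fderiv ℝ ψ y (f y u))
    {t : ℝ} (ht : 0 ≤ t) {p : (ℝ → Eu m) × (ℝ → U)} (hp : p ∈ admissible f Y (Icc 0 t) y₀) :
    μ ≤ k (p.1 t) (p.2 t) + fderiv ℝ η (p.1 t) (f (p.1 t) (p.2 t)) := by
  -- Integrating the second constraint up to time `t` gives `ψ y₀ ≤ ψ (p.1 t)`, so the difference in
  -- the first constraint is nonpositive.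
  have h1 := hp.2.1.integral_fderiv hf hp.1 hψ ht
  have h2 : 0 ≤ ∫ s in (0 : ℝ)..t, fderiv ℝ ψ (p.1 s) (f (p.1 s) (p.2 s)) :=
    intervalIntegral.integral_nonneg ht fun s hs => (hfeas _ (hp.2.2 s hs) _).2
  have h3 := (hfeas _ (hp.2.2 t ⟨ht, le_rfl⟩) (p.2 t)).1
  linarith

end OptControl

/-! ### The Cesàro limit -/

namespace OptControl

/-- If `S v(t)` is at most the integral of `κ` over `[t, t + S]`, the integral of `v` over `[0, T]`
is at most that of `κ`, up to a constant independent of `T`. -/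
theorem integral_le_of_moving_average {κ v : ℝ → ℝ} {S T M : ℝ} (hS : 0 < S) (hST : S ≤ T)
    (hκ : IntervalIntegrable κ volume 0 T) (hκM : ∀ t ∈ Icc 0 T, |κ t| ≤ M)
    (hv : ContinuousOn v (Icc 0 T)) (hvM : ∀ t ∈ Icc 0 T, |v t| ≤ M)
    (h : ∀ t ∈ Icc 0 (T - S), S * v t ≤ ∫ s in t..t + S, κ s) :
    ∫ t in (0 : ℝ)..T, v t ≤ (∫ t in (0 : ℝ)..T, κ t) + 3 * M * S := by
  have hT : 0 < T := hS.trans_le hST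
  have hTS : 0 ≤ T - S := sub_nonneg.2 hST
  set K : ℝ → ℝ := fun t => ∫ s in (0 : ℝ)..t, κ s with hK
  have hκab : ∀ a ∈ Icc 0 T, ∀ b ∈ Icc 0 T, IntervalIntegrable κ volume a b := fun a ha b hb =>
    hκ.mono_set (by rw [uIcc_of_le hT.le]; exact (convex_Icc 0 T).ordConnected.uIcc_subset ha hb)
  have h0 : (0 : ℝ) ∈ Icc 0 T := ⟨le_rfl, hT.le⟩
  have hKsub : ∀ a ∈ Icc 0 T, ∀ b ∈ Icc 0 T, K b - K a = ∫ s in a..b, κ s := fun a ha b hb =>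
    intervalIntegral.integral_interval_sub_left (hκab 0 h0 b hb) (hκab 0 h0 a ha)
  have hKlip : ∀ a ∈ Icc 0 T, ∀ b ∈ Icc 0 T, |K b - K a| ≤ M * |b - a| := by
    intro a ha b hb
    rw [hKsub a ha b hb]
    exact intervalIntegral.norm_integral_le_of_norm_le_const (f := κ) (C := M) fun r hr =>
      hκM r ((convex_Icc 0 T).ordConnected.uIcc_subset ha hb (uIoc_subset_uIcc hr))
  have hKc : ContinuousOn K (Icc 0 T) := by
    have := intervalIntegral.continuousOn_primitive_interval' hκ (a := 0) left_mem_uIcc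
    rwa [uIcc_of_le hT.le] at this
  have hKi : ∀ a ∈ Icc 0 T, ∀ b ∈ Icc 0 T, IntervalIntegrable K volume a b := fun a ha b hb =>
    (hKc.mono ((convex_Icc 0 T).ordConnected.uIcc_subset ha hb)).intervalIntegrable
  have hvi : ∀ a ∈ Icc 0 T, ∀ b ∈ Icc 0 T, IntervalIntegrable v volume a b := fun a ha b hb =>
    (hv.mono ((convex_Icc 0 T).ordConnected.uIcc_subset ha hb)).intervalIntegrable
  have hM0 : 0 ≤ M := (abs_nonneg _).trans (hκM 0 h0)
  have mS : S ∈ Icc 0 T := ⟨hS.le, hST⟩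
  have mT : T ∈ Icc 0 T := ⟨hT.le, le_rfl⟩
  have mTS : T - S ∈ Icc 0 T := ⟨hTS, by linarith⟩
  have hshift : IntervalIntegrable (fun t => K (t + S)) volume 0 (T - S) := by
    have hc : ContinuousOn (fun t => K (t + S)) (uIcc 0 (T - S)) := by
      rw [uIcc_of_le hTS]
      refine hKc.comp (by fun_prop) fun t ht => ?_
      constructor <;> linarith [ht.1, ht.2]
    exact hc.intervalIntegrable
  -- In terms of the primitive `K` the hypothesis is a bound by increments, whose integral
  -- telescopes to two windows of length `S` at the ends. There `K` is within `MS` of `K T` and of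
  -- `0`.
  have h1 : S * ∫ t in (0 : ℝ)..(T - S), v t ≤ ∫ t in (0 : ℝ)..(T - S), (K (t + S) - K t) := by
    rw [← intervalIntegral.integral_const_mul]
    refine intervalIntegral.integral_mono_on hTS ((hvi 0 h0 _ mTS).const_mul S)
      (hshift.sub (hKi 0 h0 _ mTS)) fun t ht => ?_
    rw [hKsub t ⟨ht.1, by linarith [ht.2]⟩ (t + S) ⟨by linarith [ht.1], by linarith [ht.2]⟩]
    exact h t ht
  have h2 : ∫ t in (0 : ℝ)..(T - S), (K (t + S) - K t) =
      (∫ t in (T - S)..T, K t) - ∫ t in (0 : ℝ)..S, K t := by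
    rw [intervalIntegral.integral_sub hshift (hKi 0 h0 _ mTS),
      intervalIntegral.integral_comp_add_right, zero_add, sub_add_cancel]
    have e1 := intervalIntegral.integral_add_adjacent_intervals (hKi 0 h0 _ mS) (hKi _ mS _ mT)
    have e2 := intervalIntegral.integral_add_adjacent_intervals (hKi 0 h0 _ mTS) (hKi _ mTS _ mT)
    linarith
  have h3 : ∫ t in (T - S)..T, K t ≤ S * (K T + M * S) := by
    have : ∫ t in (T - S)..T, K t ≤ ∫ t in (T - S)..T, (K T + M * S) := by
      refine intervalIntegral.integral_mono_on (by linarith) (hKi _ mTS _ mT)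
        intervalIntegrable_const fun t ht => ?_
      have h4 := (abs_le.1 (hKlip t ⟨by linarith [ht.1], ht.2⟩ T mT)).1
      rw [abs_of_nonneg (by linarith [ht.2])] at h4
      have : M * (T - t) ≤ M * S := mul_le_mul_of_nonneg_left (by linarith [ht.1]) hM0
      linarith
    refine this.trans_eq ?_
    rw [intervalIntegral.integral_const, smul_eq_mul]
    ring
  have h4 : -(S * (M * S)) ≤ ∫ t in (0 : ℝ)..S, K t := by
    have : ∫ t in (0 : ℝ)..S, (-(M * S)) ≤ ∫ t in (0 : ℝ)..S, K t := by
      refine intervalIntegral.integral_mono_on hS.le intervalIntegrable_const (hKi 0 h0 _ mS)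
        fun t ht => ?_
      have h4 := (abs_le.1 (hKlip 0 h0 t ⟨ht.1, ht.2.trans hST⟩)).1
      have hK0 : K 0 = 0 := intervalIntegral.integral_same
      rw [sub_zero, abs_of_nonneg ht.1, hK0] at h4
      have : M * t ≤ M * S := mul_le_mul_of_nonneg_left ht.2 hM0
      linarith
    refine le_trans (le_of_eq ?_) this
    rw [intervalIntegral.integral_const, smul_eq_mul]
    ring
  have h5 : ∫ t in (0 : ℝ)..(T - S), v t ≤ K T + 2 * M * S := by
    refine le_of_mul_le_mul_left ?_ hS
    calc _ ≤ _ := h1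
      _ ≤ S * (K T + M * S) + S * (M * S) := by rw [h2]; linarith
      _ = _ := by ring
  -- The last window, not covered by the hypothesis, accounts for the third `MS`.
  have h6 : ∫ t in (T - S)..T, v t ≤ M * S := by
    have h7 := intervalIntegral.norm_integral_le_of_norm_le_const (a := T - S) (b := T) (f := v)
      (C := M) fun r hr => hvM r
        ((convex_Icc 0 T).ordConnected.uIcc_subset mTS mT (uIoc_subset_uIcc hr))
    rw [sub_sub_cancel, abs_of_pos hS] at h7
    exact (le_abs_self _).trans h7
  have h8 := intervalIntegral.integral_add_adjacent_intervals (hvi 0 h0 _ mTS) (hvi _ mTS _ mT)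
  have h9 : K T = ∫ t in (0 : ℝ)..T, κ t := rfl
  linarith

variable {m : ℕ} {U : Type*} [MetricSpace U] [CompactSpace U] [MeasurableSpace U] [BorelSpace U]

section cesaro
variable {f : Eu m → U → Eu m} {k : Eu m → U → ℝ} {Y : Set (Eu m)} {y₀ : Eu m} {M T : ℝ}

theorem abs_integral_le_of_admissible (hM : ∀ x ∈ Y, ∀ v : U, |k x v| ≤ M) (hT : 0 ≤ T)
    {p : (ℝ → Eu m) × (ℝ → U)} (hp : p ∈ admissible f Y (Icc 0 T) y₀) :
    |∫ t in (0 : ℝ)..T, k (p.1 t) (p.2 t)| ≤ M * T := by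
  have h := intervalIntegral.norm_integral_le_of_norm_le_const (a := 0) (b := T)
    (f := fun t => k (p.1 t) (p.2 t)) (C := M) fun t ht => by
      rw [uIoc_of_le hT] at ht
      exact hM _ (hp.2.2 t ⟨ht.1.le, ht.2⟩) _
  rwa [sub_zero, abs_of_nonneg hT] at h

theorem mul_cesaroValue (hT : 0 < T) : T * cesaroValue f k Y T y₀ =
    sInf ((fun p => ∫ t in (0 : ℝ)..T, k (p.1 t) (p.2 t)) '' admissible f Y (Icc 0 T) y₀) := by
  rw [cesaroValue, ← mul_assoc, mul_one_div_cancel hT.ne', one_mul]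

theorem mul_cesaroValue_le (hM : ∀ x ∈ Y, ∀ v : U, |k x v| ≤ M) (hT : 0 < T)
    {p : (ℝ → Eu m) × (ℝ → U)} (hp : p ∈ admissible f Y (Icc 0 T) y₀) :
    T * cesaroValue f k Y T y₀ ≤ ∫ t in (0 : ℝ)..T, k (p.1 t) (p.2 t) := by
  rw [mul_cesaroValue hT]
  refine csInf_le ⟨-(M * T), ?_⟩ (mem_image_of_mem _ hp)
  rintro _ ⟨p', hp', rfl⟩
  exact (abs_le.1 (abs_integral_le_of_admissible hM hT.le hp')).1

theorem le_mul_cesaroValue (hT : 0 < T) (hne : (admissible f Y (Icc 0 T) y₀).Nonempty) {c : ℝ}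
    (h : ∀ p ∈ admissible f Y (Icc 0 T) y₀, c ≤ ∫ t in (0 : ℝ)..T, k (p.1 t) (p.2 t)) :
    c ≤ T * cesaroValue f k Y T y₀ := by
  rw [mul_cesaroValue hT]
  refine le_csInf (hne.image _) ?_
  rintro _ ⟨p', hp', rfl⟩
  exact h p' hp'

theorem abs_cesaroValue_le (hM : ∀ x ∈ Y, ∀ v : U, |k x v| ≤ M) (hT : 0 < T)
    (hne : (admissible f Y (Icc 0 T) y₀).Nonempty) : |cesaroValue f k Y T y₀| ≤ M := by
  obtain ⟨p, hp⟩ := hne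
  have h1 := (mul_cesaroValue_le hM hT hp).trans
    (abs_le.1 (abs_integral_le_of_admissible hM hT.le hp)).2
  have h2 : -(M * T) ≤ T * cesaroValue f k Y T y₀ := le_mul_cesaroValue hT ⟨p, hp⟩ fun p' hp' =>
    (abs_le.1 (abs_integral_le_of_admissible hM hT.le hp')).1
  rw [abs_le]
  constructor
  · refine le_of_mul_le_mul_left ?_ hT
    linarith
  · refine le_of_mul_le_mul_left ?_ hT
    linarith

theorem nonempty_admissible_Icc (hne : (admissible f Y (Ici 0) y₀).Nonempty) :
    (admissible f Y (Icc 0 T) y₀).Nonempty :=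
  hne.mono (admissible_mono (Icc_subset_Ici_zero T))

/-- Dynamic programming inequality for the Cesàro values. -/
theorem cesaroValue_dpp (hf : Continuous (fun p : Eu m × U => f p.1 p.2))
    (hk : Continuous (fun p : Eu m × U => k p.1 p.2)) (hM : ∀ x ∈ Y, ∀ v : U, |k x v| ≤ M)
    (hY_viable : ∀ y₀ ∈ Y, (admissible f Y (Ici 0) y₀).Nonempty) {τ : ℝ} (hτ : 0 < τ) (hT : 0 < T)
    {p : (ℝ → Eu m) × (ℝ → U)} (hp : p ∈ admissible f Y (Ici 0) y₀) :
    (τ + T) * cesaroValue f k Y (τ + T) y₀ ≤ M * τ + T * cesaroValue f k Y T (p.1 τ) := by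
  rw [← sub_le_iff_le_add']
  refine le_mul_cesaroValue hT (nonempty_admissible_Icc (hY_viable _ (hp.2.2 τ hτ.le)))
    fun q hq => ?_
  have hpτ := admissible_mono (Icc_subset_Ici_zero τ) hp
  have hadm := glue_mem_admissible hf hτ.le hp.1 (hp.2.1.continuousOn_Icc le_rfl)
    (fun t ht => hp.2.1.2 t ht.1) hpτ.2.2 hq (Icc_subset_Ici_zero (τ + T))
    (fun t ht h => ⟨sub_nonneg.2 h.le, by linarith [ht.2]⟩)
  have h1 := mul_cesaroValue_le hM (by positivity) hadm
  have hii : ∀ a b : ℝ, 0 ≤ a → 0 ≤ b → IntervalIntegrable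
      (fun t => k (glue τ p.1 q.1 t) (glue τ p.2 q.2 t)) volume a b := fun a b ha hb =>
    hadm.2.1.intervalIntegrable hk hadm.1 ha hb
  rw [← intervalIntegral.integral_add_adjacent_intervals (hii 0 τ le_rfl hτ.le)
    (hii τ (τ + T) hτ.le (by positivity))] at h1
  have h2 : ∫ t in (0 : ℝ)..τ, k (glue τ p.1 q.1 t) (glue τ p.2 q.2 t) =
      ∫ t in (0 : ℝ)..τ, k (p.1 t) (p.2 t) := by
    refine intervalIntegral.integral_congr fun t ht => ?_
    rw [uIcc_of_le hτ.le] at ht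
    simp only [glue_of_le _ _ ht.2]
  have h3 : ∫ t in τ..τ + T, k (glue τ p.1 q.1 t) (glue τ p.2 q.2 t) =
      ∫ t in (0 : ℝ)..T, k (q.1 t) (q.2 t) := by
    have h4 := intervalIntegral.integral_comp_sub_right (a := τ) (b := τ + T)
      (fun t => k (q.1 t) (q.2 t)) τ
    rw [sub_self, add_sub_cancel_left] at h4
    rw [← h4]
    refine intervalIntegral.integral_congr_ae (Eventually.of_forall fun t ht => ?_)
    rw [uIoc_of_le (by linarith)] at ht
    simp only [glue_of_lt _ _ ht.1]
  have h5 := (abs_le.1 (abs_integral_le_of_admissible hM hτ.le hpτ)).2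
  linarith

/-- After division of `cesaroValue_dpp` by `T`, the cost `Mτ` of the initial piece and the change of
horizon from `T` to `τ + T` both disappear as `T → ∞`. -/
theorem cesaroLimit_mono (hf : Continuous (fun p : Eu m × U => f p.1 p.2))
    (hk : Continuous (fun p : Eu m × U => k p.1 p.2)) (hM : ∀ x ∈ Y, ∀ v : U, |k x v| ≤ M)
    (hY_viable : ∀ y₀ ∈ Y, (admissible f Y (Ici 0) y₀).Nonempty) {V : Eu m → ℝ}
    (hlim : ∀ y₀ ∈ Y, Tendsto (fun T : ℝ => cesaroValue f k Y T y₀) atTop (𝓝 (V y₀)))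
    (hy₀ : y₀ ∈ Y) {p : (ℝ → Eu m) × (ℝ → U)} (hp : p ∈ admissible f Y (Ici 0) y₀) {τ : ℝ}
    (hτ : 0 < τ) : V y₀ ≤ V (p.1 τ) := by
  have hinv : Tendsto (fun T : ℝ => T⁻¹) atTop (𝓝 0) := tendsto_inv_atTop_zero
  have h1 : Tendsto (fun T : ℝ => (τ * T⁻¹ + 1) * cesaroValue f k Y (τ + T) y₀) atTop
      (𝓝 ((τ * 0 + 1) * V y₀)) :=
    ((hinv.const_mul τ).add_const 1).mul
      ((hlim y₀ hy₀).comp (tendsto_atTop_add_const_left _ τ tendsto_id))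
  have h2 : Tendsto (fun T : ℝ => M * τ * T⁻¹ + cesaroValue f k Y T (p.1 τ)) atTop
      (𝓝 (M * τ * 0 + V (p.1 τ))) :=
    (hinv.const_mul (M * τ)).add (hlim _ (hp.2.2 τ hτ.le))
  have h3 := le_of_tendsto_of_tendsto h1 h2 (by
    filter_upwards [eventually_gt_atTop 0] with T hT
    refine le_of_mul_le_mul_left ?_ hT
    have := cesaroValue_dpp hf hk hM hY_viable hτ hT hp
    calc _ = (τ + T) * cesaroValue f k Y (τ + T) y₀ := by field_simp
      _ ≤ _ := this
      _ = _ := by field_simp)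
  simpa using h3

/-- The integral of `∇η f` along a process is a difference of two values of `η` on the compact `Y`,
at most `2C`, and vanishes after division by `T`. -/
theorem le_cesaroLimit_of_feasible (hf : Continuous (fun p : Eu m × U => f p.1 p.2))
    (hk : Continuous (fun p : Eu m × U => k p.1 p.2)) (hY_compact : IsCompact Y)
    (hY_viable : ∀ y₀ ∈ Y, (admissible f Y (Ici 0) y₀).Nonempty) {V : Eu m → ℝ}
    (hlim : ∀ y₀ ∈ Y, Tendsto (fun T : ℝ => cesaroValue f k Y T y₀) atTop (𝓝 (V y₀)))
    (hy₀ : y₀ ∈ Y) {μ : ℝ} (hμ : μ ∈ dualFeasibleValues f k Y y₀) : μ ≤ V y₀ := by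
  obtain ⟨ψ, η, hψ, hη, hfeas⟩ := hμ
  obtain ⟨C, hC⟩ := hY_compact.exists_bound_of_continuousOn hη.continuous.continuousOn
  have hT : ∀ T : ℝ, 0 < T → μ - 2 * C * T⁻¹ ≤ cesaroValue f k Y T y₀ := by
    intro T hT
    refine le_of_mul_le_mul_left ?_ hT
    refine le_mul_cesaroValue hT (nonempty_admissible_Icc (hY_viable y₀ hy₀)) fun p hp => ?_
    have hki := hp.2.1.intervalIntegrable hk hp.1 le_rfl hT.le
    have hηi := hp.2.1.intervalIntegrable (g := fun y u => fderiv ℝ η y (f y u))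
      (continuous_fderiv_apply hf hη) hp.1 le_rfl hT.le
    have h1 : ∫ t in (0 : ℝ)..T, μ ≤ ∫ t in (0 : ℝ)..T, (k (p.1 t) (p.2 t) +
        fderiv ℝ η (p.1 t) (f (p.1 t) (p.2 t))) :=
      intervalIntegral.integral_mono_on hT.le intervalIntegrable_const (hki.add hηi) fun t ht =>
        le_of_mem_dualFeasible hf hψ hfeas ht.1 (admissible_mono (Icc_subset_Icc_right ht.2) hp)
    rw [intervalIntegral.integral_const, smul_eq_mul, sub_zero,
      intervalIntegral.integral_add hki hηi, hp.2.1.integral_fderiv hf hp.1 hη hT.le] at h1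
    have h2 := (abs_le.1 (hC _ (hp.2.2 T ⟨hT.le, le_rfl⟩))).2
    have h3 := (abs_le.1 (hC _ hy₀)).1
    have h4 : T * (μ - 2 * C * T⁻¹) = T * μ - 2 * C := by field_simp
    linarith
  have h1 : Tendsto (fun T : ℝ => μ - 2 * C * T⁻¹) atTop (𝓝 (μ - 2 * C * 0)) :=
    (tendsto_inv_atTop_zero.const_mul _).const_sub _
  have h2 := le_of_tendsto_of_tendsto h1 (hlim y₀ hy₀)
    ((eventually_gt_atTop 0).mono fun T h => hT T h)
  simpa using h2

/-- The normalized Lebesgue measure on `[0, T]`. -/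
def uniformTime (T : ℝ) : Measure ℝ := ENNReal.ofReal (1 / T) • volume.restrict (Icc 0 T)

theorem isProbabilityMeasure_uniformTime (hT : 0 < T) : IsProbabilityMeasure (uniformTime T) := by
  constructor
  rw [uniformTime, Measure.smul_apply, Measure.restrict_apply_univ, Real.volume_Icc, sub_zero,
    smul_eq_mul, ← ENNReal.ofReal_mul (by positivity), one_div_mul_cancel hT.ne',
    ENNReal.ofReal_one]

theorem uniformTime_compl : uniformTime T (Icc 0 T)ᶜ = 0 := by
  rw [uniformTime, Measure.smul_apply, Measure.restrict_apply measurableSet_Icc.compl]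
  simp

theorem uniformTime_apply {s : Set ℝ} (hs : s ⊆ Icc 0 T) :
    uniformTime T s = ENNReal.ofReal (1 / T) * volume s := by
  rw [uniformTime, Measure.smul_apply, Measure.restrict_eq_self _ hs, smul_eq_mul]

theorem integral_uniformTime (hT : 0 < T) (g : ℝ → ℝ) :
    ∫ t, g t ∂(uniformTime T) = T⁻¹ * ∫ t in (0 : ℝ)..T, g t := by
  rw [uniformTime, integral_smul_measure, ENNReal.toReal_ofReal (by positivity), smul_eq_mul,
    one_div, intervalIntegral.integral_of_le hT.le, integral_Icc_eq_integral_Ioc]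

/-- Excludes the degenerate case of `rhoHausdorff`, in which an empty set would count as close to
every measure. -/
theorem occupMeasures_nonempty (hT : 0 < T) (hY_nonempty : Y.Nonempty)
    (hY_viable : ∀ y₀ ∈ Y, (admissible f Y (Ici 0) y₀).Nonempty) :
    (occupMeasures f Y T).Nonempty := by
  obtain ⟨y₀, hy₀⟩ := id hY_nonempty
  obtain ⟨p, hp⟩ := nonempty_admissible_Icc (T := T) (hY_viable y₀ hy₀)
  have := isProbabilityMeasure_uniformTime hT
  obtain ⟨γ, hγ⟩ := exists_occupation hY_nonempty measurableSet_Icc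
    (hp.2.1.continuousOn_Icc le_rfl) hp.2.2 hp.1 (uniformTime_compl (T := T))
  refine ⟨γ, y₀, hy₀, p, hp, fun Q hQ => ?_⟩
  rw [hγ Q hQ, uniformTime_apply fun t ht => ht.1]

theorem integral_occupMeasures (hT : 0 < T) (hY_nonempty : Y.Nonempty)
    {γ : ProbabilityMeasure (Y × U)} (hγ : γ ∈ occupMeasures f Y T) :
    ∃ y₀ ∈ Y, ∃ p ∈ admissible f Y (Icc 0 T) y₀, ∀ g : Eu m → U → ℝ,
      Continuous (fun p : Y × U => g p.1 p.2) → ∫ p : Y × U, g p.1 p.2 ∂(γ : Measure (Y × U)) =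
        T⁻¹ * ∫ t in (0 : ℝ)..T, g (p.1 t) (p.2 t) := by
  obtain ⟨y₀, hy₀, p, hp, h⟩ := hγ
  refine ⟨y₀, hy₀, p, hp, fun g hg => ?_⟩
  rw [← integral_uniformTime hT]
  refine integral_eq_of_occupation hY_nonempty measurableSet_Icc
    (hp.2.1.continuousOn_Icc le_rfl) hp.2.2 hp.1 (uniformTime_compl (T := T)) (fun Q hQ => ?_) hg
  rw [h Q hQ, uniformTime_apply fun t ht => ht.1]

theorem continuous_sub_restrict (hk : Continuous (fun p : Eu m × U => k p.1 p.2)) {V : Eu m → ℝ}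
    (hV : ContinuousOn V Y) : Continuous (fun p : Y × U => k p.1 p.2 - V p.1) := by
  have h1 : Continuous fun p : Y × U => V p.1 :=
    (continuousOn_iff_continuous_domRestrict.1 hV).comp continuous_fst
  exact (hk.comp (by fun_prop : Continuous fun p : Y × U => ((p.1 : Eu m), p.2))).sub h1

/-- The horizon `S` stays fixed while `T → ∞`. Every tail of a process is admissible for its current
state, so the value at that state is at most the cost of the next window, and
`integral_le_of_moving_average` applies with an error independent of `T`. Continuity of the value
makes the integrand a legitimate test function. -/
theorem cesaro_stationary_nonneg (hf : Continuous (fun p : Eu m × U => f p.1 p.2))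
    (hk : Continuous (fun p : Eu m × U => k p.1 p.2)) (hM : ∀ x ∈ Y, ∀ v : U, |k x v| ≤ M)
    (hY_nonempty : Y.Nonempty) (hY_compact : IsCompact Y)
    (hY_viable : ∀ y₀ ∈ Y, (admissible f Y (Ici 0) y₀).Nonempty) {q : ℕ → Y × U → ℝ}
    (hq : IsTestSequence q)
    (hlim : Tendsto (fun T : ℝ => rhoHausdorff q (coMeasures (occupMeasures f Y T))
      (stationaryMeasures f Y)) atTop (𝓝 0)) {S : ℝ} (hS : 0 < S)
    (hc : ContinuousOn (cesaroValue f k Y S) Y) :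
    ∀ γ ∈ stationaryMeasures f Y,
      0 ≤ ∫ p : Y × U, k p.1 p.2 - cesaroValue f k Y S p.1 ∂(γ : Measure (Y × U)) := by
  have : CompactSpace Y := isCompact_iff_compactSpace.1 hY_compact
  have hcont := continuous_sub_restrict hk hc
  refine integral_nonneg_of_tendsto hq hlim
    ((eventually_gt_atTop 0).mono fun T hT => occupMeasures_nonempty hT hY_nonempty hY_viable)
    hcont (c := fun T => -(3 * M * S) * T⁻¹) 
    (by simpa using (tendsto_inv_atTop_zero (𝕜 := ℝ)).const_mul (-(3 * M * S))) ?_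
  filter_upwards [eventually_ge_atTop S] with T hST γ hγ
  have hT : 0 < T := hS.trans_le hST
  obtain ⟨y₀, hy₀, p, hp, hint⟩ := integral_occupMeasures hT hY_nonempty hγ
  rw [hint (fun y u => k y u - cesaroValue f k Y S y) hcont, mul_comm]
  refine mul_le_mul_of_nonneg_left ?_ (inv_nonneg.2 hT.le)
  have hv : ContinuousOn (fun t => cesaroValue f k Y S (p.1 t)) (Icc 0 T) :=
    hc.comp (hp.2.1.continuousOn_Icc le_rfl) hp.2.2
  have hκ := hp.2.1.intervalIntegrable hk hp.1 le_rfl hT.le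
  have h1 := integral_le_of_moving_average hS hST hκ (fun t ht => hM _ (hp.2.2 t ht) _) hv
    (fun t ht => abs_cesaroValue_le hM hS (nonempty_admissible_Icc (hY_viable _ (hp.2.2 t ht))))
    (fun t ht => by
      have h2 := mul_cesaroValue_le hM hS (shift_mem_admissible hf ht.1 hp (J := Icc 0 S)
        fun s hs => ⟨add_nonneg ht.1 hs.1, by linarith [ht.2, hs.2]⟩)
      rwa [intervalIntegral.integral_comp_add_left (fun s => k (p.1 s) (p.2 s)), add_zero] at h2)
  rw [intervalIntegral.integral_sub hκ (ContinuousOn.intervalIntegrable (by rwa [uIcc_of_le hT.le]))]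
  linarith

/-- Passage to the limit in the value functions under the integral. -/
theorem stationary_nonneg_of_tendsto (hk : Continuous (fun p : Eu m × U => k p.1 p.2))
    (hM : ∀ x ∈ Y, ∀ v : U, |k x v| ≤ M) {ι : Type*} {l : Filter ι} [l.NeBot]
    [l.IsCountablyGenerated] {v : ι → Eu m → ℝ} {V : Eu m → ℝ}
    (hv : ∀ᶠ i in l, ContinuousOn (v i) Y) (hvM : ∀ᶠ i in l, ∀ y ∈ Y, |v i y| ≤ M)
    (hlim : ∀ y ∈ Y, Tendsto (fun i => v i y) l (𝓝 (V y))) {γ : ProbabilityMeasure (Y × U)}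
    (h : ∀ᶠ i in l, 0 ≤ ∫ p : Y × U, k p.1 p.2 - v i p.1 ∂(γ : Measure (Y × U))) :
    0 ≤ ∫ p : Y × U, k p.1 p.2 - V p.1 ∂(γ : Measure (Y × U)) := by
  refine ge_of_tendsto (tendsto_integral_filter_of_dominated_convergence (fun _ => M + M)
    (hv.mono fun i hi => (continuous_sub_restrict hk hi).measurable.aestronglyMeasurable)
    (hvM.mono fun i hi => Eventually.of_forall fun p => ?_) (integrable_const _)
    (Eventually.of_forall fun p => (hlim p.1 p.1.2).const_sub _)) h
  exact (abs_sub _ _).trans (add_le_add (hM _ p.1.2 _) (hi _ p.1.2))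

end cesaro

theorem CesaroHypotheses.eq_dStar {f : Eu m → U → Eu m} {k : Eu m → U → ℝ} {Y : Set (Eu m)}
    (hf : Continuous (fun p : Eu m × U => f p.1 p.2)) {L : ℝ≥0}
    (hf_lip : ∀ u : U, LipschitzWith L (fun y => f y u))
    (hk : Continuous (fun p : Eu m × U => k p.1 p.2)) (hY_nonempty : Y.Nonempty)
    (hY_compact : IsCompact Y) (hY_closure : closure (interior Y) = Y)
    (hY_viable : ∀ y₀ ∈ Y, (admissible f Y (Ici 0) y₀).Nonempty) {q : ℕ → Y × U → ℝ}
    (hq : IsTestSequence q) {V : Eu m → ℝ} (h : CesaroHypotheses f k Y q V) :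
    ∀ y₀ ∈ Y, (V y₀ : EReal) = dStar f k Y y₀ := by
  obtain ⟨M, -, hM⟩ := exists_bound_comp hk hY_compact
  refine OptControl.eq_dStar hf hf_lip hk hY_nonempty hY_compact hY_closure hY_viable h.smooth
    (fun y₀ hy₀ p hp τ hτ => cesaroLimit_mono hf hk hM hY_viable h.limit hy₀ hp hτ)
    (fun γ hγ => ?_)
    (fun y₀ hy₀ μ hμ => le_cesaroLimit_of_feasible hf hk hY_compact hY_viable h.limit hy₀ hμ)
  refine stationary_nonneg_of_tendsto hk hM
    ((eventually_gt_atTop 0).mono fun T hT => h.continuous_value T hT)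
    ((eventually_gt_atTop 0).mono fun T hT y hy =>
      abs_cesaroValue_le hM hT (nonempty_admissible_Icc (hY_viable y hy))) h.limit
    ((eventually_gt_atTop 0).mono fun T hT => cesaro_stationary_nonneg hf hk hM hY_nonempty
      hY_compact hY_viable hq h.occup_limit hT (h.continuous_value T hT) γ hγ)

end OptControl

/-! ### Exponential times -/

namespace OptControl

/-- The exponential distribution with parameter `lam` on the time axis. -/
def expTime (lam : ℝ) : Measure ℝ :=
  (volume.restrict (Ici 0)).withDensity fun t => ENNReal.ofReal (lam * Real.exp (-lam * t))

section expTime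
variable {lam : ℝ}

theorem measurable_expDensity (lam : ℝ) :
    Measurable fun t : ℝ => ENNReal.ofReal (lam * Real.exp (-lam * t)) := by fun_prop

theorem expTime_apply {s : Set ℝ} (hs : s ⊆ Ici 0) (hl : 0 < lam) :
    expTime lam s = ENNReal.ofReal lam * ∫⁻ t in s, ENNReal.ofReal (Real.exp (-lam * t)) := by
  rw [expTime, withDensity_apply', Measure.restrict_restrict' measurableSet_Ici,
    inter_eq_left.2 hs, ← lintegral_const_mul _ (by fun_prop)]
  simp only [ENNReal.ofReal_mul hl.le]

theorem expTime_compl : expTime lam (Ici 0)ᶜ = 0 := by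
  rw [expTime, withDensity_apply', Measure.restrict_restrict' measurableSet_Ici, compl_inter_self]
  simp

theorem ae_pos_expTime : ∀ᵐ t ∂(expTime lam), 0 < t := by
  refine (withDensity_absolutelyContinuous _ _).ae_le ?_
  rw [← Measure.restrict_congr_set Ioi_ae_eq_Ici]
  exact ae_restrict_mem measurableSet_Ioi

theorem integral_expTime (hl : 0 < lam) (g : ℝ → ℝ) :
    ∫ t, g t ∂(expTime lam) = lam * ∫ t in Ioi (0 : ℝ), Real.exp (-lam * t) * g t := by
  rw [expTime, integral_withDensity_eq_integral_toReal_smul (measurable_expDensity lam)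
    (Eventually.of_forall fun _ => ENNReal.ofReal_lt_top), integral_Ici_eq_integral_Ioi,
    ← integral_const_mul]
  refine integral_congr_ae (Eventually.of_forall fun t => ?_)
  simp only [smul_eq_mul]
  rw [ENNReal.toReal_ofReal (by positivity), mul_assoc]

theorem isProbabilityMeasure_expTime (hl : 0 < lam) : IsProbabilityMeasure (expTime lam) := by
  constructor
  have h0 := expTime_apply (lam := lam) subset_rfl hl
  rw [setLIntegral_congr Ioi_ae_eq_Ici.symm, ← ofReal_integral_eq_lintegral_ofReal
    (exp_neg_integrableOn_Ioi 0 hl) (Eventually.of_forall fun t => (Real.exp_pos _).le),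
    integral_exp_mul_Ioi (by linarith), mul_zero, Real.exp_zero, neg_div_neg_eq,
    ← ENNReal.ofReal_mul hl.le, mul_one_div_cancel hl.ne', ENNReal.ofReal_one] at h0
  have h1 := measure_add_measure_compl (μ := expTime lam) (measurableSet_Ici (a := (0 : ℝ)))
  rw [expTime_compl, add_zero, h0] at h1
  exact h1.symm

variable {g : ℝ → ℝ} {M : ℝ}

theorem integrable_expTime (hl : 0 < lam) (hg : AEStronglyMeasurable g (volume.restrict (Ici 0)))
    (hM : ∀ t, 0 < t → |g t| ≤ M) : Integrable g (expTime lam) := by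
  have := isProbabilityMeasure_expTime hl
  refine Integrable.of_bound (hg.mono_ac (withDensity_absolutelyContinuous _ _)) M ?_
  filter_upwards [ae_pos_expTime] with t ht using hM t ht

theorem abs_integral_expTime_le (hl : 0 < lam) (hM : ∀ t, 0 < t → |g t| ≤ M) :
    |∫ t, g t ∂(expTime lam)| ≤ M := by
  have := isProbabilityMeasure_expTime hl
  have h := norm_integral_le_of_norm_le_const (μ := expTime lam) (f := g) (C := M)
    (by filter_upwards [ae_pos_expTime] with t ht using hM t ht)
  simpa using h

theorem integrableOn_exp_mul (hl : 0 < lam) (hg : AEStronglyMeasurable g (volume.restrict (Ici 0)))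
    (hM : ∀ t, 0 < t → |g t| ≤ M) :
    IntegrableOn (fun t => Real.exp (-lam * t) * g t) (Ioi 0) := by
  refine Integrable.mono' ((exp_neg_integrableOn_Ioi 0 hl).mul_const M)
    ((Continuous.aestronglyMeasurable (by fun_prop)).mul
      (hg.mono_measure (Measure.restrict_mono Ioi_subset_Ici_self le_rfl))) ?_
  refine (ae_restrict_iff' measurableSet_Ioi).2 (Eventually.of_forall fun t ht => ?_)
  rw [norm_mul, Real.norm_of_nonneg (Real.exp_pos _).le]
  exact mul_le_mul_of_nonneg_left (hM t ht) (Real.exp_pos _).le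

/-- The lack of memory of the exponential distribution. -/
theorem integral_expTime_eq (hl : 0 < lam) (hg : AEStronglyMeasurable g (volume.restrict (Ici 0)))
    (hM : ∀ t, 0 < t → |g t| ≤ M) {s : ℝ} (hs : 0 ≤ s) :
    ∫ t, g t ∂(expTime lam) = lam * (∫ t in (0 : ℝ)..s, Real.exp (-lam * t) * g t) +
      Real.exp (-lam * s) * ∫ t, g (s + t) ∂(expTime lam) := by
  have hi := integrableOn_exp_mul hl hg hM
  have hsplit := setIntegral_union (Ioc_disjoint_Ioi le_rfl) measurableSet_Ioi
    (hi.mono_set (Ioc_subset_Ioi_self : Ioc 0 s ⊆ Ioi 0)) (hi.mono_set (Ioi_subset_Ioi hs))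
  rw [Ioc_union_Ioi_eq_Ioi hs] at hsplit
  rw [integral_expTime hl, integral_expTime hl, intervalIntegral.integral_of_le hs, hsplit]
  have h1 := (measurePreserving_add_left (volume : Measure ℝ) s).setIntegral_preimage_emb
    (measurableEmbedding_addLeft s) (fun t => Real.exp (-lam * t) * g t) (Ioi s)
  have h2 : (fun t => s + t) ⁻¹' Ioi s = Ioi 0 := by ext t; simp
  rw [h2] at h1
  have h3 : ∫ t in Ioi (0 : ℝ), Real.exp (-lam * (s + t)) * g (s + t) =
      Real.exp (-lam * s) * ∫ t in Ioi (0 : ℝ), Real.exp (-lam * t) * g (s + t) := by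
    rw [← integral_const_mul]
    refine integral_congr_ae (Eventually.of_forall fun t => ?_)
    simp only [mul_add, Real.exp_add, mul_assoc]
  rw [← h1, h3]
  ring

theorem mul_integral_exp (hl : 0 < lam) {s : ℝ} (hs : 0 ≤ s) :
    lam * ∫ t in (0 : ℝ)..s, Real.exp (-lam * t) = 1 - Real.exp (-lam * s) := by
  have := isProbabilityMeasure_expTime hl
  have h := integral_expTime_eq (g := fun _ => 1) (M := 1) hl aestronglyMeasurable_const (by simp) hs
  simp only [integral_const, probReal_univ, smul_eq_mul, mul_one] at h
  linarith

theorem abs_integral_exp_mul_le (hl : 0 < lam) (hM : ∀ t, 0 < t → |g t| ≤ M) {s : ℝ} (hs : 0 ≤ s) :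
    |lam * ∫ t in (0 : ℝ)..s, Real.exp (-lam * t) * g t| ≤ M * (1 - Real.exp (-lam * s)) := by
  rw [← mul_integral_exp hl hs, abs_mul, abs_of_pos hl, mul_left_comm]
  refine mul_le_mul_of_nonneg_left ?_ hl.le
  rw [← intervalIntegral.integral_const_mul, ← Real.norm_eq_abs]
  refine intervalIntegral.norm_integral_le_of_norm_le hs (Eventually.of_forall fun t ht => ?_)
    (Continuous.intervalIntegrable (by fun_prop) _ _)
  rw [norm_mul, Real.norm_of_nonneg (Real.exp_pos _).le, mul_comm]
  exact mul_le_mul_of_nonneg_right (hM t ht.1) (Real.exp_pos _).le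

theorem abs_integral_expTime_sub_le (hl : 0 < lam)
    (hg : AEStronglyMeasurable g (volume.restrict (Ici 0))) (hM : ∀ t, 0 < t → |g t| ≤ M) {s : ℝ}
    (hs : 0 ≤ s) :
    |∫ t, g t ∂(expTime lam) - Real.exp (-lam * s) * ∫ t, g (s + t) ∂(expTime lam)| ≤
      M * (1 - Real.exp (-lam * s)) := by
  rw [integral_expTime_eq hl hg hM hs, add_sub_cancel_right]
  exact abs_integral_exp_mul_le hl hM hs

theorem integral_exp_expTime (hl : 0 < lam) {ν : ℝ} (hν : 0 < ν) :
    ∫ s, Real.exp (-lam * s) ∂(expTime ν) = ν / (ν + lam) := by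
  rw [integral_expTime hν]
  have : ∀ t : ℝ, Real.exp (-ν * t) * Real.exp (-lam * t) = Real.exp (-(ν + lam) * t) := fun t => by
    rw [← Real.exp_add]; ring_nf
  simp only [this]
  rw [integral_exp_mul_Ioi (by linarith), mul_zero, Real.exp_zero, neg_div_neg_eq, mul_one_div]

/-- Averaging a bounded function over an additional exponential time changes its slow exponential
mean only slightly. -/
theorem integral_integral_expTime_le (hl : 0 < lam) {ν : ℝ} (hν : 0 < ν) (hg : Measurable g)
    (hM : ∀ t, |g t| ≤ M) :
    ∫ t, ∫ s, g (t + s) ∂(expTime ν) ∂(expTime lam) ≤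
      ∫ t, g t ∂(expTime lam) + 2 * M * (lam / ν) := by
  have := isProbabilityMeasure_expTime hl
  have := isProbabilityMeasure_expTime hν
  have hint : Integrable (Function.uncurry fun t s => g (t + s)) ((expTime lam).prod (expTime ν)) :=
    Integrable.of_bound (hg.comp (by fun_prop : Measurable fun p : ℝ × ℝ => p.1 + p.2)
      ).aestronglyMeasurable M (Eventually.of_forall fun p => hM _)
  have hM0 : 0 ≤ M := (abs_nonneg _).trans (hM 0)
  -- With the delay `s` fixed, the inner integral is a shifted exponential mean, to which the lack
  -- of memory applies.
  rw [integral_integral_swap hint]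
  have hexp : Integrable (fun s => Real.exp (-lam * s)) (expTime ν) := by
    refine integrable_expTime (M := 1) hν (Continuous.aestronglyMeasurable (by fun_prop))
      fun t ht => ?_
    rw [abs_of_pos (Real.exp_pos _), Real.exp_le_one_iff]
    nlinarith
  have hsub : Integrable (fun s => 2 * M * (1 - Real.exp (-lam * s))) (expTime ν) :=
    ((integrable_const 1).sub hexp).const_mul (2 * M)
  set A := ∫ t, g t ∂(expTime lam) with hA
  have h1 : ∫ s, ∫ t, g (t + s) ∂(expTime lam) ∂(expTime ν) ≤
      ∫ s, (A + 2 * M * (1 - Real.exp (-lam * s))) ∂(expTime ν) := by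
    refine integral_mono_ae hint.integral_prod_right
      ((integrable_const A).add hsub) ?_
    filter_upwards [ae_pos_expTime] with s hs
    have h2 := (abs_le.1 (abs_integral_expTime_sub_le hl hg.aestronglyMeasurable
      (fun t _ => hM t) hs.le)).1
    have h3 := (abs_le.1 (abs_integral_expTime_le (g := fun t => g (s + t)) hl
      fun t _ => hM (s + t))).2
    simp only [add_comm _ s]
    -- The factor `2M` arises from one `M` for the time before `s` and one for removing the factor
    -- `e ^ (-lam s)` in front of the shifted mean.
    have h4 : 0 ≤ 1 - Real.exp (-lam * s) := by
      rw [sub_nonneg, Real.exp_le_one_iff]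
      nlinarith
    have h5 := mul_le_mul_of_nonneg_left h3 h4
    linarith
  refine h1.trans ?_
  rw [integral_add (integrable_const A) hsub,
    integral_const_mul, integral_sub (integrable_const 1) hexp, integral_exp_expTime hl hν]
  simp only [integral_const, probReal_univ, smul_eq_mul, one_mul]
  gcongr
  -- The mean of `1 - e ^ (-lam s)` is `lam / (ν + lam)`, which is at most `lam / ν`.
  rw [sub_le_iff_le_add, div_add_div _ _ hν.ne' (by positivity), one_le_div (by positivity)]
  nlinarith

end expTime

variable {m : ℕ} {U : Type*} [MetricSpace U] [CompactSpace U] [MeasurableSpace U] [BorelSpace U]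

/-! ### The Abel limit -/

section abel
variable {f : Eu m → U → Eu m} {k : Eu m → U → ℝ} {Y : Set (Eu m)} {y₀ : Eu m} {M lam : ℝ}

theorem abs_le_of_admissible (hM : ∀ x ∈ Y, ∀ v : U, |k x v| ≤ M)
    {p : (ℝ → Eu m) × (ℝ → U)} (hp : p ∈ admissible f Y (Ici 0) y₀) (t : ℝ) (ht : 0 < t) :
    |k (p.1 t) (p.2 t)| ≤ M := hM _ (hp.2.2 t ht.le) _

theorem abelValue_le (hM : ∀ x ∈ Y, ∀ v : U, |k x v| ≤ M) (hl : 0 < lam)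
    {p : (ℝ → Eu m) × (ℝ → U)} (hp : p ∈ admissible f Y (Ici 0) y₀) :
    abelValue f k Y lam y₀ ≤ ∫ t, k (p.1 t) (p.2 t) ∂(expTime lam) := by
  rw [integral_expTime hl, abelValue]
  refine mul_le_mul_of_nonneg_left (csInf_le ⟨-M / lam, ?_⟩ (mem_image_of_mem _ hp)) hl.le
  rintro _ ⟨p', hp', rfl⟩
  have h := (abs_le.1 (abs_integral_expTime_le hl (abs_le_of_admissible hM hp'))).1
  rw [integral_expTime hl] at h
  rw [div_le_iff₀' hl]
  exact h

theorem le_abelValue (hl : 0 < lam) (hne : (admissible f Y (Ici 0) y₀).Nonempty) {c : ℝ}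
    (h : ∀ p ∈ admissible f Y (Ici 0) y₀, c ≤ ∫ t, k (p.1 t) (p.2 t) ∂(expTime lam)) :
    c ≤ abelValue f k Y lam y₀ := by
  rw [abelValue, ← div_le_iff₀' hl]
  refine le_csInf (hne.image _) ?_
  rintro _ ⟨p', hp', rfl⟩
  rw [div_le_iff₀' hl, ← integral_expTime hl]
  exact h p' hp'

theorem abs_abelValue_le (hM : ∀ x ∈ Y, ∀ v : U, |k x v| ≤ M) (hl : 0 < lam)
    (hne : (admissible f Y (Ici 0) y₀).Nonempty) : |abelValue f k Y lam y₀| ≤ M := by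
  obtain ⟨p, hp⟩ := hne
  exact abs_le.2 ⟨le_abelValue hl ⟨p, hp⟩ fun p' hp' =>
      (abs_le.1 (abs_integral_expTime_le hl (abs_le_of_admissible hM hp'))).1,
    (abelValue_le hM hl hp).trans
      (abs_le.1 (abs_integral_expTime_le hl (abs_le_of_admissible hM hp))).2⟩

theorem admissible_aestronglyMeasurable (hk : Continuous (fun p : Eu m × U => k p.1 p.2))
    {I : Set ℝ} {p : (ℝ → Eu m) × (ℝ → U)} (hp : p ∈ admissible f Y I y₀) :
    AEStronglyMeasurable (fun t => k (p.1 t) (p.2 t)) (volume.restrict (Ici 0)) :=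
  aestronglyMeasurable_comp hk measurableSet_Ici hp.2.1.1 hp.1

/-- Dynamic programming inequality for the Abel values. -/
theorem abelValue_dpp (hf : Continuous (fun p : Eu m × U => f p.1 p.2))
    (hk : Continuous (fun p : Eu m × U => k p.1 p.2)) (hM : ∀ x ∈ Y, ∀ v : U, |k x v| ≤ M)
    (hY_viable : ∀ y₀ ∈ Y, (admissible f Y (Ici 0) y₀).Nonempty) {τ : ℝ} (hτ : 0 < τ)
    (hl : 0 < lam) {p : (ℝ → Eu m) × (ℝ → U)} (hp : p ∈ admissible f Y (Ici 0) y₀) :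
    abelValue f k Y lam y₀ ≤ M * (1 - Real.exp (-lam * τ)) +
      Real.exp (-lam * τ) * abelValue f k Y lam (p.1 τ) := by
  rw [← sub_le_iff_le_add', ← div_le_iff₀' (Real.exp_pos _)]
  refine le_abelValue hl (hY_viable _ (hp.2.2 τ hτ.le)) fun q hq => ?_
  have hpτ := admissible_mono (Icc_subset_Ici_zero τ) hp
  have hadm := glue_mem_admissible hf hτ.le hp.1 (hp.2.1.continuousOn_Icc le_rfl)
    (fun t ht => hp.2.1.2 t ht.1) hpτ.2.2 hq (I := Ici 0) subset_rfl
    (fun t _ h => sub_nonneg.2 h.le)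
  have h1 := abelValue_le hM hl hadm
  have h2 := (abs_le.1 (abs_integral_expTime_sub_le hl (admissible_aestronglyMeasurable hk hadm)
    (abs_le_of_admissible hM hadm) hτ.le)).2
  have h3 : ∫ t, k (glue τ p.1 q.1 (τ + t)) (glue τ p.2 q.2 (τ + t)) ∂(expTime lam) =
      ∫ t, k (q.1 t) (q.2 t) ∂(expTime lam) := by
    refine integral_congr_ae ?_
    filter_upwards [ae_pos_expTime] with t ht
    rw [glue_of_lt _ _ (by linarith), glue_of_lt _ _ (by linarith), add_sub_cancel_left]
  rw [div_le_iff₀' (Real.exp_pos _), ← h3]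
  linarith

/-- For fixed `τ` the discount factor tends to `1` as `lam ↓ 0`, so the weight `1 - e ^ (-lam τ)` of
the initial piece in `abelValue_dpp` disappears. -/
theorem abelLimit_mono (hf : Continuous (fun p : Eu m × U => f p.1 p.2))
    (hk : Continuous (fun p : Eu m × U => k p.1 p.2)) (hM : ∀ x ∈ Y, ∀ v : U, |k x v| ≤ M)
    (hY_viable : ∀ y₀ ∈ Y, (admissible f Y (Ici 0) y₀).Nonempty) {h : Eu m → ℝ}
    (hlim : ∀ y₀ ∈ Y, Tendsto (fun lam : ℝ => abelValue f k Y lam y₀) (𝓝[>] 0) (𝓝 (h y₀)))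
    (hy₀ : y₀ ∈ Y) {p : (ℝ → Eu m) × (ℝ → U)} (hp : p ∈ admissible f Y (Ici 0) y₀) {τ : ℝ}
    (hτ : 0 < τ) : h y₀ ≤ h (p.1 τ) := by
  have hexp : Tendsto (fun lam : ℝ => Real.exp (-lam * τ)) (𝓝[>] 0) (𝓝 1) := by
    have : Continuous fun lam : ℝ => Real.exp (-lam * τ) := by fun_prop
    simpa using (this.tendsto 0).mono_left nhdsWithin_le_nhds
  have h2 := (hexp.const_sub 1 |>.const_mul M).add (hexp.mul (hlim _ (hp.2.2 τ hτ.le)))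
  have h3 := le_of_tendsto_of_tendsto (hlim y₀ hy₀) h2
    (eventually_mem_nhdsWithin.mono fun lam hl => abelValue_dpp hf hk hM hY_viable hτ hl hp)
  simpa using h3

/-- The mean of `∇η f` along a process is small for small discount rates. -/
theorem abs_integral_fderiv_expTime_le (hf : Continuous (fun p : Eu m × U => f p.1 p.2))
    (hY_compact : IsCompact Y) {η : Eu m → ℝ} (hη : ContDiff ℝ 1 η) {C : ℝ}
    (hC : ∀ y ∈ Y, |η y| ≤ C) (hl : 0 < lam) (hy₀ : y₀ ∈ Y)
    {p : (ℝ → Eu m) × (ℝ → U)} (hp : p ∈ admissible f Y (Ici 0) y₀) :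
    |∫ t, fderiv ℝ η (p.1 t) (f (p.1 t) (p.2 t)) ∂(expTime lam)| ≤ lam * (3 * C) := by
  have hcont := continuous_fderiv_apply hf hη
  obtain ⟨M, -, hM⟩ := exists_bound_comp (g := fun y u => fderiv ℝ η y (f y u)) hcont hY_compact
  have hC0 : 0 ≤ C := (abs_nonneg _).trans (hC y₀ hy₀)
  rw [integral_expTime hl, abs_mul, abs_of_pos hl]
  refine mul_le_mul_of_nonneg_left ?_ hl.le
  have hi := integrableOn_exp_mul hl
    (admissible_aestronglyMeasurable (k := fun y u => fderiv ℝ η y (f y u)) hcont hp)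
    (abs_le_of_admissible (k := fun y u => fderiv ℝ η y (f y u)) hM hp)
  refine le_of_tendsto (intervalIntegral_tendsto_integral_Ioi 0 hi tendsto_id).abs ?_
  filter_upwards [eventually_ge_atTop 0] with T hT
  simp only [id]
  -- Three terms remain, each at most `C`: the boundary terms at `T` and at `0`, and an integral
  -- against the weight `lam e ^ (-lam t)` of mass at most `1`.
  rw [hp.2.1.integral_exp_mul_fderiv hf hp.1 hη hT (-lam)]
  have hexp : Real.exp (-lam * T) ≤ 1 := by
    rw [Real.exp_le_one_iff]; nlinarith
  have h1 : |Real.exp (-lam * T) * η (p.1 T)| ≤ C := by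
    rw [abs_mul, abs_of_pos (Real.exp_pos _)]
    exact (mul_le_of_le_one_left (abs_nonneg _) hexp).trans (hC _ (hp.2.2 T hT))
  have h2 := hC y₀ hy₀
  have h3 : |∫ t in (0 : ℝ)..T, -lam * Real.exp (-lam * t) * η (p.1 t)| ≤ C := by
    have h4 := abs_integral_exp_mul_le hl (g := fun t => η (p.1 t)) (M := C)
      (fun t ht => hC _ (hp.2.2 t ht.le)) hT
    rw [← intervalIntegral.integral_const_mul] at h4
    have h5 : ∫ t in (0 : ℝ)..T, -lam * Real.exp (-lam * t) * η (p.1 t) =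
        -∫ t in (0 : ℝ)..T, lam * (Real.exp (-lam * t) * η (p.1 t)) := by
      rw [← intervalIntegral.integral_neg]
      refine intervalIntegral.integral_congr fun t _ => ?_
      ring
    rw [h5, abs_neg]
    refine h4.trans ?_
    have := Real.exp_pos (-lam * T)
    nlinarith
  refine (abs_sub _ _).trans ((add_le_add ((abs_sub _ _).trans (add_le_add h1 h2)) h3).trans_eq ?_)
  ring

/-- Dual feasibility is averaged over the exponential time. The mean of `∇η f` is `O(lam)`,
uniformly over viable processes from `y₀`. -/
theorem le_abelLimit_of_feasible (hf : Continuous (fun p : Eu m × U => f p.1 p.2))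
    (hk : Continuous (fun p : Eu m × U => k p.1 p.2)) (hM : ∀ x ∈ Y, ∀ v : U, |k x v| ≤ M)
    (hY_compact : IsCompact Y)
    (hY_viable : ∀ y₀ ∈ Y, (admissible f Y (Ici 0) y₀).Nonempty) {h : Eu m → ℝ}
    (hlim : ∀ y₀ ∈ Y, Tendsto (fun lam : ℝ => abelValue f k Y lam y₀) (𝓝[>] 0) (𝓝 (h y₀)))
    (hy₀ : y₀ ∈ Y) {μ : ℝ} (hμ : μ ∈ dualFeasibleValues f k Y y₀) : μ ≤ h y₀ := by
  obtain ⟨ψ, η, hψ, hη, hfeas⟩ := hμ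
  obtain ⟨C, hC⟩ := hY_compact.exists_bound_of_continuousOn hη.continuous.continuousOn
  have hcont := continuous_fderiv_apply hf hη
  obtain ⟨M', -, hM'⟩ := exists_bound_comp (g := fun y u => fderiv ℝ η y (f y u)) hcont hY_compact
  have hlow : ∀ lam : ℝ, 0 < lam → μ - lam * (3 * C) ≤ abelValue f k Y lam y₀ := by
    intro lam hl
    have := isProbabilityMeasure_expTime hl
    refine le_abelValue hl (hY_viable y₀ hy₀) fun p hp => ?_
    have hki := integrable_expTime hl (admissible_aestronglyMeasurable hk hp)
      (abs_le_of_admissible hM hp)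
    have hηi := integrable_expTime hl
      (admissible_aestronglyMeasurable (k := fun y u => fderiv ℝ η y (f y u)) hcont hp)
      (abs_le_of_admissible (k := fun y u => fderiv ℝ η y (f y u)) hM' hp)
    have h1 : ∫ _, μ ∂(expTime lam) ≤ ∫ t, (k (p.1 t) (p.2 t) +
        fderiv ℝ η (p.1 t) (f (p.1 t) (p.2 t))) ∂(expTime lam) := by
      refine integral_mono_ae (integrable_const μ) (hki.add hηi) ?_
      filter_upwards [ae_pos_expTime] with t ht
      exact le_of_mem_dualFeasible hf hψ hfeas ht.le
        (admissible_mono (Icc_subset_Ici_zero t) hp)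
    rw [integral_add hki hηi, integral_const, probReal_univ, one_smul] at h1
    have h2 := (abs_le.1 (abs_integral_fderiv_expTime_le hf hY_compact hη hC hl hy₀ hp)).2
    linarith
  have h1 : Tendsto (fun lam : ℝ => μ - lam * (3 * C)) (𝓝[>] 0) (𝓝 μ) := by
    have : Continuous fun lam : ℝ => μ - lam * (3 * C) := by fun_prop
    simpa using (this.tendsto 0).mono_left nhdsWithin_le_nhds
  exact le_of_tendsto_of_tendsto h1 (hlim y₀ hy₀)
    (eventually_mem_nhdsWithin.mono fun lam hl => hlow lam hl)

theorem discOccupMeasures_nonempty (hl : 0 < lam) (hY_nonempty : Y.Nonempty)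
    (hY_viable : ∀ y₀ ∈ Y, (admissible f Y (Ici 0) y₀).Nonempty) :
    (discOccupMeasures f Y lam).Nonempty := by
  obtain ⟨y₀, hy₀⟩ := id hY_nonempty
  obtain ⟨p, hp⟩ := hY_viable y₀ hy₀
  have := isProbabilityMeasure_expTime hl
  obtain ⟨γ, hγ⟩ := exists_occupation hY_nonempty measurableSet_Ici
    hp.2.1.1 hp.2.2 hp.1 (expTime_compl (lam := lam))
  refine ⟨γ, y₀, hy₀, p, hp, fun Q hQ => ?_⟩
  rw [hγ Q hQ, expTime_apply (fun t ht => ht.1) hl]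

theorem integral_discOccupMeasures (hl : 0 < lam) (hY_nonempty : Y.Nonempty)
    {γ : ProbabilityMeasure (Y × U)} (hγ : γ ∈ discOccupMeasures f Y lam) :
    ∃ y₀ ∈ Y, ∃ p ∈ admissible f Y (Ici 0) y₀, ∀ g : Eu m → U → ℝ,
      Continuous (fun p : Y × U => g p.1 p.2) → ∫ p : Y × U, g p.1 p.2 ∂(γ : Measure (Y × U)) =
        ∫ t, g (p.1 t) (p.2 t) ∂(expTime lam) := by
  obtain ⟨y₀, hy₀, p, hp, h⟩ := hγ
  refine ⟨y₀, hy₀, p, hp, fun g hg => ?_⟩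
  refine integral_eq_of_occupation hY_nonempty measurableSet_Ici
    hp.2.1.1 hp.2.2 hp.1 (expTime_compl (lam := lam)) (fun Q hQ => ?_) hg
  rw [h Q hQ, expTime_apply (fun t ht => ht.1) hl]

/-- Along a process, the mean of `k` dominates the mean of an Abel value, up to a small error. -/
theorem integral_abelValue_le (hf : Continuous (fun p : Eu m × U => f p.1 p.2))
    (hk : Continuous (fun p : Eu m × U => k p.1 p.2)) (hM : ∀ x ∈ Y, ∀ v : U, |k x v| ≤ M)
    (hY_nonempty : Y.Nonempty) (hY_viable : ∀ y₀ ∈ Y, (admissible f Y (Ici 0) y₀).Nonempty)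
    {ν : ℝ} (hν : 0 < ν) (hc : ContinuousOn (abelValue f k Y ν) Y) (hl : 0 < lam)
    {p : (ℝ → Eu m) × (ℝ → U)} (hp : p ∈ admissible f Y (Ici 0) y₀) :
    ∫ t, abelValue f k Y ν (p.1 t) ∂(expTime lam) ≤
      ∫ t, k (p.1 t) (p.2 t) ∂(expTime lam) + 2 * M * (lam / ν) := by
  have := isProbabilityMeasure_expTime hl
  have := isProbabilityMeasure_expTime hν
  obtain ⟨Φ, hΦ, hval, -⟩ := exists_measurable_lift hY_nonempty measurableSet_Ici
    hp.2.1.1 hp.2.2 hp.1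
  -- The lift makes the running cost measurable and bounded by `M` on the whole line, including
  -- negative times, where the process is unconstrained.
  set g : ℝ → ℝ := fun t => k (Φ t).1 (Φ t).2 with hg_def
  have hg : Measurable g := by
    have h1 : Continuous fun p : Y × U => k p.1 p.2 :=
      hk.comp (by fun_prop : Continuous fun p : Y × U => ((p.1 : Eu m), p.2))
    exact h1.measurable.comp hΦ
  have hgM : ∀ t, |g t| ≤ M := fun t => hM _ (Φ t).1.2 _
  have hgk : ∀ t, 0 ≤ t → g t = k (p.1 t) (p.2 t) := fun t ht => by
    rw [hg_def]
    simp only [(hval t ht).1, (hval t ht).2]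
  have h1 := integral_integral_expTime_le hl hν hg hgM
  have h2 : ∫ t, g t ∂(expTime lam) = ∫ t, k (p.1 t) (p.2 t) ∂(expTime lam) := by
    refine integral_congr_ae ?_
    filter_upwards [ae_pos_expTime] with t ht using hgk t ht.le
  rw [h2] at h1
  refine le_trans ?_ h1
  have hint : Integrable (Function.uncurry fun t s => g (t + s)) ((expTime lam).prod (expTime ν)) :=
    Integrable.of_bound (hg.comp (by fun_prop : Measurable fun p : ℝ × ℝ => p.1 + p.2)
      ).aestronglyMeasurable M (Eventually.of_forall fun p => hgM _)
  refine integral_mono_ae (integrable_expTime hl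
    ((hc.comp hp.2.1.1 hp.2.2).aestronglyMeasurable measurableSet_Ici)
    (fun t ht => abs_abelValue_le hM hν (hY_viable _ (hp.2.2 t ht.le))))
    hint.integral_prod_left ?_
  filter_upwards [ae_pos_expTime] with t ht
  -- The tail from time `t` is one competitor for the value at the current state; its discounted
  -- cost is the mean of `g (t + s)` over an exponential time `s` of rate `ν`.
  refine (abelValue_le hM hν (shift_mem_admissible hf ht.le hp (J := Ici 0)
    fun s hs => add_nonneg ht.le hs)).trans_eq (integral_congr_ae ?_)
  filter_upwards [ae_pos_expTime] with s hs
  exact (hgk _ (by positivity)).symm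

/-- The rate `ν` of the value stays fixed while the rate `lam` of the occupational measures tends to
zero, so the error `2M lam / ν` vanishes. -/
theorem abel_stationary_nonneg (hf : Continuous (fun p : Eu m × U => f p.1 p.2))
    (hk : Continuous (fun p : Eu m × U => k p.1 p.2)) (hM : ∀ x ∈ Y, ∀ v : U, |k x v| ≤ M)
    (hY_nonempty : Y.Nonempty) (hY_compact : IsCompact Y)
    (hY_viable : ∀ y₀ ∈ Y, (admissible f Y (Ici 0) y₀).Nonempty) {q : ℕ → Y × U → ℝ}
    (hq : IsTestSequence q)
    (hlim : Tendsto (fun lam : ℝ => rhoHausdorff q (coMeasures (discOccupMeasures f Y lam))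
      (stationaryMeasures f Y)) (𝓝[>] 0) (𝓝 0)) {ν : ℝ} (hν : 0 < ν)
    (hc : ContinuousOn (abelValue f k Y ν) Y) :
    ∀ γ ∈ stationaryMeasures f Y,
      0 ≤ ∫ p : Y × U, k p.1 p.2 - abelValue f k Y ν p.1 ∂(γ : Measure (Y × U)) := by
  have : CompactSpace Y := isCompact_iff_compactSpace.1 hY_compact
  have hcont := continuous_sub_restrict hk hc
  have herr : Tendsto (fun lam : ℝ => -(2 * M * (lam / ν))) (𝓝[>] 0) (𝓝 0) := by
    have : Continuous fun lam : ℝ => -(2 * M * (lam / ν)) := by fun_prop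
    simpa using (this.tendsto 0).mono_left nhdsWithin_le_nhds
  refine integral_nonneg_of_tendsto hq hlim (eventually_mem_nhdsWithin.mono fun lam hl =>
    discOccupMeasures_nonempty hl hY_nonempty hY_viable) hcont herr
    (eventually_mem_nhdsWithin.mono fun lam (hl : 0 < lam) γ hγ => ?_)
  obtain ⟨y₀, hy₀, p, hp, hint⟩ := integral_discOccupMeasures hl hY_nonempty hγ
  rw [hint (fun y u => k y u - abelValue f k Y ν y) hcont]
  have h1 := integral_abelValue_le hf hk hM hY_nonempty hY_viable hν hc hl hp
  have hi : Integrable (fun t => abelValue f k Y ν (p.1 t)) (expTime lam) := integrable_expTime hl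
    ((hc.comp hp.2.1.1 hp.2.2).aestronglyMeasurable measurableSet_Ici)
    (fun t ht => abs_abelValue_le hM hν (hY_viable _ (hp.2.2 t ht.le)))
  rw [integral_sub (integrable_expTime hl (admissible_aestronglyMeasurable hk hp)
    (abs_le_of_admissible hM hp)) hi]
  linarith

end abel

theorem AbelHypotheses.eq_dStar {f : Eu m → U → Eu m} {k : Eu m → U → ℝ} {Y : Set (Eu m)}
    (hf : Continuous (fun p : Eu m × U => f p.1 p.2)) {L : ℝ≥0}
    (hf_lip : ∀ u : U, LipschitzWith L (fun y => f y u))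
    (hk : Continuous (fun p : Eu m × U => k p.1 p.2)) (hY_nonempty : Y.Nonempty)
    (hY_compact : IsCompact Y) (hY_closure : closure (interior Y) = Y)
    (hY_viable : ∀ y₀ ∈ Y, (admissible f Y (Ici 0) y₀).Nonempty) {q : ℕ → Y × U → ℝ}
    (hq : IsTestSequence q) {h : Eu m → ℝ} (H : AbelHypotheses f k Y q h) :
    ∀ y₀ ∈ Y, (h y₀ : EReal) = dStar f k Y y₀ := by
  obtain ⟨M, -, hM⟩ := exists_bound_comp hk hY_compact
  refine OptControl.eq_dStar hf hf_lip hk hY_nonempty hY_compact hY_closure hY_viable H.smooth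
    (fun y₀ hy₀ p hp τ hτ => abelLimit_mono hf hk hM hY_viable H.limit hy₀ hp hτ)
    (fun γ hγ => ?_)
    (fun y₀ hy₀ μ hμ => le_abelLimit_of_feasible hf hk hM hY_compact hY_viable H.limit hy₀ hμ)
  exact stationary_nonneg_of_tendsto (l := 𝓝[>] (0 : ℝ)) hk hM
    (eventually_mem_nhdsWithin.mono fun lam hl => H.continuous_value lam hl)
    (eventually_mem_nhdsWithin.mono fun lam hl y hy => abs_abelValue_le hM hl (hY_viable y hy))
    H.limit (eventually_mem_nhdsWithin.mono fun lam hl => abel_stationary_nonneg hf hk hM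
      hY_nonempty hY_compact hY_viable hq H.occup_limit hl (H.continuous_value lam hl) γ hγ)

end OptControl

end

/-! ### The theorem -/

theorem theorem3p10 {m : ℕ} {U : Type*} [MetricSpace U] [CompactSpace U] [MeasurableSpace U]
    [BorelSpace U]
    (f : EuclideanSpace ℝ (Fin m) → U → EuclideanSpace ℝ (Fin m))
    (hf : Continuous (fun p : EuclideanSpace ℝ (Fin m) × U => f p.1 p.2))
    (hf_lip : ∃ L : ℝ≥0, ∀ u : U, LipschitzWith L (fun y => f y u))
    (k : EuclideanSpace ℝ (Fin m) → U → ℝ)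
    (hk : Continuous (fun p : EuclideanSpace ℝ (Fin m) × U => k p.1 p.2))
    (Y : Set (EuclideanSpace ℝ (Fin m)))
    (hY_nonempty : Y.Nonempty) (hY_compact : IsCompact Y) (hY_closure : closure (interior Y) = Y)
    (hY_viable : ∀ y₀ ∈ Y, (OptControl.admissible f Y (Ici 0) y₀).Nonempty)
    (q : ℕ → Y × U → ℝ) (hq : OptControl.IsTestSequence q) :
    (∀ V : EuclideanSpace ℝ (Fin m) → ℝ, OptControl.CesaroHypotheses f k Y q V →
      ∀ y₀ ∈ Y, (V y₀ : EReal) = OptControl.dStar f k Y y₀) ∧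
    (∀ h : EuclideanSpace ℝ (Fin m) → ℝ, OptControl.AbelHypotheses f k Y q h →
      ∀ y₀ ∈ Y, (h y₀ : EReal) = OptControl.dStar f k Y y₀) ∧
    (∀ V h : EuclideanSpace ℝ (Fin m) → ℝ, OptControl.CesaroHypotheses f k Y q V →
      OptControl.AbelHypotheses f k Y q h → ∀ y₀ ∈ Y, V y₀ = h y₀) := by
  obtain ⟨L, hL⟩ := hf_lip
  have hV : ∀ V : EuclideanSpace ℝ (Fin m) → ℝ, OptControl.CesaroHypotheses f k Y q V →
      ∀ y₀ ∈ Y, (V y₀ : EReal) = OptControl.dStar f k Y y₀ := fun _ H =>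
    H.eq_dStar hf hL hk hY_nonempty hY_compact hY_closure hY_viable hq
  have hh : ∀ h : EuclideanSpace ℝ (Fin m) → ℝ, OptControl.AbelHypotheses f k Y q h →
      ∀ y₀ ∈ Y, (h y₀ : EReal) = OptControl.dStar f k Y y₀ := fun _ H =>
    H.eq_dStar hf hL hk hY_nonempty hY_compact hY_closure hY_viable hq
  exact ⟨hV, hh, fun V h H H' y₀ hy₀ =>
    EReal.coe_eq_coe_iff.1 ((hV V H y₀ hy₀).trans (hh h H' y₀ hy₀).symm)⟩
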